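/- All graphs are finite and simple. A rectilinear drawing $\Gamma$ of a graph $G$ maps the vertices of $G$ to distinct points of the integer grid and each edge to a horizontal or vertical segment between its end-vertices that contains no other vertex. The vertices of $\Gamma$ are the vertices of $G$ (real vertices) and the points where two edges of $G$ cross; the edges of $\Gamma$ are the portions of edges of $G$ between consecutive vertices of $\Gamma$. The faces of $\Gamma$ are the connected regions into which $\Gamma$ divides the plane. $\Gamma$ is a UER-RF drawing (unit edge-length rectilinear drawing with rectangular faces) if every edge of $\Gamma$ has length $1$, every bounded face is a rectangle, and the unbounded (external) face is the complement of a rectangle. Its external cycle is the boundary of the external face, and its corners are the four corners of the external rectangle. A rotation system of $G$ prescribes, for each vertex, the clockwise cyclic order of its incident edges; $\Gamma$ preserves it if these are the clockwise orders in $\Gamma$. **Theorem.** Let $G$ be an $n$-vertex graph and $C$ a given cycle of $G$ such that $G \setminus C$ (the graph obtained by deleting the vertices of $C$) has maximum degree at most $2$. There is an algorithm that decides whether $G$ admits a UER-RF drawing whose external cycle is $C$ and constructs one if it exists. If four vertices of $C$ are prescribed to be the four corners of the drawing, the algorithm runs in $O(n^2)$ time; otherwise it runs in $O(n^4)$ time.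 In both cases the algorithm can be adapted, within the same time bound, to the question whether there is such a drawing that also preserves a given rotation system of $G$. (The graph is given by adjacency lists, and running times are on a word RAM with words of $O(\log n)$ bits.) -/

import Mathlib

/-! ## A word RAM, programmed by while-programs over registers and arrays -/

namespace WordRAM

/-- Memory: registers `reg x` and arrays `arr a`, all holding natural numbers. A program mentions
only finitely many register and array names. -/
structure State where
  reg : ℕ → ℕ
  arr : ℕ → ℕ → ℕ

/-- Expressions: constants, registers, array reads, arithmetic (subtraction is truncated),
comparisons (with value `1` for true and `0` for false). -/
inductive Expr where
  | const (k : ℕ)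
  | var (x : ℕ)
  | read (a : ℕ) (i : Expr)
  | add (e f : Expr)
  | sub (e f : Expr)
  | mul (e f : Expr)
  | lt (e f : Expr)
  | eq (e f : Expr)

namespace Expr

/-- The value of an expression. -/
def eval (s : State) : Expr → ℕ
  | const k => k
  | var x => s.reg x
  | read a i => s.arr a (i.eval s)
  | add e f => e.eval s + f.eval s
  | sub e f => e.eval s - f.eval s
  | mul e f => e.eval s * f.eval s
  | lt e f => if e.eval s < f.eval s then 1 else 0
  | eq e f => if e.eval s = f.eval s then 1 else 0

/-- Every value met while evaluating the expression (array indices included) is at most `B`,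
that is, fits into one machine word. -/
def Fits (B : ℕ) (s : State) : Expr → Prop
  | const k => k ≤ B
  | var x => s.reg x ≤ B
  | read a i => i.Fits B s ∧ s.arr a (i.eval s) ≤ B
  | add e f => e.Fits B s ∧ f.Fits B s ∧ e.eval s + f.eval s ≤ B
  | sub e f => e.Fits B s ∧ f.Fits B s
  | mul e f => e.Fits B s ∧ f.Fits B s ∧ e.eval s * f.eval s ≤ B
  | lt e f => e.Fits B s ∧ f.Fits B s ∧ 1 ≤ B
  | eq e f => e.Fits B s ∧ f.Fits B s ∧ 1 ≤ B

/-- The number of elementary operations in an expression. -/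
def cost : Expr → ℕ
  | const _ => 1
  | var _ => 1
  | read _ i => i.cost + 1
  | add e f => e.cost + f.cost + 1
  | sub e f => e.cost + f.cost + 1
  | mul e f => e.cost + f.cost + 1
  | lt e f => e.cost + f.cost + 1
  | eq e f => e.cost + f.cost + 1

end Expr

/-- Programs. Conditions count as true when their value is not `0`. -/
inductive Prog where
  | skip
  | assign (x : ℕ) (e : Expr)
  | write (a : ℕ) (i e : Expr)
  | seq (P Q : Prog)
  | branch (e : Expr) (P Q : Prog)
  | loop (e : Expr) (P : Prog)

/-- Write `k` into register `x`. -/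
def State.setReg (s : State) (x k : ℕ) : State :=
  ⟨Function.update s.reg x k, s.arr⟩

/-- Write `k` into cell `i` of array `a`. -/
def State.setArr (s : State) (a i k : ℕ) : State :=
  ⟨s.reg, Function.update s.arr a (Function.update (s.arr a) i k)⟩

/-- `Exec B P s s' t`: started in `s`, program `P` halts in `s'` after `t` steps, and all values
computed on the way are at most `B`. Every elementary operation costs one step; a program that
exceeds the word bound `B` is stuck. -/
inductive Exec (B : ℕ) : Prog → State → State → ℕ → Prop
  | skip (s : State) : Exec B .skip s s 1
  | assign (s : State) (x : ℕ) (e : Expr) (he : e.Fits B s) :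
      Exec B (.assign x e) s (s.setReg x (e.eval s)) (e.cost + 1)
  | write (s : State) (a : ℕ) (i e : Expr) (hi : i.Fits B s) (he : e.Fits B s) :
      Exec B (.write a i e) s (s.setArr a (i.eval s) (e.eval s)) (i.cost + e.cost + 1)
  | seq (s s₁ s₂ : State) (P Q : Prog) (t₁ t₂ : ℕ)
      (h₁ : Exec B P s s₁ t₁) (h₂ : Exec B Q s₁ s₂ t₂) :
      Exec B (.seq P Q) s s₂ (t₁ + t₂)
  | branch_true (s s₁ : State) (e : Expr) (P Q : Prog) (t : ℕ) (he : e.Fits B s)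
      (hv : e.eval s ≠ 0) (h : Exec B P s s₁ t) :
      Exec B (.branch e P Q) s s₁ (e.cost + 1 + t)
  | branch_false (s s₁ : State) (e : Expr) (P Q : Prog) (t : ℕ) (he : e.Fits B s)
      (hv : e.eval s = 0) (h : Exec B Q s s₁ t) :
      Exec B (.branch e P Q) s s₁ (e.cost + 1 + t)
  | loop_true (s s₁ s₂ : State) (e : Expr) (P : Prog) (t₁ t₂ : ℕ) (he : e.Fits B s)
      (hv : e.eval s ≠ 0) (h₁ : Exec B P s s₁ t₁) (h₂ : Exec B (.loop e P) s₁ s₂ t₂) :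
      Exec B (.loop e P) s s₂ (e.cost + 1 + t₁ + t₂)
  | loop_false (s : State) (e : Expr) (P : Prog) (he : e.Fits B s) (hv : e.eval s = 0) :
      Exec B (.loop e P) s s (e.cost + 1)

end WordRAM

/-! ## Rectilinear drawings -/

namespace UERRF

open Set

/-- A placement of the vertices on the integer grid. It determines the drawing, since edges are
drawn as straight segments. -/
abbrev Drawing (V : Type*) := V → ℤ × ℤ

section

variable {V : Type*}

/-- The point of the plane that represents a vertex. -/
def pt (D : Drawing V) (v : V) : ℝ × ℝ := ((D v).1, (D v).2)

/-- Distinct vertices at distinct grid points, edges horizontal or vertical segments, and no edge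
runs through a vertex that is not one of its ends. -/
structure IsRectilinear (G : SimpleGraph V) (D : Drawing V) : Prop where
  injective : Function.Injective D
  aligned : ∀ u v, G.Adj u v → (D u).1 = (D v).1 ∨ (D u).2 = (D v).2
  avoids : ∀ u v w, G.Adj u v → pt D w ∈ segment ℝ (pt D u) (pt D v) → w = u ∨ w = v

/-- A point where two different edges cross. -/
def IsCrossing (G : SimpleGraph V) (D : Drawing V) (p : ℝ × ℝ) : Prop :=
  ∃ u v u' v', G.Adj u v ∧ G.Adj u' v' ∧ s(u, v) ≠ s(u', v') ∧
    p ∈ openSegment ℝ (pt D u) (pt D v) ∧ p ∈ openSegment ℝ (pt D u') (pt D v')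

/-- Vertices of the drawing: real vertices and crossings. -/
def IsDrawingVertex (G : SimpleGraph V) (D : Drawing V) (p : ℝ × ℝ) : Prop :=
  (∃ v, p = pt D v) ∨ IsCrossing G D p

/-- Each edge of the drawing, that is, each portion of an edge of `G` between two consecutive
vertices of the drawing, has length one. -/
def HasUnitEdges (G : SimpleGraph V) (D : Drawing V) : Prop :=
  ∀ u v, G.Adj u v → ∀ p q, p ∈ segment ℝ (pt D u) (pt D v) → q ∈ segment ℝ (pt D u) (pt D v) →
    p ≠ q → IsDrawingVertex G D p → IsDrawingVertex G D q →
    (∀ r ∈ openSegment ℝ p q, ¬ IsDrawingVertex G D r) → |p.1 - q.1| + |p.2 - q.2| = 1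

/-- The set of points of the plane covered by the drawing. -/
def carrier (G : SimpleGraph V) (D : Drawing V) : Set (ℝ × ℝ) :=
  {p | (∃ v, p = pt D v) ∨ ∃ u v, G.Adj u v ∧ p ∈ segment ℝ (pt D u) (pt D v)}

/-- The faces: connected regions into which the drawing divides the plane. -/
def IsFace (G : SimpleGraph V) (D : Drawing V) (F : Set (ℝ × ℝ)) : Prop :=
  ∃ p ∈ (carrier G D)ᶜ, F = connectedComponentIn (carrier G D)ᶜ p

/-- An internal face is bounded. -/
def IsInternalFace (G : SimpleGraph V) (D : Drawing V) (F : Set (ℝ × ℝ)) : Prop :=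
  IsFace G D F ∧ Bornology.IsBounded F

/-- The external face is unbounded. -/
def IsExternalFace (G : SimpleGraph V) (D : Drawing V) (F : Set (ℝ × ℝ)) : Prop :=
  IsFace G D F ∧ ¬ Bornology.IsBounded F

/-- Unit edge-length rectilinear drawings with rectangular faces. -/
structure IsUERRF (G : SimpleGraph V) (D : Drawing V) : Prop where
  rectilinear : IsRectilinear G D
  unit_edges : HasUnitEdges G D
  internal_rect : ∀ F, IsInternalFace G D F →
    ∃ a b c d : ℝ, a < b ∧ c < d ∧ F = Ioo a b ×ˢ Ioo c d
  external_rect : ∀ F, IsExternalFace G D F →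
    ∃ a b c d : ℝ, a < b ∧ c < d ∧ F = (Icc a b ×ˢ Icc c d)ᶜ

/-- The boundary of the external face is the drawing of the closed walk `C`. -/
def HasExternalCycle (G : SimpleGraph V) (D : Drawing V) {r : V} (C : G.Walk r r) : Prop :=
  ∃ F, IsExternalFace G D F ∧
    frontier F = {p | ∃ u v, s(u, v) ∈ C.edges ∧ p ∈ segment ℝ (pt D u) (pt D v)}

/-- The four vertices `k 0, …, k 3` are placed (in whatever order) at the four corners of the
external rectangle. -/
def HasCorners (G : SimpleGraph V) (D : Drawing V) (k : Fin 4 → V) : Prop :=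
  ∃ a b c d : ℝ, a < b ∧ c < d ∧ IsExternalFace G D (Icc a b ×ˢ Icc c d)ᶜ ∧
    range (fun i => pt D (k i)) = {(a, c), (a, d), (b, c), (b, d)}

/-- The graph `G` without the vertices of `C` has maximum degree at most two. -/
def IsInnerTwoGraph (G : SimpleGraph V) {r : V} (C : G.Walk r r) : Prop :=
  ∀ v : {v : V | v ∉ C.support}, ((G.induce {v : V | v ∉ C.support}).neighborSet v).ncard ≤ 2

/-- Adjacency lists of a graph. The cyclic order of the list of `v` is read as a clockwise order
of the edges at `v`, so that the lists also present a rotation system. -/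
structure AdjLists (G : SimpleGraph V) where
  nbrs : V → List V
  nodup : ∀ v, (nbrs v).Nodup
  mem_nbrs : ∀ u v, u ∈ nbrs v ↔ G.Adj v u

/-- The direction in which one sees `q` from `p`, for different points on a common horizontal or
vertical line: north `0`, east `1`, south `2`, west `3`, hence in clockwise order. -/
def direction (p q : ℤ × ℤ) : ℕ :=
  if p.2 < q.2 then 0 else if p.1 < q.1 then 1 else if q.2 < p.2 then 2 else 3

/-- At every vertex, the clockwise cyclic order of the neighbours in the drawing is that of the
adjacency list. -/
def PreservesRotation {G : SimpleGraph V} (D : Drawing V) (A : AdjLists G) : Prop :=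
  ∀ v, ∃ l : List V, l ~r A.nbrs v ∧ (l.map fun u => direction (D v) (D u)).Pairwise (· < ·)

end

/-! ## Input, output and running time -/

/-- Cell `i` of an array filled with a list of vertices, `0` past the end. -/
def cell {n : ℕ} (l : List (Fin n)) (i : ℕ) : ℕ := (l.map Fin.val).getD i 0

/-- The initial memory. Register `0` holds `n`, register `1` the length of `C`. Array `0` holds
the degrees, array `2` the concatenation of the adjacency lists of `0, 1, …, n - 1`, array `1`
the position in array `2` where the list of a vertex begins, array `3` the vertices in the order
in which `C` visits them, array `4` the prescribed corners (if any). All the rest is `0`. -/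
def input {n : ℕ} {G : SimpleGraph (Fin n)} (A : AdjLists G) {r : Fin n} (C : G.Walk r r)
    (corners : List (Fin n)) : WordRAM.State where
  reg x := if x = 0 then n else if x = 1 then C.length else 0
  arr a i :=
    if a = 0 then ((List.finRange n).map fun v => (A.nbrs v).length).getD i 0
    else if a = 1 then
      if i < n then (((List.finRange n).take i).map fun v => (A.nbrs v).length).sum else 0
    else if a = 2 then cell ((List.finRange n).flatMap A.nbrs) i
    else if a = 3 then cell C.support.dropLast i
    else if a = 4 then cell corners i
    else 0

/-- The drawing found in the final memory: arrays `0` and `1` hold the coordinates. -/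
def output (n : ℕ) (s : WordRAM.State) : Drawing (Fin n) := fun v => (s.arr 0 v, s.arr 1 v)

/-- Started in `s`, program `P` halts within `T` steps, using words of size at most `B`. If some
drawing satisfies `Valid`, then the value of register `0` is `1` at the end and the output is such
a drawing; otherwise the value of register `0` is `0`. -/
def Solves (P : WordRAM.Prog) (B T : ℕ) {n : ℕ} (s : WordRAM.State)
    (Valid : Drawing (Fin n) → Prop) : Prop :=
  ∃ s' t, WordRAM.Exec B P s s' t ∧ t ≤ T ∧
    (s'.reg 0 = 1 ∧ Valid (output n s') ∨ s'.reg 0 = 0 ∧ ¬ ∃ D, Valid D)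

end UERRF

/-! The proof has a geometric half, a reconstruction argument and a machine model.

Geometry. After a translation a valid drawing lies in a rectangle `[0, W] × [0, H]` with `2 * (W +
H) = |C|`, and the cycle, read from some start in some orientation, is the boundary walk that leaves
the origin to the right (`IsUERRF.exists_gridDrawing`). The topological conditions become finite
integer conditions, collected in `IsGridDrawing`. Edges of the drawing have length one exactly if
every grid point inside an edge is a crossing (`IsRectilinear.isLattice`, `IsLattice.hasUnitEdges`).
Rectangular faces amount to every inner vertex lying in the middle of a straight horizontal or
vertical pair of edges. This is necessary: otherwise a single face contains two points placed
symmetrically about the vertex, and a rectangle, being convex, would contain the vertex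
(`IsUERRF.straight`). It is sufficient: an empty box can be enlarged as long as some side is not
fully covered, because by straightness a side with a gap is wholly uncovered
(`FreeBox.exists_maximal`, `IsGridDrawing.internal_component`).

Reconstruction. Fix start, orientation and width. Then the height and the positions of all vertices
of `C` are known, and at most one drawing remains. An inner vertex of degree two must be straight,
so an edge followed through such vertices keeps its line until it reaches a vertex `w` on `C` or an
inner vertex `w` of another degree. In the second case `w` has at least three neighbours, at most
two of them inside, hence a neighbour on `C`; the side on which that neighbour lies tells whether
the edge to it is horizontal or vertical, and so one coordinate of `w` is known. As `w` shares
exactly one coordinate with the first vertex of the chain, this decides the direction of the first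
edge once its initial vertex is placed (`IsGrid.looksVertical_iff`). A row-by-row sweep therefore
places everything: by straightness an inner vertex is the right end of the edge covering the unit
segment to its left or the upper end of the one covering the segment below it (`IsGrid.which`), and
its own outgoing edges label the next segments. The result is then checked against the full list of
integer conditions, so soundness does not depend on the sweep; the sweep only has to find the
drawing if there is one (`HasFullInput.coreP_iff`, `HasFullInput.coreP_complete`).

Time. A single trial consists of loops nested to depth two, thus takes `O(n ^ 2)`. Prescribed
corners leave constantly many choices of start, width and orientation; otherwise there are `O(n ^
2)` of them. Programs are written as total programs `FProg` with a denotational semantics, and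
`FProg.exists_exec` turns loop depth into running time and polynomial word size once and for all. -/

namespace WordRAM

/-! ### Total programs on the word RAM: running time and word size. -/

/-- All memory contents are at most `M`. -/
structure State.BoundedBy (s : State) (M : ℕ) : Prop where
  reg : ∀ x, s.reg x ≤ M
  arr : ∀ a i, s.arr a i ≤ M

theorem State.BoundedBy.mono {s : State} {M N : ℕ} (h : s.BoundedBy M) (hMN : M ≤ N) :
    s.BoundedBy N :=
  ⟨fun x => (h.reg x).trans hMN, fun a i => (h.arr a i).trans hMN⟩

theorem State.BoundedBy.setReg {s : State} {M : ℕ} (h : s.BoundedBy M) {x k : ℕ} (hk : k ≤ M) :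
    (s.setReg x k).BoundedBy M := by
  refine ⟨fun y => ?_, h.arr⟩
  by_cases hy : y = x
  · subst hy; simpa [State.setReg] using hk
  · simpa [State.setReg, Function.update_of_ne hy] using h.reg y

theorem State.BoundedBy.setArr {s : State} {M : ℕ} (h : s.BoundedBy M) {a i k : ℕ} (hk : k ≤ M) :
    (s.setArr a i k).BoundedBy M := by
  refine ⟨h.reg, fun b j => ?_⟩
  by_cases hb : b = a
  · subst hb
    by_cases hj : j = i
    · subst hj; simpa [State.setArr] using hk
    · simpa [State.setArr, Function.update_of_ne hj] using h.arr b j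
  · simpa [State.setArr, Function.update_of_ne hb] using h.arr b j

namespace Expr

/-- A size that controls how large the values met during an evaluation can be. -/
def sz : Expr → ℕ
  | const k => k + 1
  | var _ => 1
  | read _ i => i.sz + 1
  | add e f => e.sz + f.sz
  | sub e f => e.sz + f.sz
  | mul e f => e.sz + f.sz
  | lt e f => e.sz + f.sz
  | eq e f => e.sz + f.sz

theorem one_le_sz (e : Expr) : 1 ≤ e.sz := by
  induction e <;> simp only [sz] <;> omega

/-- Both powers are at least two, and a sum of two such numbers is at most their product. -/
theorem pow_add_pow_le {M a b : ℕ} (ha : 1 ≤ a) (hb : 1 ≤ b) :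
    (M + 2) ^ a + (M + 2) ^ b ≤ (M + 2) ^ (a + b) := by
  have h1 : 2 ≤ (M + 2) ^ a := by
    calc 2 ≤ M + 2 := by omega
      _ = (M + 2) ^ 1 := (pow_one _).symm
      _ ≤ _ := Nat.pow_le_pow_right (by omega) ha
  have h2 : 2 ≤ (M + 2) ^ b := by
    calc 2 ≤ M + 2 := by omega
      _ = (M + 2) ^ 1 := (pow_one _).symm
      _ ≤ _ := Nat.pow_le_pow_right (by omega) hb
  rw [pow_add]
  nlinarith

/-- Products add exponents, and sums are absorbed by `pow_add_pow_le`, so a size that is additive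
over the binary operations serves as the exponent. A literal `k` is at most `2 ^ k`, which accounts
for its weight. -/
theorem eval_le_pow {s : State} {M : ℕ} (h : s.BoundedBy M) (e : Expr) :
    e.eval s ≤ (M + 2) ^ e.sz := by
  have base : ∀ k, 1 ≤ k → M + 2 ≤ (M + 2) ^ k := fun k hk => by
    calc M + 2 = (M + 2) ^ 1 := (pow_one _).symm
      _ ≤ _ := Nat.pow_le_pow_right (by omega) hk
  have one : ∀ k, 1 ≤ (M + 2) ^ k := fun k => Nat.one_le_pow _ _ (by omega)
  induction e with
  | const k =>
    calc k ≤ 2 ^ k := Nat.lt_two_pow_self.le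
      _ ≤ (M + 2) ^ k := Nat.pow_le_pow_left (by omega) k
      _ ≤ _ := Nat.pow_le_pow_right (by omega) (by simp [sz])
  | var x => have := h.reg x; have := base 1 le_rfl; simp only [eval, sz]; omega
  | read a i _ =>
    have := h.arr a (i.eval s); have := base (i.sz + 1) (by omega); simp only [eval, sz]; omega
  | add e f he hf =>
    have := pow_add_pow_le (M := M) e.one_le_sz f.one_le_sz
    simp only [eval, sz]; omega
  | sub e f he hf =>
    have := pow_add_pow_le (M := M) e.one_le_sz f.one_le_sz
    simp only [eval, sz]; omega
  | mul e f he hf => simp only [eval, sz]; rw [pow_add]; exact Nat.mul_le_mul he hf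
  | lt e f he hf => have := one (e.sz + f.sz); simp only [eval, sz]; split <;> omega
  | eq e f he hf => have := one (e.sz + f.sz); simp only [eval, sz]; split <;> omega

theorem fits_of_pow_le {s : State} {M B : ℕ} (h : s.BoundedBy M) (e : Expr)
    (hB : (M + 2) ^ e.sz ≤ B) : e.Fits B s := by
  have mono : ∀ {a b : ℕ}, a ≤ b → (M + 2) ^ a ≤ (M + 2) ^ b := fun hab =>
    Nat.pow_le_pow_right (by omega) hab
  have ev := eval_le_pow h e
  induction e with
  | const k => exact ev.trans hB
  | var x => exact ev.trans hB
  | read a i ih =>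
    exact ⟨ih ((mono (by simp [sz])).trans hB) (eval_le_pow h i), ev.trans hB⟩
  | add e f he hf =>
    exact ⟨he ((mono (by simp [sz])).trans hB) (eval_le_pow h e),
      hf ((mono (by simp [sz])).trans hB) (eval_le_pow h f), ev.trans hB⟩
  | mul e f he hf =>
    exact ⟨he ((mono (by simp [sz])).trans hB) (eval_le_pow h e),
      hf ((mono (by simp [sz])).trans hB) (eval_le_pow h f), ev.trans hB⟩
  | sub e f he hf =>
    exact ⟨he ((mono (by simp [sz])).trans hB) (eval_le_pow h e),
      hf ((mono (by simp [sz])).trans hB) (eval_le_pow h f)⟩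
  | lt e f he hf =>
    exact ⟨he ((mono (by simp [sz])).trans hB) (eval_le_pow h e),
      hf ((mono (by simp [sz])).trans hB) (eval_le_pow h f),
      (Nat.one_le_pow _ _ (by omega)).trans hB⟩
  | eq e f he hf =>
    exact ⟨he ((mono (by simp [sz])).trans hB) (eval_le_pow h e),
      hf ((mono (by simp [sz])).trans hB) (eval_le_pow h f),
      (Nat.one_le_pow _ _ (by omega)).trans hB⟩

/-- A literal. -/
def isConst : Expr → Bool
  | const _ => true
  | _ => false

/-- Expressions whose value exceeds the contents of the memory by at most a constant. -/
def tame : Expr → Bool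
  | add e f => e.tame && f.isConst
  | sub e _ => e.tame
  | mul _ _ => false
  | _ => true

/-- The constant by which the value of a tame expression can exceed the contents of the memory. -/
def wt : Expr → ℕ
  | const k => k
  | add e f => e.wt + f.wt
  | sub e _ => e.wt
  | lt _ _ => 1
  | eq _ _ => 1
  | _ => 0

/-- Only tame values are ever stored, so memory contents grow additively and stay polynomial in
polynomial time. Storing products would allow repeated squaring; products remain available in
conditions and addresses. -/
theorem eval_le_of_tame {s : State} {M : ℕ} (h : s.BoundedBy M) (e : Expr) (he : e.tame = true) :
    e.eval s ≤ M + e.wt := by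
  induction e with
  | const k => simp [eval, wt]
  | var x => exact h.reg x
  | read a i _ => exact h.arr a _
  | add e f ihe ihf =>
    simp only [tame, Bool.and_eq_true] at he
    cases f with
    | const k => have := ihe he.1; simp only [eval, wt]; omega
    | _ => simp [isConst] at he
  | sub e f ihe ihf => have := ihe he; simp only [eval, wt]; omega
  | mul e f => simp [tame] at he
  | lt e f => simp only [eval, wt]; split <;> omega
  | eq e f => simp only [eval, wt]; split <;> omega

end Expr

/-- Total programs: loops run over a counter from `0` up to a bound that is a constant or the
content of register `0`, which the program does not change. -/
inductive FProg where
  | skip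
  | assign (x : ℕ) (e : Expr)
  | write (a : ℕ) (i e : Expr)
  | seq (P Q : FProg)
  | ite (e : Expr) (P Q : FProg)
  | loop (x : ℕ) (lim : Option ℕ) (P : FProg)

/-- The bound of a loop. -/
def limExpr : Option ℕ → Expr
  | none => .var 0
  | some k => .const k

/-- The number of rounds of a loop when register `0` holds `n`. -/
def limVal (n : ℕ) : Option ℕ → ℕ
  | none => n
  | some k => k

theorem limExpr_eval (s : State) (lim : Option ℕ) :
    (limExpr lim).eval s = limVal (s.reg 0) lim := by
  cases lim <;> rfl

theorem limExpr_cost (lim : Option ℕ) : (limExpr lim).cost = 1 := by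
  cases lim <;> rfl

/-- The state after `k` rounds of a loop with counter `x`. -/
def iter (f : State → State) (x : ℕ) (s : State) : ℕ → State
  | 0 => s.setReg x 0
  | k + 1 => (f (iter f x s k)).setReg x (k + 1)

namespace FProg

/-- The final state. -/
def den : FProg → State → State
  | skip, s => s
  | assign x e, s => s.setReg x (e.eval s)
  | write a i e, s => s.setArr a (i.eval s) (e.eval s)
  | seq P Q, s => Q.den (P.den s)
  | ite e P Q, s => if e.eval s ≠ 0 then P.den s else Q.den s
  | loop x lim P, s => iter P.den x s (limVal (s.reg 0) lim)

/-- Translation into while-programs. -/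
def toProg : FProg → Prog
  | skip => .skip
  | assign x e => .assign x e
  | write a i e => .write a i e
  | seq P Q => .seq P.toProg Q.toProg
  | ite e P Q => .branch e P.toProg Q.toProg
  | loop x lim P => .seq (.assign x (.const 0)) (.loop (.lt (.var x) (limExpr lim))
      (.seq P.toProg (.assign x (.add (.var x) (.const 1)))))

/-- The registers that a program may change. -/
def regs : FProg → List ℕ
  | skip => []
  | assign x _ => [x]
  | write _ _ _ => []
  | seq P Q => P.regs ++ Q.regs
  | ite _ P Q => P.regs ++ Q.regs
  | loop x _ P => x :: P.regs

/-- The arrays that a program may change. -/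
def arrs : FProg → List ℕ
  | skip => []
  | assign _ _ => []
  | write a _ _ => [a]
  | seq P Q => P.arrs ++ Q.arrs
  | ite _ P Q => P.arrs ++ Q.arrs
  | loop _ _ P => P.arrs

/-- Loop counters and register `0` are not tampered with, and only tame expressions are stored. -/
def wf : FProg → Bool
  | skip => true
  | assign x e => (x != 0) && e.tame
  | write _ _ e => e.tame
  | seq P Q => P.wf && Q.wf
  | ite _ P Q => P.wf && Q.wf
  | loop x _ P => (x != 0) && !(P.regs.contains x) && P.wf

/-- A bound for the running time and for the growth of the memory contents. -/
def tb : FProg → ℕ → ℕ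
  | skip, _ => 1
  | assign _ e, _ => e.cost + 1 + e.wt
  | write _ i e, _ => i.cost + e.cost + 1 + e.wt
  | seq P Q, n => P.tb n + Q.tb n
  | ite e P Q, n => e.cost + 1 + P.tb n + Q.tb n
  | loop _ lim P, n => limVal n lim * (P.tb n + 9) + 6

/-- A size that controls how large the values met during a run can be. -/
def sz : FProg → ℕ
  | skip => 1
  | assign _ e => e.sz
  | write _ i e => i.sz + e.sz
  | seq P Q => P.sz + Q.sz
  | ite e P Q => e.sz + P.sz + Q.sz
  | loop _ lim P => P.sz + (limExpr lim).sz + 3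

/-- Frame property: together with `den_arr` it lets later arguments carry facts about untouched
memory past a subprogram by a syntactic test. -/
theorem den_reg (P : FProg) {x : ℕ} (hx : x ∉ P.regs) (s : State) :
    (P.den s).reg x = s.reg x := by
  induction P generalizing s with
  | skip => rfl
  | assign y e => simp [regs] at hx; simp [den, State.setReg, Function.update_of_ne hx]
  | write a i e => rfl
  | seq P Q hP hQ =>
    simp [regs] at hx; simp only [den]; rw [hQ hx.2, hP hx.1]
  | ite e P Q hP hQ =>
    simp [regs] at hx; simp only [den]; split
    · exact hP hx.1 s
    · exact hQ hx.2 s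
  | loop y lim P hP =>
    simp [regs] at hx; simp only [den]
    generalize limVal (s.reg 0) lim = N
    induction N with
    | zero => simp [iter, State.setReg, Function.update_of_ne hx.1]
    | succ k ih =>
      simp only [iter, State.setReg, Function.update_of_ne hx.1]
      rw [hP hx.2, ih]

theorem den_arr (P : FProg) {a : ℕ} (ha : a ∉ P.arrs) (s : State) :
    (P.den s).arr a = s.arr a := by
  induction P generalizing s with
  | skip => rfl
  | assign y e => rfl
  | write b i e => simp [arrs] at ha; simp [den, State.setArr, Function.update_of_ne ha]
  | seq P Q hP hQ =>
    simp [arrs] at ha; simp only [den]; rw [hQ ha.2, hP ha.1]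
  | ite e P Q hP hQ =>
    simp [arrs] at ha; simp only [den]; split
    · exact hP ha.1 s
    · exact hQ ha.2 s
  | loop y lim P hP =>
    simp [arrs] at ha; simp only [den]
    generalize limVal (s.reg 0) lim = N
    induction N with
    | zero => rfl
    | succ k ih =>
      simp only [iter, State.setReg]
      rw [hP ha, ih]

/-- Register `0` supplies the loop bounds; its invariance fixes the number of rounds in advance. -/
theorem zero_notMem_regs (P : FProg) (h : P.wf = true) : 0 ∉ P.regs := by
  induction P with
  | skip => simp [regs]
  | assign x e => simp [wf] at h; simp [regs]; exact fun h' => h.1 h'.symm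
  | write a i e => simp [regs]
  | seq P Q hP hQ => simp [wf] at h; simp [regs, hP h.1, hQ h.2]
  | ite e P Q hP hQ => simp [wf] at h; simp [regs, hP h.1, hQ h.2]
  | loop x lim P hP => simp [wf] at h; simp [regs, hP h.2]; exact fun h' => h.1.1 h'.symm

theorem iter_reg_self (f : State → State) (x : ℕ) (s : State) (k : ℕ) :
    (iter f x s k).reg x = k := by
  cases k <;> simp [iter, State.setReg]

/-- A total program runs within its time bound, with polynomially bounded words. -/
theorem exec (P : FProg) (hP : P.wf = true) {n M B : ℕ} {s : State} (hs : s.BoundedBy M)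
    (hn : s.reg 0 = n) (hB : (M + P.tb n + 2) ^ P.sz ≤ B) :
    (∃ t ≤ P.tb n, Exec B P.toProg s (P.den s) t) ∧ (P.den s).BoundedBy (M + P.tb n) := by
  induction P generalizing M s with
  | skip => exact ⟨⟨1, le_rfl, .skip s⟩, hs.mono (by omega)⟩
  | assign x e =>
    simp only [wf, Bool.and_eq_true] at hP
    have ev := e.eval_le_of_tame hs hP.2
    refine ⟨⟨e.cost + 1, by simp only [tb]; omega, .assign s x e (e.fits_of_pow_le hs ?_)⟩, ?_⟩
    · exact (Nat.pow_le_pow_left (by omega) _).trans hB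
    · exact (hs.mono (by omega)).setReg (ev.trans (by simp only [tb]; omega))
  | write a i e =>
    simp only [wf] at hP
    have ev := e.eval_le_of_tame hs hP
    have le : ∀ k ≤ i.sz + e.sz, (M + 2) ^ k ≤ B := fun k hk =>
      ((Nat.pow_le_pow_left (by omega) _).trans (Nat.pow_le_pow_right (by omega) hk)).trans hB
    refine ⟨⟨i.cost + e.cost + 1, by simp only [tb]; omega,
      .write s a i e (i.fits_of_pow_le hs (le _ (by omega)))
        (e.fits_of_pow_le hs (le _ (by omega)))⟩, ?_⟩
    exact (hs.mono (by omega)).setArr (ev.trans (by simp only [tb]; omega))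
  | seq P Q ihP ihQ =>
    simp only [wf, Bool.and_eq_true] at hP
    simp only [tb, sz] at hB
    obtain ⟨⟨t₁, ht₁, e₁⟩, b₁⟩ := ihP hP.1 hs hn
      (((Nat.pow_le_pow_left (by omega) _).trans (Nat.pow_le_pow_right (by omega) (by omega))).trans
        hB)
    obtain ⟨⟨t₂, ht₂, e₂⟩, b₂⟩ := ihQ hP.2 b₁ (by rw [den_reg _ (zero_notMem_regs _ hP.1), hn])
      (((Nat.pow_le_pow_left (by omega) _).trans (Nat.pow_le_pow_right (by omega) (by omega))).trans
        hB)
    exact ⟨⟨t₁ + t₂, by simp only [tb]; omega, .seq _ _ _ _ _ _ _ e₁ e₂⟩,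
      b₂.mono (by simp only [tb]; omega)⟩
  | ite e P Q ihP ihQ =>
    simp only [wf, Bool.and_eq_true] at hP
    simp only [tb, sz] at hB
    have he : e.Fits B s := e.fits_of_pow_le hs
      (((Nat.pow_le_pow_left (by omega) _).trans (Nat.pow_le_pow_right (by omega) (by omega))).trans
        hB)
    simp only [den]
    split
    · rename_i hv
      obtain ⟨⟨t₁, ht₁, e₁⟩, b₁⟩ := ihP hP.1 hs hn
        (((Nat.pow_le_pow_left (by omega) _).trans
          (Nat.pow_le_pow_right (by omega) (by omega))).trans hB)
      exact ⟨⟨_, by simp only [tb]; omega, .branch_true _ _ _ _ _ _ he hv e₁⟩,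
        b₁.mono (by simp only [tb]; omega)⟩
    · rename_i hv
      obtain ⟨⟨t₁, ht₁, e₁⟩, b₁⟩ := ihQ hP.2 hs hn
        (((Nat.pow_le_pow_left (by omega) _).trans
          (Nat.pow_le_pow_right (by omega) (by omega))).trans hB)
      exact ⟨⟨_, by simp only [tb]; omega, .branch_false _ _ _ _ _ _ he (by simpa using hv) e₁⟩,
        b₁.mono (by simp only [tb]; omega)⟩
  | loop x lim P ihP =>
    simp only [wf, Bool.and_eq_true, bne_iff_ne, Bool.not_eq_true', List.contains_eq_mem,
      decide_eq_false_iff_not] at hP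
    obtain ⟨⟨hx0, hxP⟩, hwf⟩ := hP
    simp only [tb, sz] at hB
    set N := limVal n lim with hN
    have hden : (loop x lim P).den s = iter P.den x s N := by simp [den, hn, hN]
    rw [hden]
    have reg0 : ∀ k, (iter P.den x s k).reg 0 = n := by
      intro k
      induction k with
      | zero => simp [iter, State.setReg, Function.update_of_ne hx0.symm, hn]
      | succ k ih =>
        simp only [iter, State.setReg, Function.update_of_ne hx0.symm]
        rw [den_reg _ (zero_notMem_regs _ hwf), ih]
    have arith : ∀ k < N, k * (P.tb n + 9) + (P.tb n + 9) ≤ N * (P.tb n + 9) := by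
      intro k hk
      rw [← Nat.succ_mul]
      exact Nat.mul_le_mul_right _ hk
    have big : ∀ k < N, (M + k * (P.tb n + 9) + P.tb n + 2) ^ P.sz ≤ B := fun k hk => by
      have := arith k hk
      exact ((Nat.pow_le_pow_left (by omega) _).trans
        (Nat.pow_le_pow_right (by omega) (by omega))).trans hB
    -- The bound `tb` also controls the growth of the contents, which is additive over the rounds;
    -- hence the exponent `P.sz` is not multiplied by the number of rounds.
    have bd : ∀ k ≤ N, (iter P.den x s k).BoundedBy (M + k * (P.tb n + 9)) := by
      intro k hk
      induction k with
      | zero => simpa [iter] using hs.setReg (Nat.zero_le _)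
      | succ k ih =>
        have h1 := (ihP hwf (ih (by omega)) (reg0 k) (big k (by omega))).2
        simp only [iter]
        refine (h1.mono ?_).setReg ?_
        · rw [Nat.succ_mul]; omega
        · have : (k + 1) * 1 ≤ (k + 1) * (P.tb n + 9) := Nat.mul_le_mul_left _ (by omega)
          omega
    have fit : ∀ e : Expr, e.sz ≤ (limExpr lim).sz + 3 →
        ∀ s', s'.BoundedBy (M + N * (P.tb n + 9)) → e.Fits B s' := fun e he s' hs' =>
      e.fits_of_pow_le hs' (((Nat.pow_le_pow_left (by omega) _).trans
        (Nat.pow_le_pow_right (by omega) (by omega))).trans hB)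
    have bd' : ∀ k ≤ N, (iter P.den x s k).BoundedBy (M + N * (P.tb n + 9)) := fun k hk =>
      (bd k hk).mono (Nat.add_le_add_left (Nat.mul_le_mul_right _ hk) _)
    have hcond : ∀ k, (Expr.lt (.var x) (limExpr lim)).eval (iter P.den x s k) =
        if k < N then 1 else 0 := fun k => by
      simp only [Expr.eval, limExpr_eval, reg0, iter_reg_self, hN]
    have hfit : ∀ k ≤ N, (Expr.lt (.var x) (limExpr lim)).Fits B (iter P.den x s k) := fun k hk =>
      fit _ (by simp [Expr.sz]; omega) _ (bd' k hk)
    -- With `j` rounds to go: a round costs its body plus four for the test and four for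
    -- incrementing the counter, and the final failing test costs four.
    have run : ∀ j k, k + j = N → ∃ t ≤ j * (P.tb n + 9) + 4,
        Exec B (.loop (.lt (.var x) (limExpr lim))
          (.seq P.toProg (.assign x (.add (.var x) (.const 1)))))
          (iter P.den x s k) (iter P.den x s N) t := by
      intro j
      induction j with
      | zero =>
        intro k hk
        obtain rfl : k = N := by omega
        exact ⟨_, by simp [Expr.cost, limExpr_cost],
          .loop_false _ _ _ (hfit _ le_rfl) (by simp [hcond])⟩
      | succ j ih =>
        intro k hk
        obtain ⟨⟨t₁, ht₁, e₁⟩, b₁⟩ := ihP hwf (bd k (by omega)) (reg0 k) (big k (by omega))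
        obtain ⟨t₂, ht₂, e₂⟩ := ih (k + 1) (by omega)
        have hb : (P.den (iter P.den x s k)).BoundedBy (M + N * (P.tb n + 9)) :=
          b₁.mono (by have := arith k (by omega); omega)
        have hreg : (P.den (iter P.den x s k)).reg x = k := by
          rw [den_reg _ hxP, iter_reg_self]
        have e₃ := Exec.assign (B := B) (P.den (iter P.den x s k)) x (.add (.var x) (.const 1))
          (fit _ (by simp [Expr.sz]) _ hb)
        have hst : (P.den (iter P.den x s k)).setReg x
            ((Expr.add (.var x) (.const 1)).eval (P.den (iter P.den x s k))) =
            iter P.den x s (k + 1) := by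
          simp [Expr.eval, hreg, iter]
        rw [hst] at e₃
        refine ⟨_, ?_, .loop_true _ _ _ _ _ _ _ (hfit k (by omega)) ?_
          (.seq _ _ _ _ _ _ _ e₁ e₃) e₂⟩
        · simp only [Expr.cost, limExpr_cost]
          rw [Nat.succ_mul]
          omega
        · rw [hcond, if_pos (by omega)]; exact one_ne_zero
    obtain ⟨t, ht, e⟩ := run N 0 (by omega)
    have e₀ := Exec.assign (B := B) s x (.const 0)
      (fit _ (by simp [Expr.sz]) _ (hs.mono (by omega)))
    refine ⟨⟨_, ?_, .seq _ _ _ _ _ _ _ e₀ e⟩, (bd' N le_rfl).mono (by simp only [tb, ← hN]; omega)⟩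
    simp only [Expr.cost, tb, ← hN]
    omega

/-- The nesting depth of loops whose number of rounds is not constant. -/
def depth : FProg → ℕ
  | skip => 0
  | assign _ _ => 0
  | write _ _ _ => 0
  | seq P Q => max P.depth Q.depth
  | ite _ P Q => max P.depth Q.depth
  | loop _ none P => P.depth + 1
  | loop _ (some _) P => P.depth

/-- The constant factor in the running time. -/
def coef : FProg → ℕ
  | skip => 1
  | assign _ e => e.cost + 1 + e.wt
  | write _ i e => i.cost + e.cost + 1 + e.wt
  | seq P Q => P.coef + Q.coef
  | ite e P Q => e.cost + 1 + P.coef + Q.coef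
  | loop _ none P => P.coef + 15
  | loop _ (some k) P => k * (P.coef + 9) + 6

/-- Only a loop with `n` rounds raises the exponent; a loop with constantly many rounds changes the
coefficient. Since `1 ≤ n`, lower-order terms are absorbed by the leading power. -/
theorem tb_le (P : FProg) {n : ℕ} (hn : 1 ≤ n) : P.tb n ≤ P.coef * n ^ P.depth := by
  have one : ∀ k, 1 ≤ n ^ k := fun k => Nat.one_le_pow _ _ hn
  have up : ∀ c : ℕ, ∀ {a b : ℕ}, a ≤ b → c * n ^ a ≤ c * n ^ b := fun c _ _ hab =>
    Nat.mul_le_mul_left _ (Nat.pow_le_pow_right hn hab)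
  induction P with
  | skip => simp [tb, coef, depth]
  | assign x e => simp [tb, coef, depth]
  | write a i e => simp [tb, coef, depth]
  | seq P Q hP hQ =>
    simp only [tb, coef, depth, Nat.add_mul]
    exact Nat.add_le_add (hP.trans (up _ (le_max_left _ _))) (hQ.trans (up _ (le_max_right _ _)))
  | ite e P Q hP hQ =>
    simp only [tb, coef, depth]
    rw [Nat.add_mul, Nat.add_mul]
    have h1 := hP.trans (up P.coef (le_max_left P.depth Q.depth))
    have h2 := hQ.trans (up Q.coef (le_max_right P.depth Q.depth))
    have h3 := Nat.le_mul_of_pos_right (e.cost + 1) (one (max P.depth Q.depth))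
    omega
  | loop x lim P hP =>
    cases lim with
    | none =>
      simp only [tb, coef, depth, limVal, pow_succ]
      have h1 := Nat.mul_le_mul_left n hP
      have h2 := Nat.mul_le_mul_right n (one P.depth)
      nlinarith
    | some k =>
      simp only [tb, coef, depth, limVal]
      have h1 := Nat.mul_le_mul_left k hP
      have h2 := one P.depth
      have h3 := Nat.le_mul_of_pos_right (9 * k + 6) h2
      nlinarith

/-- A total program with loop depth `d`, started with polynomially bounded data, halts in time
`O(n ^ d)` and uses words of polynomial size; afterwards register `0` is overwritten by the
content of register `x`. -/
theorem exists_exec (P : FProg) (hP : P.wf = true) (x : ℕ) {d : ℕ} (hd : P.depth ≤ d) :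
    ∃ K : ℕ, ∀ n, 1 ≤ n → ∀ s : State, s.reg 0 = n → s.BoundedBy (n ^ 2) →
      ∃ t ≤ K * n ^ d, Exec (K * n ^ K) (.seq P.toProg (.assign 0 (.var x))) s
        ((P.den s).setReg 0 ((P.den s).reg x)) t := by
  -- One constant serves three purposes. The contents stay below `(P.coef + 3) * n ^ (d + 2)`; its
  -- power `P.sz + 1` bounds all words and gives the first two summands as factor and exponent; the
  -- rest pays for the run and the final assignment.
  set K := (P.coef + 3) ^ (P.sz + 1) + (d + 2) * (P.sz + 1) + P.coef + 2
  refine ⟨K, fun n hn s hs hM => ?_⟩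
  have one : ∀ k, 1 ≤ n ^ k := fun k => Nat.one_le_pow _ _ hn
  have htb : P.tb n ≤ P.coef * n ^ d :=
    (P.tb_le hn).trans (Nat.mul_le_mul_left _ (Nat.pow_le_pow_right hn hd))
  have hlin : n ^ 2 + P.tb n + 2 ≤ (P.coef + 3) * n ^ (d + 2) := by
    have h1 : n ^ 2 ≤ n ^ (d + 2) := Nat.pow_le_pow_right hn (by omega)
    have h2 : n ^ d ≤ n ^ (d + 2) := Nat.pow_le_pow_right hn (by omega)
    have h3 := Nat.mul_le_mul_left P.coef h2
    have h4 := one (d + 2)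
    nlinarith
  have hbig : ∀ k ≤ P.sz + 1, (n ^ 2 + P.tb n + 2) ^ k ≤ K * n ^ K := fun k hk => by
    calc (n ^ 2 + P.tb n + 2) ^ k ≤ ((P.coef + 3) * n ^ (d + 2)) ^ k := Nat.pow_le_pow_left hlin k
      _ ≤ ((P.coef + 3) * n ^ (d + 2)) ^ (P.sz + 1) :=
          Nat.pow_le_pow_right (Nat.mul_pos (by omega) (one _)) hk
      _ = (P.coef + 3) ^ (P.sz + 1) * n ^ ((d + 2) * (P.sz + 1)) := by rw [mul_pow, ← pow_mul]
      _ ≤ K * n ^ K := Nat.mul_le_mul (by simp only [K]; omega)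
          (Nat.pow_le_pow_right hn (by simp only [K]; omega))
  obtain ⟨⟨t, ht, e⟩, b⟩ := P.exec hP hM hs (hbig _ (by omega))
  have e₂ := Exec.assign (B := K * n ^ K) (P.den s) 0 (.var x)
    (Expr.fits_of_pow_le b _ ((Nat.pow_le_pow_left (by omega) _).trans
      (hbig 1 (by omega))))
  refine ⟨_, ?_, .seq _ _ _ _ _ _ _ e e₂⟩
  have h1 : (P.coef + 2) * n ^ d ≤ K * n ^ d := Nat.mul_le_mul_right _ (by simp only [K]; omega)
  have h2 := one d
  simp only [Expr.cost]
  nlinarith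

/-- Induction over the rounds of a loop. -/
theorem den_loop {x : ℕ} {lim : Option ℕ} {P : FProg} {n : ℕ}
    (Inv : ℕ → State → Prop) {s : State} (hn : s.reg 0 = n)
    (h0 : Inv 0 (s.setReg x 0))
    (hstep : ∀ k < limVal n lim, ∀ t : State, t.reg x = k →
      (∀ y, y ≠ x → y ∉ P.regs → t.reg y = s.reg y) → (∀ a ∉ P.arrs, t.arr a = s.arr a) →
      Inv k t → Inv (k + 1) ((P.den t).setReg x (k + 1))) :
    Inv (limVal n lim) ((loop x lim P).den s) := by
  simp only [den, hn]
  -- The frame conditions are proved along with the invariant, because each step may use them.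
  suffices h : ∀ k ≤ limVal n lim, Inv k (iter P.den x s k) ∧
      (∀ y, y ≠ x → y ∉ P.regs → (iter P.den x s k).reg y = s.reg y) ∧
      (∀ a ∉ P.arrs, (iter P.den x s k).arr a = s.arr a) from (h _ le_rfl).1
  intro k
  induction k with
  | zero =>
    exact fun _ => ⟨h0, fun y hy _ => by simp [iter, State.setReg, Function.update_of_ne hy],
      fun _ _ => rfl⟩
  | succ k ih =>
    intro hk
    obtain ⟨i1, i2, i3⟩ := ih (by omega)
    refine ⟨hstep k (by omega) _ (iter_reg_self _ _ _ _) i2 i3 i1, fun y hy hy' => ?_,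
      fun a ha => ?_⟩
    · simp only [iter, State.setReg, Function.update_of_ne hy]
      rw [den_reg _ hy', i2 y hy hy']
    · simp only [iter, State.setReg]
      rw [den_arr _ ha, i3 a ha]

end FProg
end WordRAM

/-! ### Scans: nested loops that fill one array. -/

namespace WordRAM

@[simp] theorem State.setReg_reg (s : State) (x k y : ℕ) :
    (s.setReg x k).reg y = if y = x then k else s.reg y := by
  simp [State.setReg, Function.update_apply]

@[simp] theorem State.setReg_arr (s : State) (x k : ℕ) : (s.setReg x k).arr = s.arr := rfl

@[simp] theorem State.setArr_reg (s : State) (a i k : ℕ) : (s.setArr a i k).reg = s.reg := rfl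

@[simp] theorem State.setArr_arr (s : State) (a i k b j : ℕ) :
    (s.setArr a i k).arr b j = if b = a ∧ j = i then k else s.arr b j := by
  by_cases hb : b = a
  · subst hb; simp [State.setArr, Function.update_apply]
  · simp [State.setArr, hb]

theorem State.setArr_arr_of_ne (s : State) {a b : ℕ} (i k : ℕ) (hb : b ≠ a) :
    (s.setArr a i k).arr b = s.arr b := by
  simp [State.setArr, Function.update_of_ne hb]

namespace Expr

/-- The expression only mentions registers in `L` and does not read array `a`. -/
def within (a : ℕ) (L : List ℕ) : Expr → Bool
  | const _ => true
  | var x => L.contains x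
  | read b i => b != a && i.within a L
  | add e f => e.within a L && f.within a L
  | sub e f => e.within a L && f.within a L
  | mul e f => e.within a L && f.within a L
  | lt e f => e.within a L && f.within a L
  | eq e f => e.within a L && f.within a L

theorem eval_congr {a : ℕ} {L : List ℕ} {s s' : State} (hr : ∀ x ∈ L, s.reg x = s'.reg x)
    (ha : ∀ b ≠ a, s.arr b = s'.arr b) (e : Expr) (he : e.within a L = true) :
    e.eval s = e.eval s' := by
  induction e with
  | const k => rfl
  | var x => exact hr x (by simpa [within] using he)
  | read b i ih =>
    simp [within] at he
    simp [eval, ih he.2, ha b he.1]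
  | add e f h1 h2 | sub e f h1 h2 | mul e f h1 h2 | lt e f h1 h2 | eq e f h1 h2 =>
    simp only [within, Bool.and_eq_true] at he
    simp [eval, h1 he.1, h2 he.2]

end Expr

/-- Nested loops that fill one array: whenever the condition `c` of an innermost instruction
`put c i v` holds, the value `v` is written into cell `i`. -/
inductive Scan where
  | put (c i v : Expr)
  | all (x : ℕ) (lim : Option ℕ) (φ : Scan)
  | bind (x : ℕ) (e : Expr) (φ : Scan)
  | guard (e : Expr) (φ : Scan)
  | both (φ ψ : Scan)

namespace Scan

/-- The program that fills array `a`. -/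
def comp (a : ℕ) : Scan → FProg
  | put c i v => .ite c (.write a i v) .skip
  | all x lim φ => .loop x lim (φ.comp a)
  | bind x e φ => .seq (.assign x e) (φ.comp a)
  | guard e φ => .ite e (φ.comp a) .skip
  | both φ ψ => .seq (φ.comp a) (ψ.comp a)

/-- Started in `s`, the scan writes value `v` into cell `i` at some moment. -/
def Hit : State → Scan → ℕ → ℕ → Prop
  | s, put c i v, j, w => c.eval s ≠ 0 ∧ i.eval s = j ∧ v.eval s = w
  | s, all x lim φ, j, w => ∃ k < limVal (s.reg 0) lim, Hit (s.setReg x k) φ j w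
  | s, bind x e φ, j, w => Hit (s.setReg x (e.eval s)) φ j w
  | s, guard e φ, j, w => e.eval s ≠ 0 ∧ Hit s φ j w
  | s, both φ ψ, j, w => Hit s φ j w ∨ Hit s ψ j w

/-- The free registers of the scan are among `L`, which contains `0`, no bound register shadows
a register in scope, and the array `a` to be filled is not read. -/
def within (a : ℕ) : List ℕ → Scan → Bool
  | L, put c i v => c.within a L && i.within a L && v.within a L && L.contains 0
  | L, all x _ φ => !(L.contains x) && L.contains 0 && within a (x :: L) φ
  | L, bind x e φ => !(L.contains x) && e.within a L && within a (x :: L) φ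
  | L, guard e φ => e.within a L && within a L φ
  | L, both φ ψ => within a L φ && within a L ψ

theorem setReg_agree {L : List ℕ} {s s' : State} (hr : ∀ x ∈ L, s.reg x = s'.reg x) (x k : ℕ) :
    ∀ y ∈ x :: L, (s.setReg x k).reg y = (s'.setReg x k).reg y := by
  intro y hy
  by_cases hyx : y = x
  · simp [hyx]
  · simp [hyx]; exact hr y (by simpa [hyx] using hy)

/-- A scan does not read the array that it fills, so its writes so far have no influence on what it
writes later; all hits may be evaluated in the initial state. -/
theorem hit_congr {a : ℕ} {L : List ℕ} (φ : Scan) (hφ : φ.within a L = true) {s s' : State}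
    (hr : ∀ x ∈ L, s.reg x = s'.reg x) (ha : ∀ b ≠ a, s.arr b = s'.arr b) (j w : ℕ) :
    Hit s φ j w ↔ Hit s' φ j w := by
  induction φ generalizing L s s' with
  | put c i v =>
    simp only [within, Bool.and_eq_true] at hφ
    simp only [Hit, Expr.eval_congr hr ha _ hφ.1.1.1, Expr.eval_congr hr ha _ hφ.1.1.2,
      Expr.eval_congr hr ha _ hφ.1.2]
  | all x lim φ ih =>
    simp only [within, Bool.and_eq_true] at hφ
    simp only [Hit, hr 0 (by simpa using hφ.1.2)]
    refine exists_congr fun k => and_congr_right fun _ => ih hφ.2 (setReg_agree hr x k) ha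
  | bind x e φ ih =>
    simp only [within, Bool.and_eq_true] at hφ
    simp only [Hit, Expr.eval_congr hr ha _ hφ.1.2]
    refine ih hφ.2 (setReg_agree hr x _) ha
  | guard e φ ih =>
    simp only [within, Bool.and_eq_true] at hφ
    simp only [Hit, Expr.eval_congr hr ha _ hφ.1, ih hφ.2 hr ha]
  | both φ ψ h1 h2 =>
    simp only [within, Bool.and_eq_true] at hφ
    simp only [Hit, h1 hφ.1 hr ha, h2 hφ.2 hr ha]

/-- After a scan, every cell that was hit holds one of the values it was hit with, and the others
are unchanged. -/
theorem comp_spec {a : ℕ} {L : List ℕ} (φ : Scan) (hφ : φ.within a L = true) (s : State) :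
    (∀ x ∈ L, ((φ.comp a).den s).reg x = s.reg x) ∧
    (∀ b ≠ a, ((φ.comp a).den s).arr b = s.arr b) ∧
    ∀ j, (∃ w, Hit s φ j w ∧ ((φ.comp a).den s).arr a j = w) ∨
      (∀ w, ¬ Hit s φ j w) ∧ ((φ.comp a).den s).arr a j = s.arr a j := by
  induction φ generalizing L s with
  | put c i v =>
    simp only [comp, FProg.den, Hit]
    by_cases hc : c.eval s = 0
    · simp [hc]
    · simp only [hc, ne_eq, not_false_eq_true, if_true, true_and]
      refine ⟨fun _ _ => rfl, fun b hb => s.setArr_arr_of_ne _ _ hb, fun j => ?_⟩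
      by_cases hj : i.eval s = j
      · left; exact ⟨_, ⟨hj, rfl⟩, by simp [hj]⟩
      · right; refine ⟨fun w hw => hj hw.1, by simp [Ne.symm hj]⟩
  | all x lim φ ih =>
    simp only [within, Bool.and_eq_true, Bool.not_eq_true', List.contains_eq_mem,
      decide_eq_false_iff_not, decide_eq_true_eq] at hφ
    obtain ⟨⟨hx, h0⟩, hφ⟩ := hφ
    have hx0 : 0 ≠ x := fun h => hx (h ▸ h0)
    simp only [comp, FProg.den, Hit]
    generalize limVal (s.reg 0) lim = N
    induction N with
    | zero =>
      simp only [iter, State.setReg_reg, State.setReg_arr]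
      refine ⟨fun y hy => if_neg ?_, fun _ _ => trivial, fun j => .inr ⟨by simp, trivial⟩⟩
      rintro rfl
      exact hx hy
    | succ k ihk =>
      obtain ⟨r, b, h⟩ := ihk
      set t := iter (φ.comp a).den x s k with ht
      have tx : t.reg x = k := FProg.iter_reg_self _ _ _ _
      obtain ⟨r', b', h'⟩ := ih hφ t
      -- Before round `k` the state differs from the initial one only in the counter, in registers
      -- out of scope and in the array being filled, none of which spoils the description of the
      -- hits by `s.setReg x k`.
      have hcong : ∀ j w, Hit t φ j w ↔ Hit (s.setReg x k) φ j w := fun j w =>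
        hit_congr φ hφ (fun y hy => by
          by_cases hyx : y = x
          · simp [hyx, tx]
          · simp [hyx]; exact r y (by simpa [hyx] using hy))
          (fun c hc => by simp [b c hc]) j w
      simp only [iter, ← ht, State.setReg_arr]
      refine ⟨fun y hy => ?_, fun c hc => by rw [b' c hc, b c hc], fun j => ?_⟩
      · have hyx : y ≠ x := fun e => hx (e ▸ hy)
        simp only [State.setReg_reg, if_neg hyx]
        rw [r' y (by simp [hy]), r y hy]
      · rcases h' j with ⟨w, hw, e⟩ | ⟨hw, e⟩
        · exact .inl ⟨w, ⟨k, by omega, (hcong j w).1 hw⟩, e⟩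
        · rcases h j with ⟨w, ⟨k', hk', hw'⟩, e'⟩ | ⟨hw', e'⟩
          · exact .inl ⟨w, ⟨k', by omega, hw'⟩, by rw [e, e']⟩
          · refine .inr ⟨fun w ⟨k', hk', hh⟩ => ?_, by rw [e, e']⟩
            rcases Nat.lt_succ_iff_lt_or_eq.1 hk' with hlt | rfl
            · exact hw' w ⟨k', hlt, hh⟩
            · exact hw w ((hcong j w).2 hh)
  | bind x e φ ih =>
    simp only [within, Bool.and_eq_true, Bool.not_eq_true', List.contains_eq_mem,
      decide_eq_false_iff_not] at hφ
    obtain ⟨⟨hx, he⟩, hφ⟩ := hφ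
    obtain ⟨r, b, h⟩ := ih hφ (s.setReg x (e.eval s))
    refine ⟨fun y hy => ?_, b, h⟩
    have hyx : y ≠ x := fun e => hx (e ▸ hy)
    simpa [comp, FProg.den, hyx] using r y (by simp [hy])
  | guard e φ ih =>
    simp only [within, Bool.and_eq_true] at hφ
    simp only [comp, FProg.den, Hit]
    by_cases he : e.eval s = 0
    · simp [he]
    · simpa [he] using ih hφ.2 s
  | both φ ψ h1 h2 =>
    simp only [within, Bool.and_eq_true] at hφ
    simp only [comp, FProg.den, Hit]
    obtain ⟨r, b, h⟩ := h1 hφ.1 s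
    obtain ⟨r', b', h'⟩ := h2 hφ.2 ((φ.comp a).den s)
    have hcong : ∀ j w, Hit ((φ.comp a).den s) ψ j w ↔ Hit s ψ j w :=
      hit_congr ψ hφ.2 r b
    refine ⟨fun x hx => by rw [r' x hx, r x hx], fun c hc => by rw [b' c hc, b c hc], fun j => ?_⟩
    rcases h' j with ⟨w, hw, e⟩ | ⟨hw, e⟩
    · exact .inl ⟨w, .inr ((hcong j w).1 hw), e⟩
    · rcases h j with ⟨w, hw', e'⟩ | ⟨hw', e'⟩
      · exact .inl ⟨w, .inl hw', by rw [e, e']⟩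
      · exact .inr ⟨fun w hh => hh.elim (hw' w) (fun hh => hw w ((hcong j w).2 hh)), by rw [e, e']⟩

end Scan
end WordRAM

/-! ### Rectilinear drawings with unit edges as integer conditions. -/

namespace UERRF

open Set

variable {V : Type*}

/-- Combinatorial form of a rectilinear drawing whose edges have length one: no vertex inside an
edge, and every grid point inside an edge lies inside a perpendicular edge. -/
structure IsLattice (G : SimpleGraph V) (D : Drawing V) : Prop where
  injective : Function.Injective D
  aligned : ∀ u v, G.Adj u v → (D u).1 = (D v).1 ∨ (D u).2 = (D v).2
  clear_h : ∀ u v w, G.Adj u v → (D u).2 = (D v).2 → (D w).2 = (D u).2 →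
    ¬ ((D u).1 < (D w).1 ∧ (D w).1 < (D v).1)
  clear_v : ∀ u v w, G.Adj u v → (D u).1 = (D v).1 → (D w).1 = (D u).1 →
    ¬ ((D u).2 < (D w).2 ∧ (D w).2 < (D v).2)
  cross_h : ∀ u v t, G.Adj u v → (D u).2 = (D v).2 → (D u).1 < t → t < (D v).1 →
    ∃ p q, G.Adj p q ∧ (D p).1 = t ∧ (D q).1 = t ∧ (D p).2 < (D u).2 ∧ (D u).2 < (D q).2
  cross_v : ∀ u v t, G.Adj u v → (D u).1 = (D v).1 → (D u).2 < t → t < (D v).2 →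
    ∃ p q, G.Adj p q ∧ (D p).2 = t ∧ (D q).2 = t ∧ (D p).1 < (D u).1 ∧ (D u).1 < (D q).1

theorem mem_segment_pt_h {D : Drawing V} {u v : V} (h : (D u).2 = (D v).2)
    (hlt : (D u).1 ≤ (D v).1) {p : ℝ × ℝ} :
    p ∈ segment ℝ (pt D u) (pt D v) ↔ p.2 = (D u).2 ∧ ((D u).1 : ℝ) ≤ p.1 ∧ p.1 ≤ (D v).1 := by
  have hle : ((D u).1 : ℝ) ≤ (D v).1 := by exact_mod_cast hlt
  obtain ⟨a, b⟩ := p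
  simp only [pt, ← h]
  rw [← Prod.image_mk_segment_left, segment_eq_Icc hle]
  simp only [mem_image, mem_Icc, Prod.mk.injEq]
  constructor
  · rintro ⟨x, hx, rfl, rfl⟩; exact ⟨rfl, hx⟩
  · rintro ⟨rfl, hx⟩; exact ⟨a, hx, rfl, rfl⟩

theorem mem_segment_pt_v {D : Drawing V} {u v : V} (h : (D u).1 = (D v).1)
    (hlt : (D u).2 ≤ (D v).2) {p : ℝ × ℝ} :
    p ∈ segment ℝ (pt D u) (pt D v) ↔ p.1 = (D u).1 ∧ ((D u).2 : ℝ) ≤ p.2 ∧ p.2 ≤ (D v).2 := by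
  have hle : ((D u).2 : ℝ) ≤ (D v).2 := by exact_mod_cast hlt
  obtain ⟨a, b⟩ := p
  simp only [pt, ← h]
  rw [← Prod.image_mk_segment_right, segment_eq_Icc hle]
  simp only [mem_image, mem_Icc, Prod.mk.injEq]
  constructor
  · rintro ⟨x, hx, rfl, rfl⟩; exact ⟨rfl, hx⟩
  · rintro ⟨rfl, hx⟩; exact ⟨b, hx, rfl, rfl⟩

theorem mem_openSegment_h {a b y : ℝ} (hlt : a < b) {p : ℝ × ℝ} :
    p ∈ openSegment ℝ (a, y) (b, y) ↔ p.2 = y ∧ a < p.1 ∧ p.1 < b := by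
  obtain ⟨c, d⟩ := p
  rw [← Prod.image_mk_openSegment_left, openSegment_eq_Ioo hlt]
  simp only [mem_image, mem_Ioo, Prod.mk.injEq]
  constructor
  · rintro ⟨x, hx, rfl, rfl⟩; exact ⟨rfl, hx⟩
  · rintro ⟨rfl, hx⟩; exact ⟨c, hx, rfl, rfl⟩

theorem mem_openSegment_v {a b y : ℝ} (hlt : a < b) {p : ℝ × ℝ} :
    p ∈ openSegment ℝ (y, a) (y, b) ↔ p.1 = y ∧ a < p.2 ∧ p.2 < b := by
  obtain ⟨c, d⟩ := p
  rw [← Prod.image_mk_openSegment_right, openSegment_eq_Ioo hlt]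
  simp only [mem_image, mem_Ioo, Prod.mk.injEq]
  constructor
  · rintro ⟨x, hx, rfl, rfl⟩; exact ⟨rfl, hx⟩
  · rintro ⟨rfl, hx⟩; exact ⟨d, hx, rfl, rfl⟩

theorem mem_openSegment_pt_h {D : Drawing V} {u v : V} (h : (D u).2 = (D v).2)
    (hlt : (D u).1 < (D v).1) {p : ℝ × ℝ} :
    p ∈ openSegment ℝ (pt D u) (pt D v) ↔
      p.2 = (D u).2 ∧ ((D u).1 : ℝ) < p.1 ∧ p.1 < (D v).1 := by
  simp only [pt, ← h]
  exact mem_openSegment_h (by exact_mod_cast hlt)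

theorem mem_openSegment_pt_v {D : Drawing V} {u v : V} (h : (D u).1 = (D v).1)
    (hlt : (D u).2 < (D v).2) {p : ℝ × ℝ} :
    p ∈ openSegment ℝ (pt D u) (pt D v) ↔
      p.1 = (D u).1 ∧ ((D u).2 : ℝ) < p.2 ∧ p.2 < (D v).2 := by
  simp only [pt, ← h]
  exact mem_openSegment_v (by exact_mod_cast hlt)

/-- Every edge can be directed rightwards or upwards. -/
theorem exists_directed {G : SimpleGraph V} {D : Drawing V} (hinj : Function.Injective D)
    (hal : ∀ u v, G.Adj u v → (D u).1 = (D v).1 ∨ (D u).2 = (D v).2) {u v : V}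
    (h : G.Adj u v) :
    ∃ a b, (a = u ∧ b = v ∨ a = v ∧ b = u) ∧ G.Adj a b ∧
      ((D a).2 = (D b).2 ∧ (D a).1 < (D b).1 ∨ (D a).1 = (D b).1 ∧ (D a).2 < (D b).2) := by
  have hne : D u ≠ D v := fun e => h.ne (hinj e)
  rcases hal u v h with e | e
  · rcases lt_trichotomy (D u).2 (D v).2 with l | l | l
    · exact ⟨u, v, .inl ⟨rfl, rfl⟩, h, .inr ⟨e, l⟩⟩
    · exact absurd (Prod.ext e l) hne
    · exact ⟨v, u, .inr ⟨rfl, rfl⟩, h.symm, .inr ⟨e.symm, l⟩⟩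
  · rcases lt_trichotomy (D u).1 (D v).1 with l | l | l
    · exact ⟨u, v, .inl ⟨rfl, rfl⟩, h, .inl ⟨e, l⟩⟩
    · exact absurd (Prod.ext l e) hne
    · exact ⟨v, u, .inr ⟨rfl, rfl⟩, h.symm, .inl ⟨e.symm, l⟩⟩

theorem IsRectilinear.clear_h {G : SimpleGraph V} {D : Drawing V} (hD : IsRectilinear G D)
    (u v w : V) (h : G.Adj u v) (e : (D u).2 = (D v).2) (ew : (D w).2 = (D u).2) :
    ¬ ((D u).1 < (D w).1 ∧ (D w).1 < (D v).1) := by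
  rintro ⟨h1, h2⟩
  rcases hD.avoids u v w h ((mem_segment_pt_h e (by omega)).2
    ⟨by simp [pt, ew], by simpa [pt] using h1.le, by simpa [pt] using h2.le⟩) with rfl | rfl <;> omega

theorem IsRectilinear.clear_v {G : SimpleGraph V} {D : Drawing V} (hD : IsRectilinear G D)
    (u v w : V) (h : G.Adj u v) (e : (D u).1 = (D v).1) (ew : (D w).1 = (D u).1) :
    ¬ ((D u).2 < (D w).2 ∧ (D w).2 < (D v).2) := by
  rintro ⟨h1, h2⟩
  rcases hD.avoids u v w h ((mem_segment_pt_v e (by omega)).2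
    ⟨by simp [pt, ew], by simpa [pt] using h1.le, by simpa [pt] using h2.le⟩) with rfl | rfl <;> omega

/-- Crossing edges are perpendicular. -/
theorem IsRectilinear.crossing {G : SimpleGraph V} {D : Drawing V} (hD : IsRectilinear G D)
    {p : ℝ × ℝ} (hp : IsCrossing G D p) :
    ∃ u v u' v', G.Adj u v ∧ G.Adj u' v' ∧ (D u).2 = (D v).2 ∧ (D u').1 = (D v').1 ∧
      p = (((D u').1 : ℝ), ((D u).2 : ℝ)) ∧ (D u).1 < (D u').1 ∧ (D u').1 < (D v).1 ∧
      (D u').2 < (D u).2 ∧ (D u).2 < (D v').2 := by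
  obtain ⟨u, v, u', v', h, h', hne, hp, hp'⟩ := hp
  obtain ⟨a, b, hab, hadj, hdir⟩ := exists_directed hD.injective hD.aligned h
  obtain ⟨a', b', hab', hadj', hdir'⟩ := exists_directed hD.injective hD.aligned h'
  have hp : p ∈ openSegment ℝ (pt D a) (pt D b) := by
    rcases hab with ⟨rfl, rfl⟩ | ⟨rfl, rfl⟩
    · exact hp
    · rwa [openSegment_symm]
  have hp' : p ∈ openSegment ℝ (pt D a') (pt D b') := by
    rcases hab' with ⟨rfl, rfl⟩ | ⟨rfl, rfl⟩
    · exact hp'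
    · rwa [openSegment_symm]
  have hne : ¬ (a = a' ∧ b = b') := by
    rintro ⟨rfl, rfl⟩
    apply hne
    rcases hab with ⟨rfl, rfl⟩ | ⟨rfl, rfl⟩ <;> rcases hab' with ⟨rfl, rfl⟩ | ⟨rfl, rfl⟩ <;>
      simp [Sym2.eq_swap]
  obtain ⟨px, py⟩ := p
  rcases hdir with ⟨e, l⟩ | ⟨e, l⟩ <;> rcases hdir' with ⟨e', l'⟩ | ⟨e', l'⟩
  -- Parallel edges with a common inner point overlap. As no end of one lies strictly inside the
  -- other, they have the same ends, contrary to their being different.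
  · rw [mem_openSegment_pt_h e l] at hp
    rw [mem_openSegment_pt_h e' l'] at hp'
    have ey : (D a).2 = (D a').2 := by exact_mod_cast hp.1.symm.trans hp'.1
    have l1 : (D a).1 < (D b').1 := by exact_mod_cast hp.2.1.trans hp'.2.2
    have l2 : (D a').1 < (D b).1 := by exact_mod_cast hp'.2.1.trans hp.2.2
    have i1 := hD.clear_h a b a' hadj e ey.symm
    have i2 := hD.clear_h a' b' a hadj' e' ey
    have i3 := hD.clear_h a b b' hadj e (by omega)
    have i4 := hD.clear_h a' b' b hadj' e' (by omega)
    exact absurd ⟨hD.injective (Prod.ext (by omega) ey), hD.injective (Prod.ext (by omega) (by omega))⟩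
      hne
  · rw [mem_openSegment_pt_h e l] at hp
    rw [mem_openSegment_pt_v e' l'] at hp'
    simp only at hp hp'
    obtain ⟨rfl, h1, h2⟩ := hp
    obtain ⟨rfl, h3, h4⟩ := hp'
    exact ⟨a, b, a', b', hadj, hadj', e, e', rfl, by exact_mod_cast h1, by exact_mod_cast h2,
      by exact_mod_cast h3, by exact_mod_cast h4⟩
  · rw [mem_openSegment_pt_v e l] at hp
    rw [mem_openSegment_pt_h e' l'] at hp'
    simp only at hp hp'
    obtain ⟨rfl, h1, h2⟩ := hp
    obtain ⟨rfl, h3, h4⟩ := hp'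
    exact ⟨a', b', a, b, hadj', hadj, e', e, rfl, by exact_mod_cast h3, by exact_mod_cast h4,
      by exact_mod_cast h1, by exact_mod_cast h2⟩
  · rw [mem_openSegment_pt_v e l] at hp
    rw [mem_openSegment_pt_v e' l'] at hp'
    have ey : (D a).1 = (D a').1 := by exact_mod_cast hp.1.symm.trans hp'.1
    have l1 : (D a).2 < (D b').2 := by exact_mod_cast hp.2.1.trans hp'.2.2
    have l2 : (D a').2 < (D b).2 := by exact_mod_cast hp'.2.1.trans hp.2.2
    have i1 := hD.clear_v a b a' hadj e ey.symm
    have i2 := hD.clear_v a' b' a hadj' e' ey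
    have i3 := hD.clear_v a b b' hadj e (by omega)
    have i4 := hD.clear_v a' b' b hadj' e' (by omega)
    exact absurd ⟨hD.injective (Prod.ext ey (by omega)), hD.injective (Prod.ext (by omega) (by omega))⟩
      hne

/-- A crossing takes its abscissa from a vertical edge and its ordinate from a horizontal one, and
both are integers. -/
theorem IsRectilinear.drawingVertex_int {G : SimpleGraph V} {D : Drawing V}
    (hD : IsRectilinear G D) {p : ℝ × ℝ} (hp : IsDrawingVertex G D p) :
    ∃ a b : ℤ, p = ((a : ℝ), (b : ℝ)) := by
  rcases hp with ⟨v, rfl⟩ | hp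
  · exact ⟨_, _, rfl⟩
  · obtain ⟨u, v, u', v', -, -, -, -, rfl, -⟩ := hD.crossing hp
    exact ⟨_, _, rfl⟩

theorem IsLattice.isRectilinear {G : SimpleGraph V} {D : Drawing V} (hD : IsLattice G D) :
    IsRectilinear G D := by
  refine ⟨hD.injective, hD.aligned, fun u v w h hw => ?_⟩
  obtain ⟨a, b, hab, hadj, hdir⟩ := exists_directed hD.injective hD.aligned h
  have hw : pt D w ∈ segment ℝ (pt D a) (pt D b) := by
    rcases hab with ⟨rfl, rfl⟩ | ⟨rfl, rfl⟩
    · exact hw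
    · rwa [segment_symm]
  suffices w = a ∨ w = b by
    rcases hab with ⟨rfl, rfl⟩ | ⟨rfl, rfl⟩
    · exact this
    · exact this.symm
  rcases hdir with ⟨e, l⟩ | ⟨e, l⟩
  · rw [mem_segment_pt_h e l.le] at hw
    simp only [pt] at hw
    norm_cast at hw
    have := hD.clear_h a b w hadj e hw.1
    by_cases h1 : (D w).1 = (D a).1
    · exact .inl (hD.injective (Prod.ext h1 hw.1))
    · exact .inr (hD.injective (Prod.ext (by omega) (by omega)))
  · rw [mem_segment_pt_v e l.le] at hw
    simp only [pt] at hw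
    norm_cast at hw
    have := hD.clear_v a b w hadj e hw.1
    by_cases h1 : (D w).2 = (D a).2
    · exact .inl (hD.injective (Prod.ext hw.1 h1))
    · exact .inr (hD.injective (Prod.ext (by omega) (by omega)))

/-- Consecutive vertices of the drawing on an edge are grid points. If they were more than one
apart, the grid point next to the smaller of them would be a crossing between them. -/
theorem IsLattice.hasUnitEdges {G : SimpleGraph V} {D : Drawing V} (hD : IsLattice G D) :
    HasUnitEdges G D := by
  intro u v h p q hp hq hne vp vq hcons
  have hR := hD.isRectilinear
  obtain ⟨a, b, hab, hadj, hdir⟩ := exists_directed hD.injective hD.aligned h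
  have tr : ∀ p, p ∈ segment ℝ (pt D u) (pt D v) → p ∈ segment ℝ (pt D a) (pt D b) := by
    intro p hp
    rcases hab with ⟨rfl, rfl⟩ | ⟨rfl, rfl⟩
    · exact hp
    · rwa [segment_symm]
  replace hp := tr p hp
  replace hq := tr q hq
  clear tr hab
  obtain ⟨p1, p2, rfl⟩ := hR.drawingVertex_int vp
  obtain ⟨q1, q2, rfl⟩ := hR.drawingVertex_int vq
  rcases hdir with ⟨e, l⟩ | ⟨e, l⟩
  · rw [mem_segment_pt_h e l.le] at hp hq
    simp only at hp hq
    norm_cast at hp hq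
    obtain ⟨rfl, hp⟩ := hp
    obtain ⟨rfl, hq⟩ := hq
    have key : ∀ s t : ℤ, (D a).1 ≤ s → t ≤ (D b).1 → s + 1 < t →
        ∃ r ∈ openSegment ℝ ((s : ℝ), ((D a).2 : ℝ)) ((t : ℝ), ((D a).2 : ℝ)),
          IsDrawingVertex G D r := by
      intro s t hs ht hst
      refine ⟨(((s + 1 : ℤ) : ℝ), ((D a).2 : ℝ)), (mem_openSegment_h (by exact_mod_cast by omega)).2
        ⟨rfl, by push_cast; simp, by simp only; exact_mod_cast hst⟩, .inr ?_⟩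
      obtain ⟨p, q, h', rfl', hq, h3, h4⟩ := hD.cross_h a b (s + 1) hadj e (by omega) (by omega)
      refine ⟨a, b, p, q, hadj, h', ?_, (mem_openSegment_pt_h e l).2 ⟨rfl, ?_, ?_⟩,
        (mem_openSegment_pt_v (rfl'.trans hq.symm) (by omega)).2 ⟨by simp [rfl'], ?_, ?_⟩⟩
      · intro hh
        rcases Sym2.eq_iff.1 hh with ⟨rfl, rfl⟩ | ⟨rfl, rfl⟩ <;> omega
      all_goals (simp only; norm_cast; try omega)
    rcases lt_trichotomy p1 q1 with hlt | rfl | hlt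
    · by_cases h1 : p1 + 1 < q1
      · obtain ⟨r, hr, hr'⟩ := key p1 q1 (by omega) (by omega) h1
        exact absurd hr' (hcons r hr)
      · obtain rfl : q1 = p1 + 1 := by omega
        simp
    · exact absurd rfl hne
    · by_cases h1 : q1 + 1 < p1
      · obtain ⟨r, hr, hr'⟩ := key q1 p1 (by omega) (by omega) h1
        exact absurd hr' (hcons r (by rwa [openSegment_symm]))
      · obtain rfl : p1 = q1 + 1 := by omega
        simp
  · rw [mem_segment_pt_v e l.le] at hp hq
    simp only at hp hq
    norm_cast at hp hq
    obtain ⟨rfl, hp⟩ := hp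
    obtain ⟨rfl, hq⟩ := hq
    have key : ∀ s t : ℤ, (D a).2 ≤ s → t ≤ (D b).2 → s + 1 < t →
        ∃ r ∈ openSegment ℝ (((D a).1 : ℝ), (s : ℝ)) (((D a).1 : ℝ), (t : ℝ)),
          IsDrawingVertex G D r := by
      intro s t hs ht hst
      refine ⟨(((D a).1 : ℝ), ((s + 1 : ℤ) : ℝ)), (mem_openSegment_v (by exact_mod_cast by omega)).2
        ⟨rfl, by push_cast; simp, by simp only; exact_mod_cast hst⟩, .inr ?_⟩
      obtain ⟨p, q, h', rfl', hq, h3, h4⟩ := hD.cross_v a b (s + 1) hadj e (by omega) (by omega)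
      refine ⟨a, b, p, q, hadj, h', ?_, (mem_openSegment_pt_v e l).2 ⟨rfl, ?_, ?_⟩,
        (mem_openSegment_pt_h (rfl'.trans hq.symm) (by omega)).2 ⟨by simp [rfl'], ?_, ?_⟩⟩
      · intro hh
        rcases Sym2.eq_iff.1 hh with ⟨rfl, rfl⟩ | ⟨rfl, rfl⟩ <;> omega
      all_goals (simp only; norm_cast; try omega)
    rcases lt_trichotomy p2 q2 with hlt | rfl | hlt
    · by_cases h1 : p2 + 1 < q2
      · obtain ⟨r, hr, hr'⟩ := key p2 q2 (by omega) (by omega) h1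
        exact absurd hr' (hcons r hr)
      · obtain rfl : q2 = p2 + 1 := by omega
        simp
    · exact absurd rfl hne
    · by_cases h1 : q2 + 1 < p2
      · obtain ⟨r, hr, hr'⟩ := key q2 p2 (by omega) (by omega) h1
        exact absurd hr' (hcons r (by rwa [openSegment_symm]))
      · obtain rfl : p2 = q2 + 1 := by omega
        simp

/-! ### Enlarging empty boxes of grid cells. -/

/-- If one of the four unit segments at a grid point is present, then two opposite ones are. -/
def PassThrough (h v : ℤ → ℤ → Prop) (x y : ℤ) : Prop :=
  h (x - 1) y ∨ h x y ∨ v x (y - 1) ∨ v x y → h (x - 1) y ∧ h x y ∨ v x (y - 1) ∧ v x y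

/-- No unit segment meets the interior of a box. -/
def FreeBox (h v : ℤ → ℤ → Prop) (a b c d : ℤ) : Prop :=
  (∀ x y, a ≤ x → x < b → c < y → y < d → ¬ h x y) ∧
  ∀ x y, a < x → x < b → c ≤ y → y < d → ¬ v x y

theorem PassThrough.swap {h v : ℤ → ℤ → Prop} {x y : ℤ} (H : PassThrough h v x y) :
    PassThrough (fun a b => v b a) (fun a b => h b a) y x := by
  unfold PassThrough at *; tauto

theorem FreeBox.swap {h v : ℤ → ℤ → Prop} {a b c d : ℤ} (H : FreeBox h v a b c d) :
    FreeBox (fun a b => v b a) (fun a b => h b a) c d a b :=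
  ⟨fun x y h1 h2 h3 h4 => H.2 y x h3 h4 h1 h2, fun x y h1 h2 h3 h4 => H.1 y x h3 h4 h1 h2⟩

theorem forall_not_of_step {P : ℤ → Prop} {a b : ℤ}
    (hstep : ∀ x, a < x → x < b → (P (x - 1) ↔ P x)) {z : ℤ} (hz : a ≤ z) (hzb : z < b)
    (hP : ¬ P z) : ∀ x, a ≤ x → x < b → ¬ P x := by
  have key : ∀ x, a ≤ x → x < b → (P x ↔ P a) := by
    intro x hx
    induction x, hx using Int.leInduction with
    | base => exact fun _ => Iff.rfl
    | succ x hx ih =>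
      intro hb
      have h := hstep (x + 1) (by omega) hb
      rw [add_sub_cancel_right] at h
      rw [← h, ih (by omega)]
  intro x hx hb
  rw [key x hx hb, ← key z hz hzb]
  exact hP

/-- At a point strictly inside the top side the segment below is missing, because the box is free.
Passing through is then possible only horizontally: the two unit segments of the side at this point
are both present or both absent. So one gap makes the whole side absent, and after that no segment
can lead upwards from it. -/
theorem FreeBox.grow_top {h v : ℤ → ℤ → Prop} {a b c d : ℤ} (H : FreeBox h v a b c d)
    (hcd : c < d) (hp : ∀ x, a < x → x < b → PassThrough h v x d)
    (hz : ∃ z, a ≤ z ∧ z < b ∧ ¬ h z d) : FreeBox h v a b c (d + 1) := by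
  obtain ⟨z, hz, hzb, hh⟩ := hz
  have hv : ∀ x, a < x → x < b → ¬ v x (d - 1) := fun x h1 h2 =>
    H.2 x (d - 1) h1 h2 (by omega) (by omega)
  have hno := forall_not_of_step (P := fun x => h x d) (fun x h1 h2 => by
    have := hp x h1 h2; have := hv x h1 h2; unfold PassThrough at *; tauto) hz hzb hh
  refine ⟨fun x y h1 h2 h3 h4 => ?_, fun x y h1 h2 h3 h4 => ?_⟩
  · rcases Int.lt_or_eq_of_le (Int.le_of_lt_add_one h4) with h5 | rfl
    · exact H.1 x y h1 h2 h3 h5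
    · exact hno x h1 h2
  · rcases Int.lt_or_eq_of_le (Int.le_of_lt_add_one h4) with h5 | rfl
    · exact H.2 x y h1 h2 h3 h5
    · have := hp x h1 h2; have := hv x h1 h2; have := hno x (by omega) h2
      unfold PassThrough at *; tauto

theorem FreeBox.grow_bottom {h v : ℤ → ℤ → Prop} {a b c d : ℤ} (H : FreeBox h v a b c d)
    (hcd : c < d) (hp : ∀ x, a < x → x < b → PassThrough h v x c)
    (hz : ∃ z, a ≤ z ∧ z < b ∧ ¬ h z c) : FreeBox h v a b (c - 1) d := by
  obtain ⟨z, hz, hzb, hh⟩ := hz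
  have hv : ∀ x, a < x → x < b → ¬ v x c := fun x h1 h2 => H.2 x c h1 h2 le_rfl hcd
  have hno := forall_not_of_step (P := fun x => h x c) (fun x h1 h2 => by
    have := hp x h1 h2; have := hv x h1 h2; unfold PassThrough at *; tauto) hz hzb hh
  refine ⟨fun x y h1 h2 h3 h4 => ?_, fun x y h1 h2 h3 h4 => ?_⟩
  · rcases Int.lt_or_eq_of_le (Int.le_of_sub_one_lt h3) with h5 | rfl
    · exact H.1 x y h1 h2 h5 h4
    · exact hno x h1 h2
  · rcases Int.lt_or_eq_of_le h3 with h5 | rfl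
    · exact H.2 x y h1 h2 (by omega) h4
    · have := hp x h1 h2; have := hv x h1 h2; have := hno x (by omega) h2
      unfold PassThrough at *; tauto

/-- A free box can be enlarged until all its sides are covered by segments. -/
theorem FreeBox.exists_maximal {h v : ℤ → ℤ → Prop} {W H : ℤ}
    (hp : ∀ x y, 0 < x → x < W → 0 < y → y < H → PassThrough h v x y)
    (h0 : ∀ x, 0 ≤ x → x < W → h x 0) (hH : ∀ x, 0 ≤ x → x < W → h x H)
    (v0 : ∀ y, 0 ≤ y → y < H → v 0 y) (vW : ∀ y, 0 ≤ y → y < H → v W y)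
    {a b c d : ℤ} (ha : 0 ≤ a) (hab : a < b) (hb : b ≤ W) (hc : 0 ≤ c) (hcd : c < d) (hd : d ≤ H)
    (hf : FreeBox h v a b c d) :
    ∃ a' b' c' d', a' ≤ a ∧ b ≤ b' ∧ c' ≤ c ∧ d ≤ d' ∧ FreeBox h v a' b' c' d' ∧
      (∀ x, a' ≤ x → x < b' → h x c' ∧ h x d') ∧ ∀ y, c' ≤ y → y < d' → v a' y ∧ v b' y := by
  -- Induction on the total distance of the box from the sides of the rectangle. A side with a gap
  -- is not on the boundary, since the boundary is covered, so there is room to move it outwards.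
  obtain ⟨k, hk⟩ : ∃ k : ℕ, a + (W - b) + c + (H - d) ≤ k :=
    ⟨(a + (W - b) + c + (H - d)).toNat, Int.self_le_toNat _⟩
  induction k generalizing a b c d with
  | zero =>
    obtain rfl : a = 0 := by omega
    obtain rfl : b = W := by omega
    obtain rfl : c = 0 := by omega
    obtain rfl : d = H := by omega
    exact ⟨_, _, _, _, le_rfl, le_rfl, le_rfl, le_rfl, hf,
      fun x h1 h2 => ⟨h0 x h1 h2, hH x h1 h2⟩, fun y h1 h2 => ⟨v0 y h1 h2, vW y h1 h2⟩⟩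
  | succ k ih =>
    by_cases t1 : ∃ z, a ≤ z ∧ z < b ∧ ¬ h z d
    · have hd' : d < H := by
        obtain ⟨z, hz⟩ := t1
        refine lt_of_le_of_ne hd ?_
        rintro rfl
        exact hz.2.2 (hH z (by omega) (by omega))
      obtain ⟨a', b', c', d', e1, e2, e3, e4, e⟩ := ih ha hab hb hc (by omega) (by omega)
        (hf.grow_top hcd (fun x h1 h2 => hp x d (by omega) (by omega) (by omega) hd') t1) (by omega)
      exact ⟨a', b', c', d', e1, e2, e3, by omega, e⟩
    by_cases t2 : ∃ z, a ≤ z ∧ z < b ∧ ¬ h z c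
    · have hc' : 0 < c := by
        obtain ⟨z, hz⟩ := t2
        refine lt_of_le_of_ne hc ?_
        rintro rfl
        exact hz.2.2 (h0 z (by omega) (by omega))
      obtain ⟨a', b', c', d', e1, e2, e3, e4, e⟩ := ih ha hab hb (by omega) (by omega) (by omega)
        (hf.grow_bottom hcd (fun x h1 h2 => hp x c (by omega) (by omega) hc' (by omega)) t2)
        (by omega)
      exact ⟨a', b', c', d', e1, e2, by omega, by omega, e⟩
    -- The vertical sides are horizontal sides of the transposed configuration.
    by_cases t3 : ∃ z, c ≤ z ∧ z < d ∧ ¬ v b z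
    · have hb' : b < W := by
        obtain ⟨z, hz⟩ := t3
        refine lt_of_le_of_ne hb ?_
        rintro rfl
        exact hz.2.2 (vW z (by omega) (by omega))
      obtain ⟨a', b', c', d', e1, e2, e3, e4, e⟩ := ih ha (by omega) (by omega) hc hcd hd
        (hf.swap.grow_top hab
          (fun y h1 h2 => (hp b y (by omega) hb' (by omega) (by omega)).swap) t3).swap (by omega)
      exact ⟨a', b', c', d', e1, by omega, e3, e4, e⟩
    by_cases t4 : ∃ z, c ≤ z ∧ z < d ∧ ¬ v a z
    · have ha' : 0 < a := by
        obtain ⟨z, hz⟩ := t4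
        refine lt_of_le_of_ne ha ?_
        rintro rfl
        exact hz.2.2 (v0 z (by omega) (by omega))
      obtain ⟨a', b', c', d', e1, e2, e3, e4, e⟩ := ih (by omega) (by omega) hb hc hcd hd
        (hf.swap.grow_bottom hab
          (fun y h1 h2 => (hp a y ha' (by omega) (by omega) (by omega)).swap) t4).swap (by omega)
      exact ⟨a', b', c', d', by omega, by omega, e3, e4, e⟩
    push Not at t1 t2 t3 t4
    exact ⟨a, b, c, d, le_rfl, le_rfl, le_rfl, le_rfl, hf,
      fun x h1 h2 => ⟨t2 x h1 h2, t1 x h1 h2⟩, fun y h1 h2 => ⟨t4 y h1 h2, t3 y h1 h2⟩⟩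
end UERRF

/-! ### Grid drawings: integer conditions equivalent to validity. -/

namespace UERRF

open Set

variable {V : Type*}

/-- The `i`-th point on a walk around the boundary of `[0, W] × [0, H]`, starting from the origin
along the horizontal axis: first coordinate. -/
def boundaryX (W H i : ℕ) : ℕ :=
  if i ≤ W then i else if i ≤ W + H then W else if i ≤ 2 * W + H then W - (i - (W + H)) else 0

/-- The second coordinate of the `i`-th point on the boundary of `[0, W] × [0, H]`. -/
def boundaryY (W H i : ℕ) : ℕ :=
  if i ≤ W then 0 else if i ≤ W + H then i - W else if i ≤ 2 * W + H then H
  else 2 * (W + H) - i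

/-- A lattice drawing inside `[0, W] × [0, H]` with the sequence `β` on the boundary, in which all
vertices inside the rectangle lie inside a straight line of two edges. -/
structure IsGridDrawing (G : SimpleGraph V) (β : ℕ → V) (W H : ℕ) (D : Drawing V) : Prop extends
    IsLattice G D where
  W_pos : 0 < W
  H_pos : 0 < H
  inside : ∀ v, 0 ≤ (D v).1 ∧ (D v).1 ≤ W ∧ 0 ≤ (D v).2 ∧ (D v).2 ≤ H
  boundary : ∀ i < 2 * (W + H), D (β i) = ((boundaryX W H i : ℤ), (boundaryY W H i : ℤ))
  straight : ∀ v, ((D v).1 = 0 ∨ (D v).1 = W ∨ (D v).2 = 0 ∨ (D v).2 = H) ∨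
    (∃ p q, G.Adj v p ∧ G.Adj v q ∧ (D p).2 = (D v).2 ∧ (D q).2 = (D v).2 ∧
      (D p).1 < (D v).1 ∧ (D v).1 < (D q).1) ∨
    ∃ p q, G.Adj v p ∧ G.Adj v q ∧ (D p).1 = (D v).1 ∧ (D q).1 = (D v).1 ∧
      (D p).2 < (D v).2 ∧ (D v).2 < (D q).2

/-- The sequence `β` runs through a closed walk of length `N`. -/
structure IsClosedSeq (G : SimpleGraph V) (β : ℕ → V) (N : ℕ) : Prop where
  adj : ∀ i < N, G.Adj (β i) (β (i + 1))
  closed : β N = β 0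

/-- The unit segment to the right of a grid point is covered by an edge. -/
def Hor (G : SimpleGraph V) (D : Drawing V) (x y : ℤ) : Prop :=
  ∃ u v, G.Adj u v ∧ (D u).2 = y ∧ (D v).2 = y ∧ (D u).1 ≤ x ∧ x + 1 ≤ (D v).1

/-- The unit segment above a grid point is covered by an edge. -/
def Ver (G : SimpleGraph V) (D : Drawing V) (x y : ℤ) : Prop :=
  ∃ u v, G.Adj u v ∧ (D u).1 = x ∧ (D v).1 = x ∧ (D u).2 ≤ y ∧ y + 1 ≤ (D v).2

theorem Hor.mem_carrier {G : SimpleGraph V} {D : Drawing V} {x y : ℤ} (h : Hor G D x y)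
    {p : ℝ × ℝ} (h2 : p.2 = y) (h1 : x ≤ p.1) (h1' : p.1 ≤ x + 1) : p ∈ carrier G D := by
  obtain ⟨u, v, hadj, hu, hv, hx, hx'⟩ := h
  have e1 : ((D u).1 : ℝ) ≤ x := by exact_mod_cast hx
  have e2 : (x : ℝ) + 1 ≤ (D v).1 := by exact_mod_cast hx'
  exact .inr ⟨u, v, hadj, (mem_segment_pt_h (hu.trans hv.symm) (by omega)).2
    ⟨by rw [h2, hu], by linarith, by linarith⟩⟩

theorem Ver.mem_carrier {G : SimpleGraph V} {D : Drawing V} {x y : ℤ} (h : Ver G D x y)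
    {p : ℝ × ℝ} (h2 : p.1 = x) (h1 : y ≤ p.2) (h1' : p.2 ≤ y + 1) : p ∈ carrier G D := by
  obtain ⟨u, v, hadj, hu, hv, hx, hx'⟩ := h
  have e1 : ((D u).2 : ℝ) ≤ y := by exact_mod_cast hx
  have e2 : (y : ℝ) + 1 ≤ (D v).2 := by exact_mod_cast hx'
  exact .inr ⟨u, v, hadj, (mem_segment_pt_v (hu.trans hv.symm) (by omega)).2
    ⟨by rw [h2, hu], by linarith, by linarith⟩⟩

theorem exists_boundary_index {W H : ℕ} {x y : ℤ} (hW : 0 < W) (hx : 0 ≤ x ∧ x ≤ W)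
    (hy : 0 ≤ y ∧ y ≤ H) (h : x = 0 ∨ x = W ∨ y = 0 ∨ y = H) :
    ∃ i < 2 * (W + H), (boundaryX W H i : ℤ) = x ∧ (boundaryY W H i : ℤ) = y := by
  obtain ⟨hx0, hxW⟩ := hx
  obtain ⟨hy0, hyH⟩ := hy
  lift x to ℕ using hx0
  lift y to ℕ using hy0
  norm_cast at *
  unfold boundaryX boundaryY
  by_cases h1 : y = 0
  · exact ⟨x, by omega, by split_ifs <;> omega, by split_ifs <;> omega⟩
  by_cases h2 : x = W
  · exact ⟨W + y, by omega, by split_ifs <;> omega, by split_ifs <;> omega⟩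
  by_cases h3 : y = H
  · exact ⟨2 * W + H - x, by omega, by split_ifs <;> omega, by split_ifs <;> omega⟩
  · exact ⟨2 * (W + H) - y, by omega, by split_ifs <;> omega, by split_ifs <;> omega⟩

/-- Consecutive points on the boundary of the rectangle. -/
theorem boundary_step {W H i : ℕ} (hi : i < 2 * (W + H)) :
    (boundaryY W H i = 0 ∧ boundaryY W H (i + 1) = 0 ∧ boundaryX W H i < W ∧
      boundaryX W H (i + 1) = boundaryX W H i + 1) ∨
    (boundaryX W H i = W ∧ boundaryX W H (i + 1) = W ∧ boundaryY W H i < H ∧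
      boundaryY W H (i + 1) = boundaryY W H i + 1) ∨
    (boundaryY W H i = H ∧ boundaryY W H (i + 1) = H ∧ boundaryX W H (i + 1) < W ∧
      boundaryX W H i = boundaryX W H (i + 1) + 1) ∨
    (boundaryX W H i = 0 ∧ boundaryX W H (i + 1) = 0 ∧ boundaryY W H (i + 1) < H ∧
      boundaryY W H i = boundaryY W H (i + 1) + 1) := by
  unfold boundaryX boundaryY
  split_ifs <;> omega

theorem boundary_last (W H : ℕ) (hW : 0 < W) (hH : 0 < H) :
    boundaryX W H (2 * (W + H)) = boundaryX W H 0 ∧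
      boundaryY W H (2 * (W + H)) = boundaryY W H 0 := by
  unfold boundaryX boundaryY
  split_ifs <;> omega

namespace IsGridDrawing

variable {G : SimpleGraph V} {β : ℕ → V} {W H : ℕ} {D : Drawing V}

theorem boundary_le (hD : IsGridDrawing G β W H D) (hβ : IsClosedSeq G β (2 * (W + H))) {i : ℕ}
    (hi : i ≤ 2 * (W + H)) : D (β i) = ((boundaryX W H i : ℤ), (boundaryY W H i : ℤ)) := by
  rcases hi.lt_or_eq with h | rfl
  · exact hD.boundary i h
  · rw [hβ.closed, hD.boundary 0 (by have := hD.W_pos; omega), (boundary_last W H hD.W_pos hD.H_pos).1,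
      (boundary_last W H hD.W_pos hD.H_pos).2]

theorem exists_eq_boundary (hD : IsGridDrawing G β W H D) {v : V}
    (h : (D v).1 = 0 ∨ (D v).1 = W ∨ (D v).2 = 0 ∨ (D v).2 = H) :
    ∃ i < 2 * (W + H), v = β i := by
  obtain ⟨h1, h2, h3, h4⟩ := hD.inside v
  obtain ⟨i, hi, hx, hy⟩ := exists_boundary_index hD.W_pos ⟨h1, h2⟩ ⟨h3, h4⟩ h
  exact ⟨i, hi, hD.injective (by rw [hD.boundary i hi, hx, hy])⟩

theorem hor_boundary (hD : IsGridDrawing G β W H D) (hβ : IsClosedSeq G β (2 * (W + H))) {x : ℤ}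
    (hx : 0 ≤ x) (hxW : x < W) : Hor G D x 0 ∧ Hor G D x H := by
  lift x to ℕ using hx
  norm_cast at hxW
  constructor
  · have h1 := hD.boundary_le hβ (i := x) (by omega)
    have h2 := hD.boundary_le hβ (i := x + 1) (by omega)
    refine ⟨_, _, hβ.adj x (by omega), ?_⟩
    rw [h1, h2]
    unfold boundaryX boundaryY
    split_ifs <;> omega
  · have h1 := hD.boundary_le hβ (i := 2 * W + H - 1 - x) (by omega)
    have h2 := hD.boundary_le hβ (i := 2 * W + H - 1 - x + 1) (by omega)
    refine ⟨_, _, (hβ.adj (2 * W + H - 1 - x) (by omega)).symm, ?_⟩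
    have := hD.H_pos
    rw [h1, h2]
    unfold boundaryX boundaryY
    split_ifs <;> omega

theorem ver_boundary (hD : IsGridDrawing G β W H D) (hβ : IsClosedSeq G β (2 * (W + H))) {y : ℤ}
    (hy : 0 ≤ y) (hyH : y < H) : Ver G D 0 y ∧ Ver G D W y := by
  lift y to ℕ using hy
  norm_cast at hyH
  have := hD.W_pos
  constructor
  · have h1 := hD.boundary_le hβ (i := 2 * (W + H) - 1 - y) (by omega)
    have h2 := hD.boundary_le hβ (i := 2 * (W + H) - 1 - y + 1) (by omega)
    refine ⟨_, _, (hβ.adj (2 * (W + H) - 1 - y) (by omega)).symm, ?_⟩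
    rw [h1, h2]
    unfold boundaryX boundaryY
    split_ifs <;> omega
  · have h1 := hD.boundary_le hβ (i := W + y) (by omega)
    have h2 := hD.boundary_le hβ (i := W + y + 1) (by omega)
    refine ⟨_, _, hβ.adj (W + y) (by omega), ?_⟩
    rw [h1, h2]
    unfold boundaryX boundaryY
    split_ifs <;> omega

theorem exists_adj (hD : IsGridDrawing G β W H D) (hβ : IsClosedSeq G β (2 * (W + H))) (v : V) :
    ∃ w, G.Adj v w := by
  rcases hD.straight v with h | ⟨p, q, h, -⟩ | ⟨p, q, h, -⟩
  · obtain ⟨i, hi, rfl⟩ := hD.exists_eq_boundary h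
    exact ⟨_, hβ.adj i hi⟩
  · exact ⟨p, h⟩
  · exact ⟨p, h⟩

theorem straight_cover (hD : IsGridDrawing G β W H D) {v : V} (hx : 0 < (D v).1)
    (hxW : (D v).1 < W) (hy : 0 < (D v).2) (hyH : (D v).2 < H) :
    Hor G D ((D v).1 - 1) (D v).2 ∧ Hor G D (D v).1 (D v).2 ∨
      Ver G D (D v).1 ((D v).2 - 1) ∧ Ver G D (D v).1 (D v).2 := by
  rcases hD.straight v with h | ⟨p, q, hp, hq, h1, h2, h3, h4⟩ | ⟨p, q, hp, hq, h1, h2, h3, h4⟩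
  · omega
  · exact .inl ⟨⟨p, v, hp.symm, h1, rfl, by omega, by omega⟩, ⟨v, q, hq, rfl, h2, by omega, by omega⟩⟩
  · exact .inr ⟨⟨p, v, hp.symm, h1, rfl, by omega, by omega⟩, ⟨v, q, hq, rfl, h2, by omega, by omega⟩⟩

/-- An edge that covers one of the four segments at the point either runs on through the point or
has an end there; in the latter case the point carries an inner vertex, and straightness supplies
the opposite pair. -/
theorem passThrough (hD : IsGridDrawing G β W H D) {x y : ℤ} (hx : 0 < x) (hxW : x < W)
    (hy : 0 < y) (hyH : y < H) : PassThrough (Hor G D) (Ver G D) x y := by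
  have vertex : ∀ v, (D v).1 = x → (D v).2 = y →
      Hor G D (x - 1) y ∧ Hor G D x y ∨ Ver G D x (y - 1) ∧ Ver G D x y := by
    rintro v rfl rfl
    exact hD.straight_cover hx hxW hy hyH
  have hor : ∀ u v, G.Adj u v → (D u).2 = y → (D v).2 = y → (D u).1 ≤ x → x ≤ (D v).1 →
      Hor G D (x - 1) y ∧ Hor G D x y ∨ Ver G D x (y - 1) ∧ Ver G D x y := by
    intro u v h hu hv h1 h2
    by_cases e1 : (D u).1 = x
    · exact vertex u e1 hu
    by_cases e2 : (D v).1 = x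
    · exact vertex v e2 hv
    exact .inl ⟨⟨u, v, h, hu, hv, by omega, by omega⟩, ⟨u, v, h, hu, hv, by omega, by omega⟩⟩
  have ver : ∀ u v, G.Adj u v → (D u).1 = x → (D v).1 = x → (D u).2 ≤ y → y ≤ (D v).2 →
      Hor G D (x - 1) y ∧ Hor G D x y ∨ Ver G D x (y - 1) ∧ Ver G D x y := by
    intro u v h hu hv h1 h2
    by_cases e1 : (D u).2 = y
    · exact vertex u hu e1
    by_cases e2 : (D v).2 = y
    · exact vertex v hv e2
    exact .inr ⟨⟨u, v, h, hu, hv, by omega, by omega⟩, ⟨u, v, h, hu, hv, by omega, by omega⟩⟩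
  rintro (⟨u, v, h, h1, h2, h3, h4⟩ | ⟨u, v, h, h1, h2, h3, h4⟩ | ⟨u, v, h, h1, h2, h3, h4⟩ |
    ⟨u, v, h, h1, h2, h3, h4⟩)
  · exact hor u v h h1 h2 (by omega) (by omega)
  · exact hor u v h h1 h2 (by omega) (by omega)
  · exact ver u v h h1 h2 (by omega) (by omega)
  · exact ver u v h h1 h2 (by omega) (by omega)

theorem carrier_cases (hD : IsGridDrawing G β W H D) (hβ : IsClosedSeq G β (2 * (W + H)))
    {p : ℝ × ℝ} (hp : p ∈ carrier G D) :
    (∃ u v, G.Adj u v ∧ (D u).2 = (D v).2 ∧ (D u).1 < (D v).1 ∧ p.2 = (D u).2 ∧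
      ((D u).1 : ℝ) ≤ p.1 ∧ p.1 ≤ (D v).1) ∨
    ∃ u v, G.Adj u v ∧ (D u).1 = (D v).1 ∧ (D u).2 < (D v).2 ∧ p.1 = (D u).1 ∧
      ((D u).2 : ℝ) ≤ p.2 ∧ p.2 ≤ (D v).2 := by
  have hp : ∃ u v, G.Adj u v ∧ p ∈ segment ℝ (pt D u) (pt D v) := by
    rcases hp with ⟨v, rfl⟩ | h
    · obtain ⟨w, hw⟩ := hD.exists_adj hβ v
      exact ⟨v, w, hw, left_mem_segment _ _ _⟩
    · exact h
  obtain ⟨u, v, h, hp⟩ := hp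
  obtain ⟨a, b, hab, hadj, hdir⟩ := exists_directed hD.injective hD.aligned h
  have hp : p ∈ segment ℝ (pt D a) (pt D b) := by
    rcases hab with ⟨rfl, rfl⟩ | ⟨rfl, rfl⟩
    · exact hp
    · rwa [segment_symm]
  rcases hdir with ⟨e, l⟩ | ⟨e, l⟩
  · exact .inl ⟨a, b, hadj, e, l, (mem_segment_pt_h e l.le).1 hp⟩
  · exact .inr ⟨a, b, hadj, e, l, (mem_segment_pt_v e l.le).1 hp⟩

theorem carrier_subset (hD : IsGridDrawing G β W H D) (hβ : IsClosedSeq G β (2 * (W + H))) :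
    carrier G D ⊆ Icc (0 : ℝ) W ×ˢ Icc (0 : ℝ) H := by
  intro p hp
  have cast : ∀ v, (0 : ℝ) ≤ (D v).1 ∧ ((D v).1 : ℝ) ≤ W ∧ (0 : ℝ) ≤ (D v).2 ∧
      ((D v).2 : ℝ) ≤ H := fun v => by exact_mod_cast hD.inside v
  rcases hD.carrier_cases hβ hp with ⟨u, v, -, -, -, h2, h1, h1'⟩ | ⟨u, v, -, -, -, h2, h1, h1'⟩ <;>
  · obtain ⟨a1, a2, a3, a4⟩ := cast u
    obtain ⟨b1, b2, b3, b4⟩ := cast v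
    exact ⟨⟨by linarith, by linarith⟩, ⟨by linarith, by linarith⟩⟩

/-- A free box does not meet the drawing. -/
theorem disjoint_box (hD : IsGridDrawing G β W H D) (hβ : IsClosedSeq G β (2 * (W + H)))
    {a b c d : ℤ} (hf : FreeBox (Hor G D) (Ver G D) a b c d) :
    Disjoint (Ioo (a : ℝ) b ×ˢ Ioo (c : ℝ) d) (carrier G D) := by
  rw [Set.disjoint_left]
  rintro p ⟨⟨ha, hb⟩, hc, hd⟩ hp
  rcases hD.carrier_cases hβ hp with ⟨u, v, hadj, e, l, h2, h1, h1'⟩ | ⟨u, v, hadj, e, l, h2, h1, h1'⟩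
  · rw [h2] at hc hd
    have hua : a < (D v).1 := by exact_mod_cast ha.trans_le h1'
    have hub : (D u).1 < b := by exact_mod_cast h1.trans_lt hb
    -- The witness is the first unit segment of the edge that does not lie to the left of the box.
    refine hf.1 (max a (D u).1) (D u).2 (le_max_left _ _) (max_lt ?_ hub) (by exact_mod_cast hc)
      (by exact_mod_cast hd) ⟨u, v, hadj, rfl, e.symm, le_max_right _ _, by omega⟩
    exact_mod_cast ha.trans hb
  · rw [h2] at ha hb
    have hua : c < (D v).2 := by exact_mod_cast hc.trans_le h1'
    have hub : (D u).2 < d := by exact_mod_cast h1.trans_lt hd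
    refine hf.2 (D u).1 (max c (D u).2) (by exact_mod_cast ha) (by exact_mod_cast hb)
      (le_max_left _ _) (max_lt ?_ hub) ⟨u, v, hadj, rfl, e.symm, le_max_right _ _, by omega⟩
    exact_mod_cast hc.trans hd

end IsGridDrawing
end UERRF

/-! ### The faces of a grid drawing. -/

namespace UERRF

open Set

variable {V : Type*}

/-- The connected set `A` is part of the component. Conversely the component is connected and
covered by the disjoint open sets `A` and `B`, so it cannot leave `A`. -/
theorem connectedComponentIn_eq_of_separated {K A B : Set (ℝ × ℝ)} (hA : IsOpen A) (hB : IsOpen B)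
    (hc : IsPreconnected A) (hAB : Disjoint A B) (hcov : Kᶜ ⊆ A ∪ B) (hAK : A ⊆ Kᶜ)
    {p : ℝ × ℝ} (hp : p ∈ A) : connectedComponentIn Kᶜ p = A := by
  refine Subset.antisymm ?_ (hc.subset_connectedComponentIn hp hAK)
  exact isPreconnected_connectedComponentIn.subset_left_of_subset_union hA hB hAB
    ((connectedComponentIn_subset _ _).trans hcov) ⟨p, mem_connectedComponentIn (hAK hp), hp⟩

/-- The complement is the union of four open half planes. They are convex, and in cyclic order each
one meets the union of its predecessors. -/
theorem isPreconnected_compl_box {a b c d : ℝ} :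
    IsPreconnected (Icc a b ×ˢ Icc c d)ᶜ := by
  have e : (Icc a b ×ˢ Icc c d)ᶜ = ((Iio a ×ˢ univ ∪ univ ×ˢ Iio c) ∪ Ioi b ×ˢ univ) ∪
      univ ×ˢ Ioi d := by
    ext ⟨x, y⟩
    simp only [mem_compl_iff, mem_prod, mem_Icc, mem_union, mem_Iio, mem_Ioi, mem_univ, and_true,
      true_and, not_and_or, not_le]
    tauto
  rw [e]
  have h1 : IsPreconnected (Iio a ×ˢ (univ : Set ℝ)) :=
    ((convex_Iio a).prod convex_univ).isPreconnected
  have h2 : IsPreconnected ((univ : Set ℝ) ×ˢ Iio c) :=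
    (convex_univ.prod (convex_Iio c)).isPreconnected
  have h3 : IsPreconnected (Ioi b ×ˢ (univ : Set ℝ)) :=
    ((convex_Ioi b).prod convex_univ).isPreconnected
  have h4 : IsPreconnected ((univ : Set ℝ) ×ˢ Ioi d) :=
    (convex_univ.prod (convex_Ioi d)).isPreconnected
  refine ((h1.union (a - 1, c - 1) ?_ ?_ h2).union (b + 1, c - 1) ?_ ?_ h3).union
    (b + 1, d + 1) ?_ ?_ h4 <;> simp

theorem frontier_box {a b c d : ℝ} (hab : a < b) (hcd : c < d) :
    frontier ((Icc a b ×ˢ Icc c d)ᶜ) =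
      {p | p ∈ Icc a b ×ˢ Icc c d ∧ (p.1 = a ∨ p.1 = b ∨ p.2 = c ∨ p.2 = d)} := by
  rw [frontier_compl, (isClosed_Icc.prod isClosed_Icc).frontier_eq, interior_prod_eq, interior_Icc,
    interior_Icc]
  ext ⟨x, y⟩
  simp only [mem_sdiff, mem_prod, mem_Icc, mem_Ioo, mem_ofPred_eq]
  constructor
  · rintro ⟨h1, h2⟩
    refine ⟨h1, ?_⟩
    by_contra! h
    exact h2 ⟨⟨lt_of_le_of_ne h1.1.1 h.1.symm, lt_of_le_of_ne h1.1.2 h.2.1⟩,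
      lt_of_le_of_ne h1.2.1 h.2.2.1.symm, lt_of_le_of_ne h1.2.2 h.2.2.2⟩
  · rintro ⟨h1, h2⟩
    refine ⟨h1, fun h => ?_⟩
    rcases h2 with rfl | rfl | rfl | rfl
    · exact lt_irrefl _ h.1.1
    · exact lt_irrefl _ h.1.2
    · exact lt_irrefl _ h.2.1
    · exact lt_irrefl _ h.2.2

theorem not_isBounded_compl_box {a b c d : ℝ} :
    ¬ Bornology.IsBounded (Icc a b ×ˢ Icc c d)ᶜ := by
  intro h
  have hR : Bornology.IsBounded (Icc a b ×ˢ Icc c d) :=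
    (isCompact_Icc.prod isCompact_Icc).isBounded
  have := h.union hR
  rw [compl_union_self] at this
  exact NormedSpace.unbounded_univ ℝ (ℝ × ℝ) this

namespace IsGridDrawing

variable {G : SimpleGraph V} {β : ℕ → V} {W H : ℕ} {D : Drawing V}

/-- The sides of the rectangle are covered. -/
theorem side_mem (hD : IsGridDrawing G β W H D) (hβ : IsClosedSeq G β (2 * (W + H))) {p : ℝ × ℝ}
    (hp : p ∈ Icc (0 : ℝ) W ×ˢ Icc (0 : ℝ) H) (h : p.1 = 0 ∨ p.1 = W ∨ p.2 = 0 ∨ p.2 = H) :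
    ∃ i < 2 * (W + H), p ∈ segment ℝ (pt D (β i)) (pt D (β (i + 1))) := by
  obtain ⟨⟨h1, h2⟩, h3, h4⟩ := hp
  -- At the far end `r = N` the floor would name a cell beyond the side; the last cell `N - 1` also
  -- contains this point.
  have cell : ∀ (r : ℝ) (N : ℕ), 0 < N → 0 ≤ r → r ≤ N → ∃ k < N, (k : ℝ) ≤ r ∧ r ≤ k + 1 := by
    intro r N hN h0 hr
    rcases hr.lt_or_eq with hlt | rfl
    · exact ⟨⌊r⌋₊, (Nat.floor_lt h0).2 hlt, Nat.floor_le h0, (Nat.lt_floor_add_one r).le⟩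
    · refine ⟨N - 1, by omega, ?_, ?_⟩ <;> rw [Nat.cast_sub hN] <;> simp
  have cong : ∀ {i : ℕ} {a b a' b' : ℕ}, i < 2 * (W + H) → boundaryX W H i = a →
      boundaryY W H i = b → boundaryX W H (i + 1) = a' → boundaryY W H (i + 1) = b' →
      D (β i) = ((a : ℤ), (b : ℤ)) ∧ D (β (i + 1)) = ((a' : ℤ), (b' : ℤ)) := by
    intro i a b a' b' hi e1 e2 e3 e4
    rw [hD.boundary_le hβ hi.le, hD.boundary_le hβ (show i + 1 ≤ _ by omega), e1, e2, e3, e4]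
    exact ⟨rfl, rfl⟩
  have hW := hD.W_pos
  have hH := hD.H_pos
  rcases h with h | h | h | h
  · obtain ⟨k, hk, l1, l2⟩ := cell p.2 H hH h3 h4
    obtain ⟨e1, e2⟩ := cong (i := 2 * (W + H) - 1 - k) (a := 0) (b := k + 1) (a' := 0) (b' := k)
      (by omega) (by unfold boundaryX; split_ifs <;> omega)
      (by unfold boundaryY; split_ifs <;> omega) (by unfold boundaryX; split_ifs <;> omega)
      (by unfold boundaryY; split_ifs <;> omega)
    refine ⟨2 * (W + H) - 1 - k, by omega, ?_⟩
    rw [segment_symm, mem_segment_pt_v (by rw [e1, e2]) (by rw [e1, e2]; simp), e1, e2]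
    exact ⟨by simpa using h, by simpa using l1, by simpa using l2⟩
  · obtain ⟨k, hk, l1, l2⟩ := cell p.2 H hH h3 h4
    obtain ⟨e1, e2⟩ := cong (i := W + k) (a := W) (b := k) (a' := W) (b' := k + 1)
      (by omega) (by unfold boundaryX; split_ifs <;> omega)
      (by unfold boundaryY; split_ifs <;> omega) (by unfold boundaryX; split_ifs <;> omega)
      (by unfold boundaryY; split_ifs <;> omega)
    refine ⟨W + k, by omega, ?_⟩
    rw [mem_segment_pt_v (by rw [e1, e2]) (by rw [e1, e2]; simp), e1, e2]
    exact ⟨by simpa using h, by simpa using l1, by simpa using l2⟩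
  · obtain ⟨k, hk, l1, l2⟩ := cell p.1 W hW h1 h2
    obtain ⟨e1, e2⟩ := cong (i := k) (a := k) (b := 0) (a' := k + 1) (b' := 0)
      (by omega) (by unfold boundaryX; split_ifs <;> omega)
      (by unfold boundaryY; split_ifs <;> omega) (by unfold boundaryX; split_ifs <;> omega)
      (by unfold boundaryY; split_ifs <;> omega)
    refine ⟨k, by omega, ?_⟩
    rw [mem_segment_pt_h (by rw [e1, e2]) (by rw [e1, e2]; simp), e1, e2]
    exact ⟨by simpa using h, by simpa using l1, by simpa using l2⟩
  · obtain ⟨k, hk, l1, l2⟩ := cell p.1 W hW h1 h2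
    obtain ⟨e1, e2⟩ := cong (i := 2 * W + H - 1 - k) (a := k + 1) (b := H) (a' := k) (b' := H)
      (by omega) (by unfold boundaryX; split_ifs <;> omega)
      (by unfold boundaryY; split_ifs <;> omega) (by unfold boundaryX; split_ifs <;> omega)
      (by unfold boundaryY; split_ifs <;> omega)
    refine ⟨2 * W + H - 1 - k, by omega, ?_⟩
    rw [segment_symm, mem_segment_pt_h (by rw [e1, e2]) (by rw [e1, e2]; simp), e1, e2]
    exact ⟨by simpa using h, by simpa using l1, by simpa using l2⟩

theorem segment_side (hD : IsGridDrawing G β W H D) (hβ : IsClosedSeq G β (2 * (W + H))) {i : ℕ}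
    (hi : i < 2 * (W + H)) {p : ℝ × ℝ} (hp : p ∈ segment ℝ (pt D (β i)) (pt D (β (i + 1)))) :
    p ∈ Icc (0 : ℝ) W ×ˢ Icc (0 : ℝ) H ∧ (p.1 = 0 ∨ p.1 = W ∨ p.2 = 0 ∨ p.2 = H) := by
  refine ⟨hD.carrier_subset hβ (.inr ⟨_, _, hβ.adj i hi, hp⟩), ?_⟩
  have e1 := hD.boundary_le hβ hi.le
  have e2 := hD.boundary_le hβ (show i + 1 ≤ _ by omega)
  rcases boundary_step hi with ⟨h1, h2, h3, h4⟩ | ⟨h1, h2, h3, h4⟩ | ⟨h1, h2, h3, h4⟩ |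
    ⟨h1, h2, h3, h4⟩
  · rw [mem_segment_pt_h (by rw [e1, e2, h1, h2]) (by rw [e1, e2, h4]; simp), e1, h1] at hp
    exact .inr (.inr (.inl (by simpa using hp.1)))
  · rw [mem_segment_pt_v (by rw [e1, e2, h1, h2]) (by rw [e1, e2, h4]; simp), e1, h1] at hp
    exact .inr (.inl (by simpa using hp.1))
  · rw [segment_symm, mem_segment_pt_h (by rw [e1, e2, h1, h2]) (by rw [e1, e2, h4]; simp), e2, h2]
      at hp
    exact .inr (.inr (.inr (by simpa using hp.1)))
  · rw [segment_symm, mem_segment_pt_v (by rw [e1, e2, h1, h2]) (by rw [e1, e2, h4]; simp), e2, h2]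
      at hp
    exact .inl (by simpa using hp.1)

theorem side_mem_carrier (hD : IsGridDrawing G β W H D) (hβ : IsClosedSeq G β (2 * (W + H)))
    {p : ℝ × ℝ} (hp : p ∈ Icc (0 : ℝ) W ×ˢ Icc (0 : ℝ) H)
    (h : p.1 = 0 ∨ p.1 = W ∨ p.2 = 0 ∨ p.2 = H) : p ∈ carrier G D := by
  obtain ⟨i, hi, hp⟩ := hD.side_mem hβ hp h
  exact .inr ⟨_, _, hβ.adj i hi, hp⟩

/-- All four sides are covered, so the plane without the drawing is contained in the union of the
exterior and the open interior of the rectangle; the exterior is connected and free of the drawing.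
-/
theorem external_component (hD : IsGridDrawing G β W H D) (hβ : IsClosedSeq G β (2 * (W + H)))
    {p : ℝ × ℝ} (hp : p ∉ Icc (0 : ℝ) W ×ˢ Icc (0 : ℝ) H) :
    connectedComponentIn (carrier G D)ᶜ p = (Icc (0 : ℝ) W ×ˢ Icc (0 : ℝ) H)ᶜ := by
  refine connectedComponentIn_eq_of_separated (B := Ioo (0 : ℝ) W ×ˢ Ioo (0 : ℝ) H)
    (isClosed_Icc.prod isClosed_Icc).isOpen_compl (isOpen_Ioo.prod isOpen_Ioo)
    isPreconnected_compl_box ?_ ?_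
    (compl_subset_compl.2 (hD.carrier_subset hβ)) hp
  · rw [Set.disjoint_left]
    intro q hq hq'
    exact hq ⟨Ioo_subset_Icc_self hq'.1, Ioo_subset_Icc_self hq'.2⟩
  · intro q hq
    by_cases hR : q ∈ Icc (0 : ℝ) W ×ˢ Icc (0 : ℝ) H
    · right
      have hne : ¬ (q.1 = 0 ∨ q.1 = W ∨ q.2 = 0 ∨ q.2 = H) := fun h =>
        hq (hD.side_mem_carrier hβ hR h)
      push Not at hne
      exact ⟨⟨lt_of_le_of_ne hR.1.1 hne.1.symm, lt_of_le_of_ne hR.1.2 hne.2.1⟩,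
        lt_of_le_of_ne hR.2.1 hne.2.2.1.symm, lt_of_le_of_ne hR.2.2 hne.2.2.2⟩
    · exact .inl hR

/-- A small free box around the point is enlarged by `FreeBox.exists_maximal`. The resulting open
box misses the drawing, while its sides are covered, which separates it from everything else. -/
theorem internal_component (hD : IsGridDrawing G β W H D) (hβ : IsClosedSeq G β (2 * (W + H)))
    {p : ℝ × ℝ} (hp : p ∈ Icc (0 : ℝ) W ×ˢ Icc (0 : ℝ) H) (hpK : p ∉ carrier G D) :
    ∃ a b c d : ℝ, a < b ∧ c < d ∧
      connectedComponentIn (carrier G D)ᶜ p = Ioo a b ×ˢ Ioo c d := by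
  have hne : ¬ (p.1 = 0 ∨ p.1 = W ∨ p.2 = 0 ∨ p.2 = H) := fun h =>
    hpK (hD.side_mem_carrier hβ hp h)
  push Not at hne
  have hx0 : 0 < p.1 := lt_of_le_of_ne hp.1.1 hne.1.symm
  have hxW : p.1 < W := lt_of_le_of_ne hp.1.2 hne.2.1
  have hy0 : 0 < p.2 := lt_of_le_of_ne hp.2.1 hne.2.2.1.symm
  have hyH : p.2 < H := lt_of_le_of_ne hp.2.2 hne.2.2.2
  have f1 := Int.floor_le p.1
  have f2 := Int.lt_floor_add_one p.1
  have f3 := Int.floor_le p.2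
  have f4 := Int.lt_floor_add_one p.2
  have c1 := Int.le_ceil p.1
  have c2 := Int.ceil_lt_add_one p.1
  have c3 := Int.le_ceil p.2
  have c4 := Int.ceil_lt_add_one p.2
  -- In a non-integer coordinate the box is one cell wide; in an integer one it is two cells wide,
  -- with the grid line through `p` in the middle. A unit segment meeting its interior would contain
  -- `p`.
  have hfree : FreeBox (Hor G D) (Ver G D) (⌈p.1⌉ - 1) (⌊p.1⌋ + 1) (⌈p.2⌉ - 1) (⌊p.2⌋ + 1) := by
    constructor
    · intro x y h1 h2 h3 h4 hh
      have e3 : (⌈p.2⌉ : ℝ) ≤ y := by exact_mod_cast Int.le_of_sub_one_lt h3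
      have e4 : (y : ℝ) ≤ ⌊p.2⌋ := by exact_mod_cast Int.le_of_lt_add_one h4
      have e1 : (⌈p.1⌉ : ℝ) - 1 ≤ x := by exact_mod_cast h1
      have e2 : (x : ℝ) ≤ ⌊p.1⌋ := by exact_mod_cast Int.le_of_lt_add_one h2
      exact hpK (hh.mem_carrier (le_antisymm (by linarith) (by linarith)) (by linarith)
        (by linarith))
    · intro x y h1 h2 h3 h4 hh
      have e3 : (⌈p.2⌉ : ℝ) - 1 ≤ y := by exact_mod_cast h3
      have e4 : (y : ℝ) ≤ ⌊p.2⌋ := by exact_mod_cast Int.le_of_lt_add_one h4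
      have e1 : (⌈p.1⌉ : ℝ) ≤ x := by exact_mod_cast Int.le_of_sub_one_lt h1
      have e2 : (x : ℝ) ≤ ⌊p.1⌋ := by exact_mod_cast Int.le_of_lt_add_one h2
      exact hpK (hh.mem_carrier (le_antisymm (by linarith) (by linarith)) (by linarith)
        (by linarith))
  have i1 : 1 ≤ ⌈p.1⌉ := Int.one_le_ceil_iff.2 hx0
  have i2 : ⌊p.1⌋ < (W : ℤ) := Int.floor_lt.2 (by exact_mod_cast hxW)
  have i3 : 1 ≤ ⌈p.2⌉ := Int.one_le_ceil_iff.2 hy0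
  have i4 : ⌊p.2⌋ < (H : ℤ) := Int.floor_lt.2 (by exact_mod_cast hyH)
  have i5 : ⌈p.1⌉ < ⌊p.1⌋ + 2 := by
    have : (⌈p.1⌉ : ℝ) < ⌊p.1⌋ + 2 := by linarith
    exact_mod_cast this
  have i6 : ⌈p.2⌉ < ⌊p.2⌋ + 2 := by
    have : (⌈p.2⌉ : ℝ) < ⌊p.2⌋ + 2 := by linarith
    exact_mod_cast this
  obtain ⟨a, b, c, d, ha, hb, hc, hd, hf, hh, hv⟩ := hfree.exists_maximal
    (fun x y => hD.passThrough) (fun x h h' => (hD.hor_boundary hβ h h').1)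
    (fun x h h' => (hD.hor_boundary hβ h h').2) (fun y h h' => (hD.ver_boundary hβ h h').1)
    (fun y h h' => (hD.ver_boundary hβ h h').2) (by omega) (by omega) (by omega) (by omega)
    (by omega) (by omega)
  have ra : (a : ℝ) ≤ ⌈p.1⌉ - 1 := by exact_mod_cast ha
  have rb : (⌊p.1⌋ : ℝ) + 1 ≤ b := by exact_mod_cast hb
  have rc : (c : ℝ) ≤ ⌈p.2⌉ - 1 := by exact_mod_cast hc
  have rd : (⌊p.2⌋ : ℝ) + 1 ≤ d := by exact_mod_cast hd
  have cell : ∀ (r : ℝ) (s t : ℤ), s < t → (s : ℝ) ≤ r → r ≤ t →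
      ∃ k, s ≤ k ∧ k < t ∧ (k : ℝ) ≤ r ∧ r ≤ k + 1 := by
    intro r s t hst h1 h2
    rcases h2.lt_or_eq with hlt | rfl
    · exact ⟨⌊r⌋, Int.le_floor.2 h1, Int.floor_lt.2 hlt, Int.floor_le r,
        (Int.lt_floor_add_one r).le⟩
    · exact ⟨t - 1, by omega, by omega, by push_cast; linarith, by push_cast; linarith⟩
  refine ⟨a, b, c, d, by linarith, by linarith, ?_⟩
  refine connectedComponentIn_eq_of_separated (B := (Icc (a : ℝ) b ×ˢ Icc (c : ℝ) d)ᶜ)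
    (isOpen_Ioo.prod isOpen_Ioo) (isClosed_Icc.prod isClosed_Icc).isOpen_compl
    ((convex_Ioo _ _).prod (convex_Ioo _ _)).isPreconnected ?_ ?_
    (hD.disjoint_box hβ hf).subset_compl_right
    ⟨⟨by linarith, by linarith⟩, by linarith, by linarith⟩
  · rw [Set.disjoint_left]
    intro q hq hq'
    exact hq' ⟨Ioo_subset_Icc_self hq.1, Ioo_subset_Icc_self hq.2⟩
  · intro q hq
    by_cases hR : q ∈ Icc (a : ℝ) b ×ˢ Icc (c : ℝ) d
    · left
      by_contra hn
      apply hq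
      have hside : q.1 = a ∨ q.1 = b ∨ q.2 = c ∨ q.2 = d := by
        by_contra! h
        exact hn ⟨⟨lt_of_le_of_ne hR.1.1 h.1.symm, lt_of_le_of_ne hR.1.2 h.2.1⟩,
          lt_of_le_of_ne hR.2.1 h.2.2.1.symm, lt_of_le_of_ne hR.2.2 h.2.2.2⟩
      obtain ⟨kx, k1, k2, k3, k4⟩ := cell q.1 a b (by omega) hR.1.1 hR.1.2
      obtain ⟨ky, l1, l2, l3, l4⟩ := cell q.2 c d (by omega) hR.2.1 hR.2.2
      rcases hside with e | e | e | e
      · exact (hv ky l1 l2).1.mem_carrier e l3 l4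
      · exact (hv ky l1 l2).2.mem_carrier e l3 l4
      · exact (hh kx k1 k2).1.mem_carrier e k3 k4
      · exact (hh kx k1 k2).2.mem_carrier e k3 k4
    · exact .inr hR

theorem isExternalFace (hD : IsGridDrawing G β W H D) (hβ : IsClosedSeq G β (2 * (W + H))) :
    IsExternalFace G D (Icc (0 : ℝ) W ×ˢ Icc (0 : ℝ) H)ᶜ := by
  have hp : ((-1 : ℝ), (0 : ℝ)) ∉ Icc (0 : ℝ) W ×ˢ Icc (0 : ℝ) H := by
    rintro ⟨⟨h, -⟩, -⟩
    norm_num at h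
  exact ⟨⟨_, fun h => hp (hD.carrier_subset hβ h), (hD.external_component hβ hp).symm⟩,
    not_isBounded_compl_box⟩

theorem isUERRF (hD : IsGridDrawing G β W H D) (hβ : IsClosedSeq G β (2 * (W + H))) :
    IsUERRF G D := by
  refine ⟨hD.isRectilinear, hD.hasUnitEdges, ?_, ?_⟩
  · rintro F ⟨⟨p, hp, rfl⟩, hb⟩
    by_cases hR : p ∈ Icc (0 : ℝ) W ×ˢ Icc (0 : ℝ) H
    · exact hD.internal_component hβ hR hp
    · rw [hD.external_component hβ hR] at hb
      exact absurd hb not_isBounded_compl_box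
  · rintro F ⟨⟨p, hp, rfl⟩, hb⟩
    by_cases hR : p ∈ Icc (0 : ℝ) W ×ˢ Icc (0 : ℝ) H
    · obtain ⟨a, b, c, d, -, -, e⟩ := hD.internal_component hβ hR hp
      rw [e] at hb
      exact absurd ((Metric.isBounded_Ioo a b).prod (Metric.isBounded_Ioo c d)) hb
    · exact ⟨0, W, 0, H, by exact_mod_cast hD.W_pos, by exact_mod_cast hD.H_pos,
        hD.external_component hβ hR⟩

theorem hasExternalCycle (hD : IsGridDrawing G β W H D) (hβ : IsClosedSeq G β (2 * (W + H)))
    {r : V} {C : G.Walk r r}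
    (hC : ∀ e, e ∈ C.edges ↔ ∃ i < 2 * (W + H), e = s(β i, β (i + 1))) :
    HasExternalCycle G D C := by
  refine ⟨_, hD.isExternalFace hβ, ?_⟩
  rw [frontier_box (by exact_mod_cast hD.W_pos) (by exact_mod_cast hD.H_pos)]
  ext p
  simp only [mem_ofPred_eq, hC]
  constructor
  · rintro ⟨h1, h2⟩
    obtain ⟨i, hi, hp⟩ := hD.side_mem hβ h1 h2
    exact ⟨_, _, ⟨i, hi, rfl⟩, hp⟩
  · rintro ⟨u, v, ⟨i, hi, e⟩, hp⟩
    apply hD.segment_side hβ hi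
    rcases Sym2.eq_iff.1 e with ⟨rfl, rfl⟩ | ⟨rfl, rfl⟩
    · exact hp
    · rwa [segment_symm]

/-- Four different vertices lie in a set of at most four corner points, hence they exhaust it. -/
theorem hasCorners (hD : IsGridDrawing G β W H D) (hβ : IsClosedSeq G β (2 * (W + H)))
    {k : Fin 4 → V} (hk : Function.Injective k)
    (hc : ∀ i, ((D (k i)).1 = 0 ∨ (D (k i)).1 = W) ∧ ((D (k i)).2 = 0 ∨ (D (k i)).2 = H)) :
    HasCorners G D k := by
  refine ⟨0, W, 0, H, by exact_mod_cast hD.W_pos, by exact_mod_cast hD.H_pos,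
    hD.isExternalFace hβ, ?_⟩
  have hinj : Function.Injective fun i => pt D (k i) := by
    intro i j h
    simp only [pt, Prod.mk.injEq] at h
    exact hk (hD.injective (Prod.ext (by exact_mod_cast h.1) (by exact_mod_cast h.2)))
  have hsub : range (fun i => pt D (k i)) ⊆
      {((0 : ℝ), (0 : ℝ)), (0, (H : ℝ)), ((W : ℝ), 0), ((W : ℝ), (H : ℝ))} := by
    rintro _ ⟨i, rfl⟩
    obtain ⟨h1, h2⟩ := hc i
    rcases h1 with h1 | h1 <;> rcases h2 with h2 | h2 <;> simp [pt, h1, h2]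
  refine Set.eq_of_subset_of_ncard_le hsub ?_
  rw [← image_univ, ncard_image_of_injective _ hinj, ncard_univ, Nat.card_fin]
  refine (ncard_insert_le _ _).trans ?_
  have h1 := ncard_insert_le ((0 : ℝ), (H : ℝ)) {((W : ℝ), (0 : ℝ)), ((W : ℝ), (H : ℝ))}
  have h2 := ncard_insert_le ((W : ℝ), (0 : ℝ)) {((W : ℝ), (H : ℝ))}
  have h3 := ncard_singleton ((W : ℝ), (H : ℝ))
  omega

end IsGridDrawing
end UERRF

/-! ### Valid drawings satisfy the integer conditions. -/

namespace UERRF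

open Set

variable {V : Type*}

/-- A point on an edge, with the edge directed rightwards or upwards. -/
theorem IsRectilinear.segment_cases {G : SimpleGraph V} {D : Drawing V} (hD : IsRectilinear G D)
    {u v : V} (h : G.Adj u v) {p : ℝ × ℝ} (hp : p ∈ segment ℝ (pt D u) (pt D v)) :
    ∃ a b, (a = u ∧ b = v ∨ a = v ∧ b = u) ∧ G.Adj a b ∧
      ((D a).2 = (D b).2 ∧ (D a).1 < (D b).1 ∧ p.2 = (D a).2 ∧ ((D a).1 : ℝ) ≤ p.1 ∧
        p.1 ≤ (D b).1 ∨
      (D a).1 = (D b).1 ∧ (D a).2 < (D b).2 ∧ p.1 = (D a).1 ∧ ((D a).2 : ℝ) ≤ p.2 ∧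
        p.2 ≤ (D b).2) := by
  obtain ⟨a, b, hab, hadj, hdir⟩ := exists_directed hD.injective hD.aligned h
  have hp : p ∈ segment ℝ (pt D a) (pt D b) := by
    rcases hab with ⟨rfl, rfl⟩ | ⟨rfl, rfl⟩
    · exact hp
    · rwa [segment_symm]
  refine ⟨a, b, hab, hadj, ?_⟩
  rcases hdir with ⟨e, l⟩ | ⟨e, l⟩
  · exact .inl ⟨e, l, (mem_segment_pt_h e l.le).1 hp⟩
  · exact .inr ⟨e, l, (mem_segment_pt_v e l.le).1 hp⟩

/-- The neighbours of `t` in a set of integers that contains points on both sides of `t`. -/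
theorem exists_int_gap {P : ℤ → Prop} {l t r : ℤ} (hlt : l < t) (htr : t < r) (hl : P l) (hr : P r)
    (ht : ¬ P t) : ∃ a b, l ≤ a ∧ a < t ∧ t < b ∧ b ≤ r ∧ P a ∧ P b ∧
      ∀ s, a < s → s < b → ¬ P s := by
  obtain ⟨a, ⟨ha, hat⟩, hmax⟩ := Int.exists_greatest_of_bdd (P := fun s => P s ∧ s < t)
    ⟨t, fun z hz => hz.2.le⟩ ⟨l, hl, hlt⟩
  obtain ⟨b, ⟨hb, htb⟩, hmin⟩ := Int.exists_least_of_bdd (P := fun s => P s ∧ t < s)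
    ⟨t, fun z hz => hz.2.le⟩ ⟨r, hr, htr⟩
  refine ⟨a, b, hmax l ⟨hl, hlt⟩, hat, htb, hmin r ⟨hr, htr⟩, ha, hb, fun s h1 h2 hs => ?_⟩
  rcases lt_trichotomy s t with h | rfl | h
  · have := hmax s ⟨hs, h⟩; omega
  · exact ht hs
  · have := hmin s ⟨hs, h⟩; omega

/-- Suppose that a grid point inside an edge is not on a perpendicular edge. Then it is not a vertex
of the drawing. The nearest vertices of the drawing on either side of it along the edge exist, since
the ends are such vertices, and they are consecutive at distance at least two, contradicting unit
length. -/
theorem IsRectilinear.isLattice {G : SimpleGraph V} {D : Drawing V} (hD : IsRectilinear G D)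
    (hU : HasUnitEdges G D) : IsLattice G D := by
  refine ⟨hD.injective, hD.aligned, hD.clear_h, hD.clear_v, ?_, ?_⟩
  · intro u v t h e h1 h2
    by_contra hno
    have key := exists_int_gap (P := fun s => IsDrawingVertex G D ((s : ℝ), ((D u).2 : ℝ))) h1 h2
      (.inl ⟨u, rfl⟩) (.inl ⟨v, by simp [pt, e]⟩) (by
        rintro (⟨w, hw⟩ | hc)
        · simp only [pt, Prod.mk.injEq] at hw
          norm_cast at hw
          exact hD.clear_h u v w h e hw.2.symm ⟨by omega, by omega⟩
        · obtain ⟨a, b, a', b', -, hadj, -, e', hp, -, -, l3, l4⟩ := hD.crossing hc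
          simp only [Prod.mk.injEq] at hp
          norm_cast at hp
          exact hno ⟨a', b', hadj, by omega, by omega, by omega, by omega⟩)
    obtain ⟨a, b, ha, hat, htb, hb, pa, pb, hgap⟩ := key
    have hlen := hU u v h ((a : ℝ), ((D u).2 : ℝ)) ((b : ℝ), ((D u).2 : ℝ))
      ((mem_segment_pt_h e (by omega)).2 ⟨rfl, by simpa using ha, by simp only; norm_cast; omega⟩)
      ((mem_segment_pt_h e (by omega)).2 ⟨rfl, by simp only; norm_cast; omega, by simpa using hb⟩)
      (by intro h; simp only [Prod.mk.injEq] at h; norm_cast at h; omega) pa pb (by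
        intro r hr hv
        obtain ⟨x, y, rfl⟩ := hD.drawingVertex_int hv
        rw [mem_openSegment_h (by exact_mod_cast by omega)] at hr
        simp only at hr
        rw [hr.1] at hv
        exact hgap x (by exact_mod_cast hr.2.1) (by exact_mod_cast hr.2.2) hv)
    simp only [sub_self, abs_zero, add_zero] at hlen
    have : |a - b| = 1 := by exact_mod_cast hlen
    rw [abs_of_neg (by omega)] at this
    omega
  · intro u v t h e h1 h2
    by_contra hno
    have key := exists_int_gap (P := fun s => IsDrawingVertex G D (((D u).1 : ℝ), (s : ℝ))) h1 h2
      (.inl ⟨u, rfl⟩) (.inl ⟨v, by simp [pt, e]⟩) (by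
        rintro (⟨w, hw⟩ | hc)
        · simp only [pt, Prod.mk.injEq] at hw
          norm_cast at hw
          exact hD.clear_v u v w h e hw.1.symm ⟨by omega, by omega⟩
        · obtain ⟨a, b, a', b', hadj, -, e', -, hp, l3, l4, -, -⟩ := hD.crossing hc
          simp only [Prod.mk.injEq] at hp
          norm_cast at hp
          exact hno ⟨a, b, hadj, by omega, by omega, by omega, by omega⟩)
    obtain ⟨a, b, ha, hat, htb, hb, pa, pb, hgap⟩ := key
    have hlen := hU u v h (((D u).1 : ℝ), (a : ℝ)) (((D u).1 : ℝ), (b : ℝ))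
      ((mem_segment_pt_v e (by omega)).2 ⟨rfl, by simpa using ha, by simp only; norm_cast; omega⟩)
      ((mem_segment_pt_v e (by omega)).2 ⟨rfl, by simp only; norm_cast; omega, by simpa using hb⟩)
      (by intro h; simp only [Prod.mk.injEq] at h; norm_cast at h; omega) pa pb (by
        intro r hr hv
        obtain ⟨x, y, rfl⟩ := hD.drawingVertex_int hv
        rw [mem_openSegment_v (by exact_mod_cast by omega)] at hr
        simp only at hr
        rw [hr.1] at hv
        exact hgap y (by exact_mod_cast hr.2.1) (by exact_mod_cast hr.2.2) hv)
    simp only [sub_self, abs_zero, zero_add] at hlen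
    have : |a - b| = 1 := by exact_mod_cast hlen
    rw [abs_of_neg (by omega)] at this
    omega

/-- Without a neighbour above `v`, nothing is drawn in a box above `v`. -/
theorem IsRectilinear.disjoint_up {G : SimpleGraph V} {D : Drawing V} (hD : IsRectilinear G D)
    {v : V} (h : ∀ q, G.Adj v q → (D q).1 = (D v).1 → ¬ (D v).2 < (D q).2) :
    Ioo ((D v).1 - 1 : ℝ) ((D v).1 + 1) ×ˢ Ioo ((D v).2 : ℝ) ((D v).2 + 1) ⊆ (carrier G D)ᶜ := by
  rintro p ⟨⟨h1, h2⟩, h3, h4⟩ (⟨w, rfl⟩ | ⟨u, w, hadj, hp⟩)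
  · simp only [pt] at h3 h4
    norm_cast at h3 h4
    omega
  -- A horizontal edge has an integer ordinate and misses the open strip. A vertical edge meeting
  -- the box lies in the column of `v` and, as it does not run over `v`, starts there.
  · obtain ⟨a, b, -, hadj, ⟨e, l, e2, -⟩ | ⟨e, l, e1, l1, l2⟩⟩ := hD.segment_cases hadj hp
    · rw [e2] at h3 h4
      norm_cast at h3 h4
      omega
    · rw [e1] at h1 h2
      have a1 : (D a).2 < (D v).2 + 1 := by exact_mod_cast l1.trans_lt h4
      have a2 : (D v).2 < (D b).2 := by exact_mod_cast h3.trans_le l2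
      have a3 : (D v).1 - 1 < (D a).1 := by exact_mod_cast h1
      have a4 : (D a).1 < (D v).1 + 1 := by exact_mod_cast h2
      have := hD.clear_v a b v hadj e (by omega)
      obtain rfl : v = a := hD.injective (Prod.ext (by omega) (by omega))
      exact h b hadj e.symm a2

theorem IsRectilinear.disjoint_down {G : SimpleGraph V} {D : Drawing V} (hD : IsRectilinear G D)
    {v : V} (h : ∀ q, G.Adj v q → (D q).1 = (D v).1 → ¬ (D q).2 < (D v).2) :
    Ioo ((D v).1 - 1 : ℝ) ((D v).1 + 1) ×ˢ Ioo ((D v).2 - 1 : ℝ) (D v).2 ⊆ (carrier G D)ᶜ := by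
  rintro p ⟨⟨h1, h2⟩, h3, h4⟩ (⟨w, rfl⟩ | ⟨u, w, hadj, hp⟩)
  · simp only [pt] at h3 h4
    norm_cast at h3 h4
    omega
  · obtain ⟨a, b, -, hadj, ⟨e, l, e2, -⟩ | ⟨e, l, e1, l1, l2⟩⟩ := hD.segment_cases hadj hp
    · rw [e2] at h3 h4
      norm_cast at h3 h4
      omega
    · rw [e1] at h1 h2
      have a1 : (D a).2 < (D v).2 := by exact_mod_cast l1.trans_lt h4
      have a2 : (D v).2 - 1 < (D b).2 := by exact_mod_cast h3.trans_le l2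
      have a3 : (D v).1 - 1 < (D a).1 := by exact_mod_cast h1
      have a4 : (D a).1 < (D v).1 + 1 := by exact_mod_cast h2
      have := hD.clear_v a b v hadj e (by omega)
      obtain rfl : v = b := hD.injective (Prod.ext (by omega) (by omega))
      exact h a hadj.symm e a1

theorem IsRectilinear.disjoint_right {G : SimpleGraph V} {D : Drawing V} (hD : IsRectilinear G D)
    {v : V} (h : ∀ q, G.Adj v q → (D q).2 = (D v).2 → ¬ (D v).1 < (D q).1) :
    Ioo ((D v).1 : ℝ) ((D v).1 + 1) ×ˢ Ioo ((D v).2 - 1 : ℝ) ((D v).2 + 1) ⊆ (carrier G D)ᶜ := by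
  rintro p ⟨⟨h1, h2⟩, h3, h4⟩ (⟨w, rfl⟩ | ⟨u, w, hadj, hp⟩)
  · simp only [pt] at h1 h2
    norm_cast at h1 h2
    omega
  · obtain ⟨a, b, -, hadj, ⟨e, l, e1, l1, l2⟩ | ⟨e, l, e2, -⟩⟩ := hD.segment_cases hadj hp
    · rw [e1] at h3 h4
      have a1 : (D a).1 < (D v).1 + 1 := by exact_mod_cast l1.trans_lt h2
      have a2 : (D v).1 < (D b).1 := by exact_mod_cast h1.trans_le l2
      have a3 : (D v).2 - 1 < (D a).2 := by exact_mod_cast h3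
      have a4 : (D a).2 < (D v).2 + 1 := by exact_mod_cast h4
      have := hD.clear_h a b v hadj e (by omega)
      obtain rfl : v = a := hD.injective (Prod.ext (by omega) (by omega))
      exact h b hadj e.symm a2
    · rw [e2] at h1 h2
      norm_cast at h1 h2
      omega

theorem IsRectilinear.disjoint_left {G : SimpleGraph V} {D : Drawing V} (hD : IsRectilinear G D)
    {v : V} (h : ∀ q, G.Adj v q → (D q).2 = (D v).2 → ¬ (D q).1 < (D v).1) :
    Ioo ((D v).1 - 1 : ℝ) (D v).1 ×ˢ Ioo ((D v).2 - 1 : ℝ) ((D v).2 + 1) ⊆ (carrier G D)ᶜ := by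
  rintro p ⟨⟨h1, h2⟩, h3, h4⟩ (⟨w, rfl⟩ | ⟨u, w, hadj, hp⟩)
  · simp only [pt] at h1 h2
    norm_cast at h1 h2
    omega
  · obtain ⟨a, b, -, hadj, ⟨e, l, e1, l1, l2⟩ | ⟨e, l, e2, -⟩⟩ := hD.segment_cases hadj hp
    · rw [e1] at h3 h4
      have a1 : (D a).1 < (D v).1 := by exact_mod_cast l1.trans_lt h2
      have a2 : (D v).1 - 1 < (D b).1 := by exact_mod_cast h1.trans_le l2
      have a3 : (D v).2 - 1 < (D a).2 := by exact_mod_cast h3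
      have a4 : (D a).2 < (D v).2 + 1 := by exact_mod_cast h4
      have := hD.clear_h a b v hadj e (by omega)
      obtain rfl : v = b := hD.injective (Prod.ext (by omega) (by omega))
      exact h a hadj.symm e a1
    · rw [e2] at h1 h2
      norm_cast at h1 h2
      omega

/-- The complements of two bounded rectangles meet because the plane is unbounded, and two
components that meet are equal. -/
theorem IsUERRF.externalFace_unique {G : SimpleGraph V} {D : Drawing V} (hD : IsUERRF G D)
    {F F' : Set (ℝ × ℝ)} (hF : IsExternalFace G D F) (hF' : IsExternalFace G D F') : F = F' := by
  obtain ⟨a, b, c, d, -, -, e⟩ := hD.external_rect F hF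
  obtain ⟨a', b', c', d', -, -, e'⟩ := hD.external_rect F' hF'
  obtain ⟨q, hq, hq'⟩ : (F ∩ F').Nonempty := by
    rw [e, e', ← compl_union]
    by_contra hne
    rw [not_nonempty_iff_eq_empty, compl_empty_iff] at hne
    have hbd : Bornology.IsBounded (Icc a b ×ˢ Icc c d ∪ Icc a' b' ×ˢ Icc c' d') :=
      (isCompact_Icc.prod isCompact_Icc).isBounded.union
        (isCompact_Icc.prod isCompact_Icc).isBounded
    rw [hne] at hbd
    exact NormedSpace.unbounded_univ ℝ (ℝ × ℝ) hbd
  obtain ⟨z, -, hz⟩ := hF.1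
  obtain ⟨z', -, hz'⟩ := hF'.1
  rw [hz] at hq ⊢
  rw [hz'] at hq' ⊢
  rw [connectedComponentIn_eq hq, connectedComponentIn_eq hq']

/-- An internal face that contains two points also contains the point midway between them. -/
theorem IsUERRF.midpoint_notMem {G : SimpleGraph V} {D : Drawing V} (hD : IsUERRF G D)
    {R A B : Set (ℝ × ℝ)} (hR : IsExternalFace G D Rᶜ) (hA : A ⊆ (carrier G D)ᶜ)
    (hB : B ⊆ (carrier G D)ᶜ) (cA : Convex ℝ A) (cB : Convex ℝ B) {x y h k : ℝ}
    (hpA : (x + h, y + k) ∈ A) (hpB : (x - h, y - k) ∈ B) (hAB : (A ∩ B).Nonempty)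
    (hpR : (x + h, y + k) ∈ R) : (x, y) ∉ carrier G D := by
  set F := connectedComponentIn (carrier G D)ᶜ (x + h, y + k) with hF
  have hpF : (x + h, y + k) ∈ F := mem_connectedComponentIn (hA hpA)
  -- The overlapping convex sets lie in one face. If it is bounded it is a rectangle, which contains
  -- midpoints; it cannot be the external face, since it meets `R`.
  have hsub : A ∪ B ⊆ F := (cA.isPreconnected.union' hAB cB.isPreconnected).subset_connectedComponentIn
    (.inl hpA) (union_subset hA hB)
  have hface : IsFace G D F := ⟨_, hA hpA, rfl⟩
  by_cases hb : Bornology.IsBounded F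
  · obtain ⟨a, b, c, d, -, -, e⟩ := hD.internal_rect F ⟨hface, hb⟩
    have h1 : (x + h, y + k) ∈ F := hpF
    have h2 : (x - h, y - k) ∈ F := hsub (.inr hpB)
    have hmem : (x, y) ∈ F := by
      rw [e] at h1 h2 ⊢
      obtain ⟨⟨a1, a2⟩, a3, a4⟩ := h1
      obtain ⟨⟨b1, b2⟩, b3, b4⟩ := h2
      simp only at a1 a2 a3 a4 b1 b2 b3 b4
      exact ⟨⟨by simp only; linarith, by simp only; linarith⟩,
        ⟨by simp only; linarith, by simp only; linarith⟩⟩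
    exact connectedComponentIn_subset _ _ hmem
  · have e1 := hD.externalFace_unique ⟨hface, hb⟩ hR
    rw [e1] at hpF
    exact absurd hpR hpF

/-- If both conclusions fail, the vertex lacks a neighbour in one horizontal and in one vertical
direction. The two half boxes on these sides are empty and overlap in a quadrant, and they contain
two points of which the vertex is the midpoint. By `IsUERRF.midpoint_notMem` the vertex would not
lie on the drawing. -/
theorem IsUERRF.straight {G : SimpleGraph V} {D : Drawing V} (hD : IsUERRF G D) {a b c d : ℤ}
    (hR : IsExternalFace G D (Icc (a : ℝ) b ×ˢ Icc (c : ℝ) d)ᶜ) {v : V} (ha : a < (D v).1)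
    (hb : (D v).1 < b) (hc : c < (D v).2) (hd : (D v).2 < d) :
    (∃ p q, G.Adj v p ∧ G.Adj v q ∧ (D p).2 = (D v).2 ∧ (D q).2 = (D v).2 ∧
      (D p).1 < (D v).1 ∧ (D v).1 < (D q).1) ∨
    ∃ p q, G.Adj v p ∧ G.Adj v q ∧ (D p).1 = (D v).1 ∧ (D q).1 = (D v).1 ∧
      (D p).2 < (D v).2 ∧ (D v).2 < (D q).2 := by
  have hrec := hD.rectilinear
  have hv : (((D v).1 : ℝ), ((D v).2 : ℝ)) ∈ carrier G D := .inl ⟨v, rfl⟩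
  have ra : (a : ℝ) + 1 ≤ (D v).1 := by exact_mod_cast ha
  have rb : ((D v).1 : ℝ) + 1 ≤ b := by exact_mod_cast hb
  have rc : (c : ℝ) + 1 ≤ (D v).2 := by exact_mod_cast hc
  have rd : ((D v).2 : ℝ) + 1 ≤ d := by exact_mod_cast hd
  have cvx : ∀ p q r s : ℝ, Convex ℝ (Ioo p q ×ˢ Ioo r s) := fun p q r s =>
    (convex_Ioo p q).prod (convex_Ioo r s)
  by_contra hno
  push Not at hno
  obtain ⟨hno1, hno2⟩ := hno
  have hx : (∀ q, G.Adj v q → (D q).2 = (D v).2 → ¬ (D q).1 < (D v).1) ∨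
      ∀ q, G.Adj v q → (D q).2 = (D v).2 → ¬ (D v).1 < (D q).1 := by
    by_contra! h
    obtain ⟨⟨p, p1, p2, p3⟩, q, q1, q2, q3⟩ := h
    exact absurd q3 (not_lt.2 (hno1 p q p1 q1 p2 q2 p3))
  have hy : (∀ q, G.Adj v q → (D q).1 = (D v).1 → ¬ (D q).2 < (D v).2) ∨
      ∀ q, G.Adj v q → (D q).1 = (D v).1 → ¬ (D v).2 < (D q).2 := by
    by_contra! h
    obtain ⟨⟨p, p1, p2, p3⟩, q, q1, q2, q3⟩ := h
    exact absurd q3 (not_lt.2 (hno2 p q p1 q1 p2 q2 p3))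
  rcases hx with hx | hx <;> rcases hy with hy | hy
  · refine hD.midpoint_notMem hR (hrec.disjoint_left hx) (hrec.disjoint_down hy) (cvx _ _ _ _)
      (cvx _ _ _ _) (h := -1 / 2) (k := 1 / 2) ?_ ?_ ⟨((D v).1 - 1 / 2, (D v).2 - 1 / 2), ?_⟩ ?_ hv
    all_goals
      simp only [mem_inter_iff, mem_prod, mem_Ioo, mem_Icc]
      constructorm* _ ∧ _ <;> linarith
  · refine hD.midpoint_notMem hR (hrec.disjoint_left hx) (hrec.disjoint_up hy) (cvx _ _ _ _)
      (cvx _ _ _ _) (h := -1 / 2) (k := -1 / 2) ?_ ?_ ⟨((D v).1 - 1 / 2, (D v).2 + 1 / 2), ?_⟩ ?_ hv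
    all_goals
      simp only [mem_inter_iff, mem_prod, mem_Ioo, mem_Icc]
      constructorm* _ ∧ _ <;> linarith
  · refine hD.midpoint_notMem hR (hrec.disjoint_right hx) (hrec.disjoint_down hy) (cvx _ _ _ _)
      (cvx _ _ _ _) (h := 1 / 2) (k := 1 / 2) ?_ ?_ ⟨((D v).1 + 1 / 2, (D v).2 - 1 / 2), ?_⟩ ?_ hv
    all_goals
      simp only [mem_inter_iff, mem_prod, mem_Ioo, mem_Icc]
      constructorm* _ ∧ _ <;> linarith
  · refine hD.midpoint_notMem hR (hrec.disjoint_right hx) (hrec.disjoint_up hy) (cvx _ _ _ _)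
      (cvx _ _ _ _) (h := 1 / 2) (k := -1 / 2) ?_ ?_ ⟨((D v).1 + 1 / 2, (D v).2 + 1 / 2), ?_⟩ ?_ hv
    all_goals
      simp only [mem_inter_iff, mem_prod, mem_Ioo, mem_Icc]
      constructorm* _ ∧ _ <;> linarith

end UERRF

/-! ### Walking along the external cycle from any start in both orientations. -/

namespace UERRF

open Set

variable {V : Type*}

/-- The drawing moved by `(-a, -c)`. -/
def shift (a c : ℤ) (D : Drawing V) : Drawing V := fun v => ((D v).1 - a, (D v).2 - c)

theorem IsLattice.shift {G : SimpleGraph V} {D : Drawing V} (hD : IsLattice G D) (a c : ℤ) :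
    IsLattice G (shift a c D) where
  injective u v h := by
    simp only [UERRF.shift, Prod.mk.injEq] at h
    exact hD.injective (Prod.ext (by omega) (by omega))
  aligned u v h := by have := hD.aligned u v h; simp only [UERRF.shift]; omega
  clear_h u v w h e e' := by
    simp only [UERRF.shift] at *
    have := hD.clear_h u v w h (by omega) (by omega)
    omega
  clear_v u v w h e e' := by
    simp only [UERRF.shift] at *
    have := hD.clear_v u v w h (by omega) (by omega)
    omega
  cross_h u v t h e h1 h2 := by
    simp only [UERRF.shift] at *
    obtain ⟨p, q, hpq, l⟩ := hD.cross_h u v (t + a) h (by omega) (by omega) (by omega)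
    exact ⟨p, q, hpq, by omega⟩
  cross_v u v t h e h1 h2 := by
    simp only [UERRF.shift] at *
    obtain ⟨p, q, hpq, l⟩ := hD.cross_v u v (t + c) h (by omega) (by omega) (by omega)
    exact ⟨p, q, hpq, by omega⟩

/-- Position on a closed walk of length `m` after `i` steps from position `s`, forwards if `o = 0`
and backwards otherwise. -/
def cycIdx (m s o i : ℕ) : ℕ :=
  if o = 0 then (if m ≤ s + i then s + i - m else s + i)
  else if m ≤ s + m - i then s + m - i - m else s + m - i

/-- The vertex of a closed walk reached after `i` steps from position `s`. -/
def cyc {G : SimpleGraph V} {r : V} (C : G.Walk r r) (s o i : ℕ) : V :=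
  C.getVert (cycIdx C.length s o i)

theorem mem_edges_iff_getVert {G : SimpleGraph V} {u v : V} (p : G.Walk u v) (e : Sym2 V) :
    e ∈ p.edges ↔ ∃ i < p.length, e = s(p.getVert i, p.getVert (i + 1)) := by
  induction p with
  | nil => simp
  | cons h p ih =>
    simp only [SimpleGraph.Walk.edges_cons, List.mem_cons, ih, SimpleGraph.Walk.length_cons]
    constructor
    · rintro (rfl | ⟨i, hi, rfl⟩)
      · exact ⟨0, by omega, by simp⟩
      · exact ⟨i + 1, by omega, by simp⟩
    · rintro ⟨i, hi, rfl⟩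
      cases i with
      | zero => left; simp
      | succ i => right; exact ⟨i, by omega, by simp⟩

section cyc

variable {G : SimpleGraph V} {r : V} {C : G.Walk r r} {s o : ℕ}

/-- The hypothesis lists how two consecutive indices can match the edge at position `j`: forwards or
backwards, possibly across the place where the closed walk wraps around. -/
theorem cyc_edge_eq {i j : ℕ}
    (h : cycIdx C.length s o i = j ∧ (cycIdx C.length s o (i + 1) = j + 1 ∨
        j + 1 = C.length ∧ cycIdx C.length s o (i + 1) = 0) ∨
      cycIdx C.length s o (i + 1) = j ∧ (cycIdx C.length s o i = j + 1 ∨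
        j + 1 = C.length ∧ cycIdx C.length s o i = 0)) :
    s(cyc C s o i, cyc C s o (i + 1)) = s(C.getVert j, C.getVert (j + 1)) := by
  have wrap : C.getVert C.length = C.getVert 0 := by simp
  unfold cyc
  rcases h with ⟨h1, h2 | ⟨h3, h2⟩⟩ | ⟨h1, h2 | ⟨h3, h2⟩⟩
  · rw [h1, h2]
  · rw [h1, h2, h3, wrap]
  · rw [h1, h2, Sym2.eq_swap]
  · rw [h1, h2, h3, wrap, Sym2.eq_swap]

theorem cyc_edges (hs : s < C.length) (e : Sym2 V) :
    e ∈ C.edges ↔ ∃ i < C.length, e = s(cyc C s o i, cyc C s o (i + 1)) := by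
  rw [mem_edges_iff_getVert]
  constructor
  · rintro ⟨j, hj, rfl⟩
    by_cases ho : o = 0
    · by_cases h : s ≤ j
      · exact ⟨j - s, by omega, (cyc_edge_eq (by unfold cycIdx; split_ifs <;> omega)).symm⟩
      · exact ⟨j + C.length - s, by omega,
          (cyc_edge_eq (by unfold cycIdx; split_ifs <;> omega)).symm⟩
    · by_cases h : j < s
      · exact ⟨s - 1 - j, by omega, (cyc_edge_eq (by unfold cycIdx; split_ifs <;> omega)).symm⟩
      · exact ⟨s + C.length - 1 - j, by omega,
          (cyc_edge_eq (by unfold cycIdx; split_ifs <;> omega)).symm⟩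
  · rintro ⟨i, hi, rfl⟩
    -- When the walk is traversed backwards, an edge is found at the index of its second end.
    refine ⟨if o = 0 then cycIdx C.length s o i else cycIdx C.length s o (i + 1), ?_, cyc_edge_eq ?_⟩
    · unfold cycIdx; split_ifs <;> omega
    · unfold cycIdx; split_ifs <;> omega

theorem cyc_closed (hs : s < C.length) : cyc C s o C.length = cyc C s o 0 := by
  unfold cyc cycIdx
  split_ifs <;> first | omega | (congr 1 <;> omega)

theorem cyc_isClosedSeq (hs : s < C.length) : IsClosedSeq G (cyc C s o) C.length := by
  refine ⟨fun i hi => ?_, cyc_closed hs⟩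
  have h := (cyc_edges (o := o) hs _).2 ⟨i, hi, rfl⟩
  exact C.adj_of_mem_edges h

theorem cyc_injOn (hC : C.IsCycle) (hs : s < C.length) {i j : ℕ} (hi : i < C.length)
    (hj : j < C.length) (h : cyc C s o i = cyc C s o j) : i = j := by
  unfold cyc at h
  have h := hC.getVert_injOn' (by simp only [cycIdx, mem_ofPred_eq]; split_ifs <;> omega)
    (by simp only [cycIdx, mem_ofPred_eq]; split_ifs <;> omega) h
  unfold cycIdx at h
  split_ifs at h <;> omega

theorem exists_cyc_eq {v : V} (hm : 0 < C.length) (hv : v ∈ C.support) :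
    ∃ s < C.length, ∀ o, cyc C s o 0 = v := by
  obtain ⟨i, e, hi⟩ := SimpleGraph.Walk.mem_support_iff_exists_getVert.1 hv
  rcases hi.lt_or_eq with h | rfl
  · exact ⟨i, h, fun o => by rw [← e]; unfold cyc cycIdx; split_ifs <;> first | omega | (congr 1 <;> omega)⟩
  · refine ⟨0, hm, fun o => ?_⟩
    rw [← e, show C.getVert C.length = C.getVert 0 by simp]
    unfold cyc cycIdx; split_ifs <;> first | omega | (congr 1 <;> omega)

theorem cyc_mem_support (i : ℕ) : cyc C s o i ∈ C.support := C.getVert_mem_support _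

end cyc

/-- Two grid points joined by a unit segment on the boundary of `[0, W] × [0, H]`. -/
def Side (W H : ℕ) (p q : ℤ × ℤ) : Prop :=
  p.2 = q.2 ∧ (p.2 = 0 ∨ p.2 = H) ∧ (q.1 = p.1 + 1 ∨ p.1 = q.1 + 1) ∨
    p.1 = q.1 ∧ (p.1 = 0 ∨ p.1 = W) ∧ (q.2 = p.2 + 1 ∨ p.2 = q.2 + 1)

/-- A boundary point has just two boundary points at unit distance along the sides, its predecessor
and its successor on the boundary walk. -/
theorem side_boundary {W H i : ℕ} (hW : 0 < W) (hH : 0 < H) (hi : i + 1 < 2 * (W + H)) {q : ℤ × ℤ}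
    (hq : 0 ≤ q.1 ∧ q.1 ≤ W ∧ 0 ≤ q.2 ∧ q.2 ≤ H)
    (h : Side W H ((boundaryX W H (i + 1) : ℤ), (boundaryY W H (i + 1) : ℤ)) q) :
    q = ((boundaryX W H (i + 1 + 1) : ℤ), (boundaryY W H (i + 1 + 1) : ℤ)) ∨
      q = ((boundaryX W H i : ℤ), (boundaryY W H i : ℤ)) := by
  obtain ⟨x, y⟩ := q
  simp only [Prod.mk.injEq, Side] at *
  rcases boundary_step (W := W) (H := H) (i := i) (by omega) with h1 | h1 | h1 | h1 <;>
    rcases boundary_step (W := W) (H := H) (i := i + 1) hi with h2 | h2 | h2 | h2 <;> omega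

/-- A closed sequence of grid points along the boundary of a rectangle is the boundary walk. -/
theorem boundary_sequence {W H m : ℕ} {β : ℕ → V} {D : Drawing V} (hinj : Function.Injective D)
    (hW : 0 < W) (hH : 0 < H) (hm : 3 ≤ m)
    (hβ : ∀ i j, i < m → j < m → β i = β j → i = j) (hclosed : β m = β 0)
    (hin : ∀ v, 0 ≤ (D v).1 ∧ (D v).1 ≤ W ∧ 0 ≤ (D v).2 ∧ (D v).2 ≤ H)
    (hside : ∀ i < m, Side W H (D (β i)) (D (β (i + 1)))) (h0 : D (β 0) = (0, 0))
    (h1 : D (β 1) = (1, 0)) :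
    m = 2 * (W + H) ∧ ∀ i < m, D (β i) = ((boundaryX W H i : ℤ), (boundaryY W H i : ℤ)) := by
  have b0 : boundaryX W H 0 = 0 ∧ boundaryY W H 0 = 0 := by simp [boundaryX, boundaryY]
  -- Given two consecutive correct positions, the next vertex is one step ahead or one step back;
  -- the latter would repeat a vertex. In the last step the repetition is with `β 0`, and `3 ≤ m`
  -- excludes it.
  have key : ∀ i, i + 1 ≤ m → i + 1 ≤ 2 * (W + H) →
      D (β i) = ((boundaryX W H i : ℤ), (boundaryY W H i : ℤ)) ∧
      D (β (i + 1)) = ((boundaryX W H (i + 1) : ℤ), (boundaryY W H (i + 1) : ℤ)) := by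
    intro i
    induction i with
    | zero =>
      intro _ _
      refine ⟨by rw [h0, b0.1, b0.2]; rfl, ?_⟩
      have : boundaryX W H 1 = 1 ∧ boundaryY W H 1 = 0 := by
        unfold boundaryX boundaryY; split_ifs <;> omega
      rw [zero_add, h1, this.1, this.2]; rfl
    | succ i ih =>
      intro h2 h3
      obtain ⟨e1, e2⟩ := ih (by omega) (by omega)
      refine ⟨e2, ?_⟩
      have hs := hside (i + 1) (by omega)
      rw [e2] at hs
      rcases side_boundary hW hH (by omega) (hin _) hs with e | e
      · exact e
      · rw [← e1] at e
        have e := hinj e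
        rcases h2.lt_or_eq with h4 | h4
        · have := hβ _ _ h4 (by omega) e; omega
        · rw [h4, hclosed] at e
          have := hβ _ _ (by omega) (by omega) e; omega
  -- A shorter cycle would close up away from the origin, a longer one would visit the origin twice.
  have hN : m = 2 * (W + H) := by
    rcases lt_trichotomy m (2 * (W + H)) with h | h | h
    · have e := (key (m - 1) (by omega) (by omega)).2
      rw [show m - 1 + 1 = m by omega, hclosed, h0] at e
      simp only [Prod.mk.injEq] at e
      norm_cast at e
      unfold boundaryX boundaryY at e
      split_ifs at e <;> omega
    · exact h
    · have e := (key (2 * (W + H) - 1) (by omega) (by omega)).2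
      rw [show 2 * (W + H) - 1 + 1 = 2 * (W + H) by omega, (boundary_last W H hW hH).1,
        (boundary_last W H hW hH).2, b0.1, b0.2] at e
      have := hβ _ _ h (by omega) (hinj (e.trans h0.symm))
      omega
  exact ⟨hN, fun i hi => (key i (by omega) (by omega)).1⟩

end UERRF

/-! ### Moving a valid drawing to the origin. -/

namespace UERRF

open Set

variable {V : Type*} {G : SimpleGraph V} {D : Drawing V}

/-- A corner of a rectangle that contains the drawing and lies on an edge is a vertex. -/
theorem IsRectilinear.lower_corner (hD : IsRectilinear G D) {u v : V} (h : G.Adj u v) {a c : ℝ}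
    (hu : ∀ w, a ≤ (D w).1 ∧ c ≤ (D w).2) (hp : (a, c) ∈ segment ℝ (pt D u) (pt D v)) :
    ∃ w, (w = u ∨ w = v) ∧ pt D w = (a, c) := by
  obtain ⟨p, q, hpq, -, ⟨-, -, e, l, -⟩ | ⟨-, -, e, l, -⟩⟩ := hD.segment_cases h hp
  · exact ⟨p, by tauto, Prod.ext (le_antisymm l (hu p).1) e.symm⟩
  · exact ⟨p, by tauto, Prod.ext e.symm (le_antisymm l (hu p).2)⟩

theorem IsRectilinear.upper_corner (hD : IsRectilinear G D) {u v : V} (h : G.Adj u v) {b d : ℝ}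
    (hu : ∀ w, (D w).1 ≤ b ∧ (D w).2 ≤ d) (hp : (b, d) ∈ segment ℝ (pt D u) (pt D v)) :
    ∃ w, (w = u ∨ w = v) ∧ pt D w = (b, d) := by
  obtain ⟨p, q, hpq, -, ⟨h1, -, e, -, l⟩ | ⟨h1, -, e, -, l⟩⟩ := hD.segment_cases h hp
  · exact ⟨q, by tauto, Prod.ext (le_antisymm (hu q).1 l)
      (by simp only [pt, ← h1]; exact e.symm)⟩
  · exact ⟨q, by tauto, Prod.ext (by simp only [pt, ← h1]; exact e.symm)
      (le_antisymm (hu q).2 l)⟩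

/-- Edges on the boundary of the rectangle are unit segments on one of its sides. -/
theorem IsLattice.side (hD : IsLattice G D) {W H : ℕ}
    (hin : ∀ v, 0 ≤ (D v).1 ∧ (D v).1 ≤ W ∧ 0 ≤ (D v).2 ∧ (D v).2 ≤ H) {u v : V} (h : G.Adj u v)
    (hseg : ∀ p ∈ segment ℝ (pt D u) (pt D v), p.1 = 0 ∨ p.1 = W ∨ p.2 = 0 ∨ p.2 = H) :
    Side W H (D u) (D v) := by
  obtain ⟨a, b, hab, hadj, hdir⟩ := exists_directed hD.injective hD.aligned h
  have hseg : ∀ p ∈ segment ℝ (pt D a) (pt D b), p.1 = 0 ∨ p.1 = W ∨ p.2 = 0 ∨ p.2 = H := by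
    rcases hab with ⟨rfl, rfl⟩ | ⟨rfl, rfl⟩
    · exact hseg
    · rwa [segment_symm]
  have hs : Side W H (D a) (D b) := by
    rcases hdir with ⟨e, l⟩ | ⟨e, l⟩
    -- The point half a unit along the edge has a non-integer abscissa, so it is not on a vertical
    -- side of the rectangle and must be on a horizontal one.
    · have hmid := hseg (((D a).1 : ℝ) + 1 / 2, ((D a).2 : ℝ)) ((mem_segment_pt_h e l.le).2
        ⟨rfl, by simp only; linarith, by
          have : ((D a).1 : ℝ) + 1 ≤ (D b).1 := by exact_mod_cast l
          simp only; linarith⟩)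
      have hy : (D a).2 = 0 ∨ (D a).2 = H := by
        simp only at hmid
        rcases hmid with h | h | h | h
        · exfalso
          have : (2 * (D a).1 + 1 : ℝ) = 0 := by linarith
          norm_cast at this
          omega
        · exfalso
          have : (2 * (D a).1 + 1 : ℝ) = 2 * W := by linarith
          norm_cast at this
          omega
        · exact .inl (by exact_mod_cast h)
        · exact .inr (by exact_mod_cast h)
      -- A longer edge on the side would be crossed at its next grid point, and the crossing edge
      -- would leave the rectangle.
      have hlen : (D b).1 = (D a).1 + 1 := by
        by_contra hne
        obtain ⟨p, q, -, -, -, l1, l2⟩ := hD.cross_h a b ((D a).1 + 1) hadj e (by omega) (by omega)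
        have h1 := hin p
        have h2 := hin q
        omega
      exact .inl ⟨e, hy, .inl hlen⟩
    · have hmid := hseg (((D a).1 : ℝ), ((D a).2 : ℝ) + 1 / 2) ((mem_segment_pt_v e l.le).2
        ⟨rfl, by simp only; linarith, by
          have : ((D a).2 : ℝ) + 1 ≤ (D b).2 := by exact_mod_cast l
          simp only; linarith⟩)
      have hy : (D a).1 = 0 ∨ (D a).1 = W := by
        simp only at hmid
        rcases hmid with h | h | h | h
        · exact .inl (by exact_mod_cast h)
        · exact .inr (by exact_mod_cast h)
        · exfalso
          have : (2 * (D a).2 + 1 : ℝ) = 0 := by linarith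
          norm_cast at this
          omega
        · exfalso
          have : (2 * (D a).2 + 1 : ℝ) = 2 * H := by linarith
          norm_cast at this
          omega
      have hlen : (D b).2 = (D a).2 + 1 := by
        by_contra hne
        obtain ⟨p, q, -, -, -, l1, l2⟩ := hD.cross_v a b ((D a).2 + 1) hadj e (by omega) (by omega)
        have h1 := hin p
        have h2 := hin q
        omega
      exact .inr ⟨e, hy, .inl hlen⟩
  rcases hab with ⟨rfl, rfl⟩ | ⟨rfl, rfl⟩
  · exact hs
  · unfold Side at *; omega

/-- A valid drawing is a grid drawing, up to a translation and the choice of the corner of the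
external cycle that is placed at the origin. -/
theorem IsUERRF.exists_gridDrawing {r : V} {C : G.Walk r r} (hC : C.IsCycle) (hD : IsUERRF G D)
    (hE : HasExternalCycle G D C) :
    ∃ (a c : ℤ) (W H s o : ℕ), s < C.length ∧ o < 2 ∧ 2 * (W + H) = C.length ∧
      IsGridDrawing G (cyc C s o) W H (shift a c D) ∧
      IsExternalFace G D (Icc (a : ℝ) ((a + W : ℤ) : ℝ) ×ˢ Icc (c : ℝ) ((c + H : ℤ) : ℝ))ᶜ := by
  have hm := hC.three_le_length
  have hrec := hD.rectilinear
  have hlat := hrec.isLattice hD.unit_edges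
  obtain ⟨F, hF, hfr⟩ := hE
  obtain ⟨a, b, c, d, hab, hcd, rfl⟩ := hD.external_rect F hF
  rw [frontier_box hab hcd] at hfr
  have hsub : carrier G D ⊆ Icc a b ×ˢ Icc c d := by
    obtain ⟨z, -, hz⟩ := hF.1
    rw [← compl_subset_compl, hz]
    exact connectedComponentIn_subset _ _
  have hvert : ∀ v, pt D v ∈ Icc a b ×ˢ Icc c d := fun v => hsub (.inl ⟨v, rfl⟩)
  -- Two opposite corners of the external rectangle are covered by edges of the cycle. An edge
  -- cannot continue beyond the rectangle, so these corners are vertices; this makes the four real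
  -- bounds integers and provides the start of the cycle.
  obtain ⟨u₁, v₁, hC₁, hp₁⟩ : (a, c) ∈ {p | ∃ u v, s(u, v) ∈ C.edges ∧
      p ∈ segment ℝ (pt D u) (pt D v)} := by
    rw [← hfr]; exact ⟨⟨⟨le_rfl, hab.le⟩, le_rfl, hcd.le⟩, .inl rfl⟩
  obtain ⟨u₂, v₂, hC₂, hp₂⟩ : (b, d) ∈ {p | ∃ u v, s(u, v) ∈ C.edges ∧
      p ∈ segment ℝ (pt D u) (pt D v)} := by
    rw [← hfr]; exact ⟨⟨⟨hab.le, le_rfl⟩, hcd.le, le_rfl⟩, .inr (.inl rfl)⟩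
  obtain ⟨w₁, hw₁, e₁⟩ := hrec.lower_corner (C.adj_of_mem_edges hC₁)
    (fun w => ⟨(hvert w).1.1, (hvert w).2.1⟩) hp₁
  obtain ⟨w₂, -, e₂⟩ := hrec.upper_corner (C.adj_of_mem_edges hC₂)
    (fun w => ⟨(hvert w).1.2, (hvert w).2.2⟩) hp₂
  have hw₁C : w₁ ∈ C.support := by
    rcases hw₁ with rfl | rfl
    · exact C.fst_mem_support_of_mem_edges hC₁
    · exact C.snd_mem_support_of_mem_edges hC₁
  simp only [pt, Prod.mk.injEq] at e₁ e₂
  obtain ⟨rfl, rfl⟩ := e₁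
  obtain ⟨rfl, rfl⟩ := e₂
  have hab' : (D w₁).1 < (D w₂).1 := by exact_mod_cast hab
  have hcd' : (D w₁).2 < (D w₂).2 := by exact_mod_cast hcd
  obtain ⟨W, hW⟩ : ∃ W : ℕ, (D w₂).1 = (D w₁).1 + W :=
    ⟨((D w₂).1 - (D w₁).1).toNat, by omega⟩
  obtain ⟨H, hH⟩ : ∃ H : ℕ, (D w₂).2 = (D w₁).2 + H :=
    ⟨((D w₂).2 - (D w₁).2).toNat, by omega⟩
  rw [hW, hH] at hF hfr hvert
  rw [hW] at hab'
  rw [hH] at hcd'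
  clear hab hcd hsub hp₂ hp₁ hW hH
  set a := (D w₁).1 with ha
  set c := (D w₁).2 with hc
  have hin : ∀ v, 0 ≤ (shift a c D v).1 ∧ (shift a c D v).1 ≤ W ∧ 0 ≤ (shift a c D v).2 ∧
      (shift a c D v).2 ≤ H := by
    intro v
    obtain ⟨⟨h1, h2⟩, h3, h4⟩ := hvert v
    simp only [pt] at h1 h2 h3 h4
    norm_cast at h1 h2 h3 h4
    simp only [shift]
    omega
  have hlat' := hlat.shift a c
  have hedge : ∀ u v, s(u, v) ∈ C.edges → Side W H (shift a c D u) (shift a c D v) := by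
    intro u v huv
    refine hlat'.side hin (C.adj_of_mem_edges huv) fun p hp => ?_
    have hp' : (p.1 + a, p.2 + c) ∈ segment ℝ (pt D u) (pt D v) := by
      have hu : ∀ w, pt D w = ((a : ℝ), (c : ℝ)) + pt (shift a c D) w := by
        intro w; simp [pt, shift]
      have hpe : (p.1 + a, p.2 + c) = ((a : ℝ), (c : ℝ)) + p := by
        ext <;> simp [add_comm]
      rw [hu u, hu v, hpe, mem_segment_translate]
      exact hp
    have hmem : (p.1 + a, p.2 + c) ∈ {p | ∃ u v, s(u, v) ∈ C.edges ∧
      p ∈ segment ℝ (pt D u) (pt D v)} := ⟨u, v, huv, hp'⟩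
    rw [← hfr] at hmem
    obtain ⟨-, h⟩ := hmem
    push_cast at h
    rcases h with h | h | h | h
    · exact .inl (by linarith)
    · exact .inr (.inl (by linarith))
    · exact .inr (.inr (.inl (by linarith)))
    · exact .inr (.inr (.inr (by linarith)))
  obtain ⟨s, hs, hcyc⟩ := exists_cyc_eq (by omega) hw₁C
  have hWpos : 0 < W := by omega
  have hHpos : 0 < H := by omega
  have h0 : ∀ o, shift a c D (cyc C s o 0) = (0, 0) := by
    intro o
    rw [hcyc]
    simp [shift, ha, hc]
  have hside : ∀ o, ∀ i < C.length, Side W H (shift a c D (cyc C s o i))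
      (shift a c D (cyc C s o (i + 1))) := fun o i hi =>
    hedge _ _ ((cyc_edges hs _).2 ⟨i, hi, rfl⟩)
  -- The two neighbours of the start on the cycle differ, as the cycle has length at least three.
  -- They are at `(1, 0)` and `(0, 1)` in some order, so one orientation begins to the right.
  have hdiff : cyc C s 0 1 ≠ cyc C s 1 1 := by
    intro h
    have e : cyc C s 1 1 = cyc C s 0 (C.length - 1) := by
      have : cycIdx C.length s 1 1 = cycIdx C.length s 0 (C.length - 1) := by
        simp only [cycIdx, if_true, one_ne_zero, if_false]
        split_ifs
        all_goals omega
      unfold cyc; rw [this]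
    rw [e] at h
    have := cyc_injOn hC hs (by omega) (by omega) h
    omega
  have hfirst : ∀ o, shift a c D (cyc C s o 1) = (1, 0) ∨ shift a c D (cyc C s o 1) = (0, 1) := by
    intro o
    have h1 := hside o 0 (by omega)
    have h2 := hin (cyc C s o 1)
    rw [h0] at h1
    simp only [Side, zero_add] at h1
    simp only [Prod.ext_iff]
    omega
  obtain ⟨o, ho, h1⟩ : ∃ o < 2, shift a c D (cyc C s o 1) = (1, 0) := by
    rcases hfirst 0 with h | h
    · exact ⟨0, by omega, h⟩
    · rcases hfirst 1 with h' | h'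
      · exact ⟨1, by omega, h'⟩
      · exact absurd (hlat'.injective (h.trans h'.symm)) hdiff
  obtain ⟨hN, hb⟩ := boundary_sequence (β := cyc C s o) hlat'.injective hWpos hHpos hm
    (fun i j hi hj h => cyc_injOn hC hs hi hj h) (cyc_closed hs) hin (hside o) (h0 o) h1
  refine ⟨a, c, W, H, s, o, hs, ho, hN.symm, ⟨hlat', hWpos, hHpos, hin, ?_, ?_⟩, hF⟩
  · rw [← hN]; exact hb
  · intro v
    by_cases hv : (shift a c D v).1 = 0 ∨ (shift a c D v).1 = W ∨ (shift a c D v).2 = 0 ∨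
        (shift a c D v).2 = H
    · exact .inl hv
    · right
      have hi := hin v
      simp only [shift] at hv hi ⊢
      have := hD.straight hF (v := v) (by omega) (by omega) (by omega) (by omega)
      simp only [sub_left_inj, sub_lt_sub_iff_right]
      exact this

/-- Where the prescribed corners are in a grid drawing that comes from a valid drawing. -/
theorem HasCorners.shift {k : Fin 4 → V} (hD : IsUERRF G D) (hk : HasCorners G D k) {a c : ℤ}
    {W H : ℕ} (hW : 0 < W) (hH : 0 < H) (hF : IsExternalFace G D
      (Icc (a : ℝ) ((a + W : ℤ) : ℝ) ×ˢ Icc (c : ℝ) ((c + H : ℤ) : ℝ))ᶜ) :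
    (∀ i, ((UERRF.shift a c D (k i)).1 = 0 ∨ (UERRF.shift a c D (k i)).1 = W) ∧
      ((UERRF.shift a c D (k i)).2 = 0 ∨ (UERRF.shift a c D (k i)).2 = H)) ∧
    (∃ i, UERRF.shift a c D (k i) = (0, 0)) ∧ ∃ i, UERRF.shift a c D (k i) = ((W : ℤ), 0) := by
  obtain ⟨a', b', c', d', hab, hcd, hF', hr⟩ := hk
  -- The rectangle that witnesses the corners is the external rectangle, by uniqueness of the
  -- external face.
  have e := compl_injective (hD.externalFace_unique hF' hF)
  have ne : (Icc a' b' ×ˢ Icc c' d').Nonempty := ⟨(a', c'), ⟨le_rfl, hab.le⟩, le_rfl, hcd.le⟩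
  have ha : (a : ℝ) < ((a + W : ℤ) : ℝ) := by exact_mod_cast by omega
  have hc : (c : ℝ) < ((c + H : ℤ) : ℝ) := by exact_mod_cast by omega
  obtain ⟨e1, e2⟩ := (prod_eq_prod_iff_of_nonempty ne).1 e
  obtain ⟨rfl, rfl⟩ := (Icc_eq_Icc_iff hab.le).1 e1
  obtain ⟨rfl, rfl⟩ := (Icc_eq_Icc_iff hcd.le).1 e2
  refine ⟨fun i => ?_, ?_, ?_⟩
  · have : pt D (k i) ∈ range fun i => pt D (k i) := ⟨i, rfl⟩
    rw [hr] at this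
    simp only [pt, mem_insert_iff, mem_singleton_iff, Prod.mk.injEq] at this
    norm_cast at this
    simp only [UERRF.shift]
    omega
  · have : ((a : ℝ), (c : ℝ)) ∈ range fun i => pt D (k i) := by rw [hr]; simp
    obtain ⟨i, hi⟩ := this
    simp only [pt, Prod.mk.injEq] at hi
    norm_cast at hi
    exact ⟨i, by simp only [UERRF.shift, Prod.mk.injEq]; omega⟩
  · have : (((a + W : ℤ) : ℝ), (c : ℝ)) ∈ range fun i => pt D (k i) := by rw [hr]; simp
    obtain ⟨i, hi⟩ := this
    simp only [pt, Prod.mk.injEq] at hi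
    norm_cast at hi
    exact ⟨i, by simp only [UERRF.shift, Prod.mk.injEq]; omega⟩

end UERRF

/-! ### Conditions as expressions, and scans that only check. -/

namespace WordRAM

namespace Expr

/-- Negation of a condition. -/
def not (e : Expr) : Expr := .eq e (.const 0)

/-- The condition `e ≤ f`. -/
def le (e f : Expr) : Expr := .lt e (.add f (.const 1))

/-- The condition that `f k` holds for some `k < 4`. -/
def any4 (f : Expr → Expr) : Expr :=
  .add (.add (f (.const 0)) (f (.const 1))) (.add (f (.const 2)) (f (.const 3)))

theorem add_ne {s : State} {e f : Expr} :
    (Expr.add e f).eval s ≠ 0 ↔ e.eval s ≠ 0 ∨ f.eval s ≠ 0 := by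
  simp only [eval]; omega

theorem mul_ne {s : State} {e f : Expr} :
    (Expr.mul e f).eval s ≠ 0 ↔ e.eval s ≠ 0 ∧ f.eval s ≠ 0 := by
  simp [eval]

theorem lt_ne {s : State} {e f : Expr} : (Expr.lt e f).eval s ≠ 0 ↔ e.eval s < f.eval s := by
  simp [eval]

theorem eq_ne {s : State} {e f : Expr} : (Expr.eq e f).eval s ≠ 0 ↔ e.eval s = f.eval s := by
  simp [eval]

theorem not_ne {s : State} {e : Expr} : e.not.eval s ≠ 0 ↔ ¬ e.eval s ≠ 0 := by
  simp only [not, eval]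
  by_cases h : eval s e = 0 <;> simp [h]

theorem le_ne {s : State} {e f : Expr} : (e.le f).eval s ≠ 0 ↔ e.eval s ≤ f.eval s := by
  simp [le, eval]

theorem any4_ne {s : State} {f : Expr → Expr} :
    (any4 f).eval s ≠ 0 ↔ ∃ k < 4, (f (.const k)).eval s ≠ 0 := by
  simp only [any4, add_ne]
  constructor
  · rintro ((h | h) | h | h)
    exacts [⟨0, by omega, h⟩, ⟨1, by omega, h⟩, ⟨2, by omega, h⟩, ⟨3, by omega, h⟩]
  · rintro ⟨k, hk, h⟩
    interval_cases k <;> tauto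

end Expr

namespace Scan

/-- Nothing is written. -/
def Quiet (s : State) (φ : Scan) : Prop := ∀ j w, ¬ Hit s φ j w

/-- Raise the flag in cell `0` unless the condition holds. -/
def check (c : Expr) : Scan := .put c.not (.const 0) (.const 1)

theorem quiet_check {s : State} {c : Expr} : Quiet s (check c) ↔ c.eval s ≠ 0 := by
  simp only [Quiet, check, Hit, Expr.not_ne]
  constructor
  · intro h
    by_contra hc
    exact h _ _ ⟨fun h' => h' hc, rfl, rfl⟩
  · intro h j w hh
    exact hh.1 h

theorem quiet_all {s : State} {x : ℕ} {lim : Option ℕ} {φ : Scan} :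
    Quiet s (all x lim φ) ↔ ∀ k < limVal (s.reg 0) lim, Quiet (s.setReg x k) φ := by
  simp only [Quiet, Hit, not_exists, not_and]
  exact ⟨fun h k hk j w => h j w k hk, fun h j w k hk => h k hk j w⟩

theorem quiet_bind {s : State} {x : ℕ} {e : Expr} {φ : Scan} :
    Quiet s (bind x e φ) ↔ Quiet (s.setReg x (e.eval s)) φ := Iff.rfl

theorem quiet_guard {s : State} {e : Expr} {φ : Scan} :
    Quiet s (guard e φ) ↔ (e.eval s ≠ 0 → Quiet s φ) := by
  simp only [Quiet, Hit, not_and]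
  exact ⟨fun h he j w => h j w he, fun h j w he => h he j w⟩

theorem quiet_both {s : State} {φ ψ : Scan} :
    Quiet s (both φ ψ) ↔ Quiet s φ ∧ Quiet s ψ := by
  simp only [Quiet, Hit, not_or]
  exact ⟨fun h => ⟨fun j w => (h j w).1, fun j w => (h j w).2⟩, fun h j w => ⟨h.1 j w, h.2 j w⟩⟩

end Scan
end WordRAM

namespace UERRF

open WordRAM

/-! ### The algorithm

Registers: `0` number of vertices, `1` length of the cycle, `2` start on the cycle, `3` width,
`4` orientation, `5` height. Arrays: `0`–`4` input, `5` and `6` coordinates, `7` vertices of the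
cycle, `8` chain ends, `9` edges going up, `10` and `11` grid points inside vertical and horizontal
edges, `12` auxiliary, `13` failure flag. -/

section Expressions

/-- First coordinate of a vertex. -/
def xE (v : Expr) : Expr := .read 5 v

/-- Second coordinate of a vertex. -/
def yE (v : Expr) : Expr := .read 6 v

/-- Degree of a vertex. -/
def degE (v : Expr) : Expr := .read 0 v

/-- The `k`-th neighbour of `v`. -/
def nbE (v k : Expr) : Expr := .read 2 (.add (.read 1 v) k)

/-- The number `s ± i` before reduction modulo the length of the cycle. -/
def rawIdxE (i : Expr) : Expr :=
  .add (.mul (.eq (.var 4) (.const 0)) (.add (.var 2) i))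
    (.mul (Expr.not (.eq (.var 4) (.const 0))) (.sub (.add (.var 2) (.var 1)) i))

/-- The vertex of the cycle at distance `i` from the start. -/
def cycE (i : Expr) : Expr :=
  .read 3 (.sub (rawIdxE i) (.mul (.var 1) (Expr.le (.var 1) (rawIdxE i))))

/-- First coordinate of the `i`-th boundary point. -/
def boundaryXE (i : Expr) : Expr :=
  .sub (.sub i (.sub i (.var 3))) (.sub i (.add (.var 3) (.var 5)))

/-- Second coordinate of the `i`-th boundary point. -/
def boundaryYE (i : Expr) : Expr :=
  .sub (.sub (.sub i (.var 3)) (.sub (.sub i (.var 3)) (.var 5)))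
    (.sub i (.add (.add (.var 3) (.var 3)) (.var 5)))

/-- Some neighbour `u` of `v` satisfies `f u`. -/
def anyNbE (v : Expr) (f : Expr → Expr) : Expr :=
  Expr.any4 fun k => .mul (.lt k (degE v)) (f (nbE v k))

/-- Whether a dart at the point `(i, j)` whose chain ends in `w` is vertical. -/
def vertE (w i j : Expr) : Expr :=
  .add (.mul (.read 7 w) (.eq (xE w) i))
    (.mul (Expr.not (.read 7 w)) (anyNbE w fun c => .mul (.read 7 c)
      (.add (.mul (.add (.eq (yE c) (.const 0)) (.eq (yE c) (.var 5))) (.eq (xE c) i))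
        (.mul (Expr.not (.add (.eq (yE c) (.const 0)) (.eq (yE c) (.var 5))))
          (Expr.not (.eq (yE c) j))))))

/-- `direction` of `u` seen from `v`. -/
def dirE (v u : Expr) : Expr :=
  .mul (Expr.not (.lt (yE v) (yE u)))
    (.add (.lt (xE v) (xE u)) (.mul (Expr.not (.lt (xE v) (xE u)))
      (.add (.mul (.const 2) (.lt (yE u) (yE v)))
        (.mul (.const 3) (Expr.not (.lt (yE u) (yE v)))))))

/-- The `k`-th neighbour in the adjacency list of `v` rotated by `a`. -/
def rotNbE (v a : Expr) (k : ℕ) : Expr :=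
  nbE v (.sub (.add a (.const k)) (.mul (degE v) (Expr.le (degE v) (.add a (.const k)))))

/-- The directions at `v` in the list rotated by `a` increase at place `k`. -/
def stepE (v a : Expr) (k : ℕ) : Expr :=
  .add (Expr.le (degE v) (.const (k + 1)))
    (.lt (dirE v (rotNbE v a k)) (dirE v (rotNbE v a (k + 1))))

/-- The cyclic order of the adjacency list of `v` is clockwise. -/
def rotE (v : Expr) : Expr :=
  Expr.any4 fun a => .mul (.lt a (degE v)) (.mul (stepE v a 0) (.mul (stepE v a 1) (stepE v a 2)))

end Expressions

section Programs

/-- Find the height. -/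
def heightP : FProg :=
  .seq (.write 12 (.const 0) (.const 0))
    (.seq ((Scan.all 20 none (.put (.eq (.mul (.const 2) (.add (.var 3) (.var 20))) (.var 1))
      (.const 0) (.var 20))).comp 12) (.assign 5 (.read 12 (.const 0))))

/-- Default values for all vertices. -/
def resetP (a : ℕ) (e : Expr) : FProg :=
  (Scan.all 20 none (.put (.const 1) (.var 20) e)).comp a

/-- Values for the vertices of the cycle. -/
def onCycleP (a : ℕ) (e : Expr) : FProg :=
  (Scan.all 20 none (.put (.lt (.var 20) (.var 1)) (cycE (.var 20)) e)).comp a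

/-- Place the cycle. -/
def placeP : FProg :=
  -- The default position `(W, H)` is beyond every inner point in both coordinates, so a vertex that
  -- is not yet placed compares as lying ahead of the sweep.
  .seq (.seq (resetP 5 (.var 3)) (.seq (resetP 6 (.var 5)) (resetP 7 (.const 0))))
    (.seq (onCycleP 5 (boundaryXE (.var 20)))
      (.seq (onCycleP 6 (boundaryYE (.var 20))) (onCycleP 7 (.const 1))))

/-- One step along a chain. -/
def chainStepP : FProg :=
  .ite (.mul (Expr.not (.read 7 (.var 16))) (.eq (degE (.var 16)) (.const 2)))
    (.seq (.assign 17 (nbE (.var 16) (.const 0)))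
      (.seq (.ite (.eq (.var 17) (.var 15)) (.assign 17 (nbE (.var 16) (.const 1))) .skip)
        (.seq (.assign 15 (.var 16)) (.assign 16 (.var 17))))) .skip

/-- The chain end of the `k`-th dart of `v`. -/
def chainP : FProg :=
  .ite (.lt (.var 9) (degE (.var 8)))
    (.seq (.assign 15 (.var 8)) (.seq (.assign 16 (nbE (.var 8) (.var 9)))
      (.seq (.loop 14 none chainStepP)
        (.write 8 (.add (.mul (.const 4) (.var 8)) (.var 9)) (.var 16))))) .skip

/-- The chain ends of all darts. -/
def chainsP : FProg := .loop 8 none (.loop 9 (some 4) chainP)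

/-- Which vertex (increased by one) is placed at the point `(i, j)`. -/
def whichP : FProg :=
  .ite (.eq (.var 7) (.const 0)) (.assign 11 (.add (cycE (.var 6)) (.const 1)))
    -- The left side is the last part of the boundary walk, traversed downwards, so height `j` is
    -- reached `j` steps before the end.
    (.ite (.eq (.var 6) (.const 0)) (.assign 11 (.add (cycE (.sub (.var 1) (.var 7))) (.const 1)))
      (.ite (.eq (.var 10) (.const 0)) (.assign 11 (.read 9 (.var 6)))
        (.ite (.add (.eq (.read 9 (.var 6)) (.const 0)) (.eq (.read 9 (.var 6)) (.var 10)))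
          (.assign 11 (.var 10)) (.assign 11 (.const 0)))))

/-- Look at the `k`-th dart of the vertex that is being placed. -/
def dartP : FProg :=
  .ite (.lt (.var 9) (degE (.var 8)))
    (.seq (.assign 18 (nbE (.var 8) (.var 9)))
      (.ite (vertE (.read 8 (.add (.mul (.const 4) (.var 8)) (.var 9))) (.var 6) (.var 7))
        (.ite (.lt (.var 7) (yE (.var 18))) (.assign 13 (.add (.var 18) (.const 1))) .skip)
        (.ite (.lt (.var 6) (xE (.var 18))) (.assign 12 (.add (.var 18) (.const 1))) .skip))) .skip

/-- Process the point `(i, j)`. -/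
def pointP : FProg :=
  .seq whichP (.ite (.var 11)
    (.seq (.assign 8 (.sub (.var 11) (.const 1)))
      (.seq (.write 5 (.var 8) (.var 6)) (.seq (.write 6 (.var 8) (.var 7))
        (.seq (.assign 12 (.const 0)) (.seq (.assign 13 (.const 0))
          (.seq (.loop 9 (some 4) dartP)
            (.seq (.assign 10 (.var 12)) (.write 9 (.var 6) (.var 13)))))))))
    .skip)

/-- Sweep over the rectangle, row by row. -/
def sweepP : FProg :=
  .loop 7 none (.ite (.lt (.var 7) (.var 5))
    (.loop 6 none (.ite (.lt (.var 6) (.var 3)) pointP .skip)) .skip)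

/-- Write zeros into a table of grid points. -/
def clearS : Scan :=
  .all 20 none (.all 21 none
    (.put (.const 1) (.add (.mul (.var 20) (.var 0)) (.var 21)) (.const 0)))

/-- Mark the grid points inside edges; `a` and `b` are the arrays with the coordinate that is
constant, respectively varies, along the edges in question. -/
def paintS (a b : ℕ) : Scan :=
  .all 20 none (.all 22 (some 4) (.guard (.lt (.var 22) (degE (.var 20)))
    (.bind 23 (nbE (.var 20) (.var 22)) (.all 24 none
      (.put (.mul (.eq (.read a (.var 20)) (.read a (.var 23)))
          (.mul (.lt (.read b (.var 20)) (.var 24)) (.lt (.var 24) (.read b (.var 23)))))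
        (.add (.mul (.read a (.var 20)) (.var 0)) (.var 24)) (.const 1))))))

/-- Fill the tables of grid points inside edges. -/
def paintP : FProg :=
  .seq (clearS.comp 10) (.seq ((paintS 5 6).comp 10)
    (.seq (clearS.comp 11) ((paintS 6 5).comp 11)))

/-- Checks of the parameters. -/
def paramS : Scan :=
  .both (.check (.lt (.var 2) (.var 1))) (.both (.check (.lt (.const 0) (.var 3)))
    (.both (.check (.lt (.const 0) (.var 5)))
      (.check (.eq (.mul (.const 2) (.add (.var 3) (.var 5))) (.var 1)))))

/-- Checks for the position of a single vertex. -/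
def vertexS : Scan :=
  .all 20 none (.both (.check (Expr.le (degE (.var 20)) (.const 4)))
    (.both (.check (Expr.le (xE (.var 20)) (.var 3)))
      (.both (.check (Expr.le (yE (.var 20)) (.var 5)))
        (.check (.add
          (.add (.add (.eq (xE (.var 20)) (.const 0)) (.eq (xE (.var 20)) (.var 3)))
            (.add (.eq (yE (.var 20)) (.const 0)) (.eq (yE (.var 20)) (.var 5))))
          (.add
            (.mul
              (anyNbE (.var 20) fun u =>
                .mul (.eq (yE u) (yE (.var 20))) (.lt (xE u) (xE (.var 20))))
              (anyNbE (.var 20) fun u =>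
                .mul (.eq (yE u) (yE (.var 20))) (.lt (xE (.var 20)) (xE u))))
            (.mul
              (anyNbE (.var 20) fun u =>
                .mul (.eq (xE u) (xE (.var 20))) (.lt (yE u) (yE (.var 20))))
              (anyNbE (.var 20) fun u =>
                .mul (.eq (xE u) (xE (.var 20))) (.lt (yE (.var 20)) (yE u))))))))))

/-- Different vertices are at different points. -/
def injS : Scan :=
  .all 20 none (.all 21 none (.check (.add (.eq (.var 20) (.var 21))
    (.add (Expr.not (.eq (xE (.var 20)) (xE (.var 21))))
      (Expr.not (.eq (yE (.var 20)) (yE (.var 21))))))))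

/-- Checks for edges. -/
def edgeS : Scan :=
  .all 20 none (.all 22 (some 4) (.guard (.lt (.var 22) (degE (.var 20)))
    (.bind 23 (nbE (.var 20) (.var 22)) (.both
      (.check (.add (.eq (xE (.var 20)) (xE (.var 23))) (.eq (yE (.var 20)) (yE (.var 23)))))
      (.all 24 none (.both
        (.both
          (.check (Expr.not (.mul (.eq (yE (.var 20)) (yE (.var 23)))
            (.mul (.eq (yE (.var 24)) (yE (.var 20)))
              (.mul (.lt (xE (.var 20)) (xE (.var 24))) (.lt (xE (.var 24)) (xE (.var 23))))))))
          (.check (Expr.not (.mul (.eq (xE (.var 20)) (xE (.var 23)))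
            (.mul (.eq (xE (.var 24)) (xE (.var 20)))
              (.mul (.lt (yE (.var 20)) (yE (.var 24))) (.lt (yE (.var 24)) (yE (.var 23)))))))))
        (.both
          -- The painted tables answer in constant time whether a grid point lies inside a
          -- perpendicular edge; a search through all edges would cost another factor `n`.
          (.check (.add (Expr.not (.mul (.eq (yE (.var 20)) (yE (.var 23)))
              (.mul (.lt (xE (.var 20)) (.var 24)) (.lt (.var 24) (xE (.var 23))))))
            (.read 10 (.add (.mul (.var 24) (.var 0)) (yE (.var 20))))))
          (.check (.add (Expr.not (.mul (.eq (xE (.var 20)) (xE (.var 23)))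
              (.mul (.lt (yE (.var 20)) (.var 24)) (.lt (.var 24) (yE (.var 23))))))
            (.read 11 (.add (.mul (.var 24) (.var 0)) (xE (.var 20)))))))))))))

/-- The cycle is on the boundary. -/
def cycleS : Scan :=
  .all 20 none (.guard (.lt (.var 20) (.var 1)) (.both
    (.check (.eq (xE (cycE (.var 20))) (boundaryXE (.var 20))))
    (.check (.eq (yE (cycE (.var 20))) (boundaryYE (.var 20))))))

/-- The prescribed corners are corners. -/
def cornerS : Scan :=
  .all 20 (some 4) (.check (.mul
    (.add (.eq (xE (.read 4 (.var 20))) (.const 0)) (.eq (xE (.read 4 (.var 20))) (.var 3)))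
    (.add (.eq (yE (.read 4 (.var 20))) (.const 0)) (.eq (yE (.read 4 (.var 20))) (.var 5)))))

/-- The rotation system is preserved. -/
def rotationS : Scan := .all 20 none (.check (rotE (.var 20)))

/-- All checks. -/
def checkS (rot corners : Bool) : Scan :=
  .both paramS (.both vertexS (.both injS (.both edgeS (.both cycleS
    (.both (if corners then cornerS else .check (.const 1))
      (if rot then rotationS else .check (.const 1)))))))

/-- Look for a drawing with given start, width and orientation, and verify it. -/
def coreP (rot corners : Bool) : FProg :=
  .seq heightP (.seq placeP (.seq chainsP (.seq sweepP
    (.seq paintP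
      (.seq (.write 13 (.const 0) (.const 0)) ((checkS rot corners).comp 13))))))

/-- Try the current parameters, unless a drawing has been found already; in this case set
register `30`. -/
def tryP (pre : FProg) (rot corners : Bool) : FProg :=
  .ite (.eq (.var 30) (.const 0))
    (.seq pre (.seq (coreP rot corners)
      (.ite (.eq (.read 13 (.const 0)) (.const 0)) (.assign 30 (.const 1)) .skip))) .skip

/-- Copy the drawing to the output. -/
def outputP : FProg := .seq (resetP 0 (xE (.var 20))) (resetP 1 (yE (.var 20)))

/-- The algorithm without prescribed corners. -/
def freeP (rot : Bool) : FProg :=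
  .seq (.loop 2 none (.loop 3 none (.loop 4 (some 2) (tryP .skip rot false)))) outputP

/-- Compute start and width from the two corners with indices in registers `31` and `32`. -/
def cornerP : FProg :=
  .seq ((Scan.all 20 none (.put (.mul (.lt (.var 20) (.var 1))
      (.eq (.read 3 (.var 20)) (.read 4 (.var 31)))) (.const 0) (.var 20))).comp 12)
    (.seq (.assign 2 (.read 12 (.const 0)))
      (.seq ((Scan.all 20 none (.put (.mul (.lt (.var 20) (.var 1))
        (.eq (cycE (.var 20)) (.read 4 (.var 32)))) (.const 0) (.var 20))).comp 12)
        (.assign 3 (.read 12 (.const 0)))))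

/-- The algorithm with prescribed corners. -/
def cornersP (rot : Bool) : FProg :=
  .seq (.loop 31 (some 4) (.loop 32 (some 4) (.loop 4 (some 2) (tryP cornerP rot true)))) outputP

end Programs

theorem freeP_wf (rot : Bool) : (freeP rot).wf = true := by cases rot <;> decide

/-- Start and width contribute one level each, and a single trial two; the loops over orientations
and over darts have constant length. -/
theorem freeP_depth (rot : Bool) : (freeP rot).depth ≤ 4 := by cases rot <;> decide

theorem cornersP_wf (rot : Bool) : (cornersP rot).wf = true := by cases rot <;> decide

/-- The loops over the two corners and the orientation have constant length, so only the two levels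
of a single trial count. -/
theorem cornersP_depth (rot : Bool) : (cornersP rot).depth ≤ 2 := by cases rot <;> decide

theorem checkS_within (rot corners : Bool) :
    (checkS rot corners).within 13 [0, 1, 2, 3, 4, 5] = true := by
  cases rot <;> cases corners <;> decide

end UERRF

/-! ### What a grid drawing reveals about its vertices: natural coordinates, chains and labels. -/

namespace UERRF

open Set

variable {V : Type*}

/-- The drawing with the given nonnegative coordinates. -/
def natDrawing (x y : V → ℕ) : Drawing V := fun v => (x v, y v)

/-- A lattice drawing in `[0, W] × [0, H]` with straight vertices inside the rectangle, in which
`S` is the set of vertices on the boundary; all coordinates are natural numbers. -/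
structure IsGrid (G : SimpleGraph V) (S : Set V) (W H : ℕ) (x y : V → ℕ) : Prop where
  injective : ∀ u v, x u = x v → y u = y v → u = v
  aligned : ∀ u v, G.Adj u v → x u = x v ∨ y u = y v
  clear_h : ∀ u v w, G.Adj u v → y u = y v → y w = y u → ¬ (x u < x w ∧ x w < x v)
  clear_v : ∀ u v w, G.Adj u v → x u = x v → x w = x u → ¬ (y u < y w ∧ y w < y v)
  cross_h : ∀ u v t, G.Adj u v → y u = y v → x u < t → t < x v →
    ∃ p q, G.Adj p q ∧ x p = t ∧ x q = t ∧ y p < y u ∧ y u < y q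
  cross_v : ∀ u v t, G.Adj u v → x u = x v → y u < t → t < y v →
    ∃ p q, G.Adj p q ∧ y p = t ∧ y q = t ∧ x p < x u ∧ x u < x q
  le_W : ∀ v, x v ≤ W
  le_H : ∀ v, y v ≤ H
  mem_iff : ∀ v, v ∈ S ↔ (x v = 0 ∨ x v = W) ∨ y v = 0 ∨ y v = H
  straight : ∀ v, v ∉ S →
    (∃ p q, G.Adj v p ∧ G.Adj v q ∧ y p = y v ∧ y q = y v ∧ x p < x v ∧ x v < x q) ∨
    ∃ p q, G.Adj v p ∧ G.Adj v q ∧ x p = x v ∧ x q = x v ∧ y p < y v ∧ y v < y q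

/-- Reflection in the diagonal. The structure mentions the boundary only as a set, which makes it
symmetric, and every statement about rows also yields the one about columns. -/
theorem IsGrid.swap {G : SimpleGraph V} {S : Set V} {W H : ℕ} {x y : V → ℕ}
    (h : IsGrid G S W H x y) : IsGrid G S H W y x where
  injective u v hy hx := h.injective u v hx hy
  aligned u v a := (h.aligned u v a).symm
  clear_h := h.clear_v
  clear_v := h.clear_h
  cross_h := h.cross_v
  cross_v := h.cross_h
  le_W := h.le_H
  le_H := h.le_W
  mem_iff v := (h.mem_iff v).trans or_comm
  straight v hv := (h.straight v hv).symm

/-- The right-hand side is, up to grouping, what the program can test with its natural numbers. A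
point `t` inside an edge is between two natural coordinates, hence natural itself. -/
theorem isGridDrawing_natDrawing {G : SimpleGraph V} {β : ℕ → V} {W H : ℕ} {x y : V → ℕ} :
    IsGridDrawing G β W H (natDrawing x y) ↔
      ((∀ u v, x u = x v → y u = y v → u = v) ∧
      (∀ u v, G.Adj u v → x u = x v ∨ y u = y v) ∧
      (∀ u v w, G.Adj u v → y u = y v → y w = y u → ¬ (x u < x w ∧ x w < x v)) ∧
      (∀ u v w, G.Adj u v → x u = x v → x w = x u → ¬ (y u < y w ∧ y w < y v)) ∧
      (∀ u v t, G.Adj u v → y u = y v → x u < t → t < x v →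
        ∃ p q, G.Adj p q ∧ x p = t ∧ x q = t ∧ y p < y u ∧ y u < y q) ∧
      (∀ u v t, G.Adj u v → x u = x v → y u < t → t < y v →
        ∃ p q, G.Adj p q ∧ y p = t ∧ y q = t ∧ x p < x u ∧ x u < x q)) ∧
      0 < W ∧ 0 < H ∧ (∀ v, x v ≤ W) ∧ (∀ v, y v ≤ H) ∧
      (∀ i < 2 * (W + H), x (β i) = boundaryX W H i ∧ y (β i) = boundaryY W H i) ∧
      ∀ v, ((x v = 0 ∨ x v = W) ∨ y v = 0 ∨ y v = H) ∨
        (∃ p q, G.Adj v p ∧ G.Adj v q ∧ y p = y v ∧ y q = y v ∧ x p < x v ∧ x v < x q) ∨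
        ∃ p q, G.Adj v p ∧ G.Adj v q ∧ x p = x v ∧ x q = x v ∧ y p < y v ∧ y v < y q := by
  constructor
  · rintro ⟨⟨h1, h2, h3, h4, h5, h6⟩, hW, hH, hi, hb, hs⟩
    simp only [natDrawing, Nat.cast_inj, Nat.cast_lt, Nat.cast_nonneg, Nat.cast_le, true_and,
      Nat.cast_eq_zero, Prod.mk.injEq] at h2 h3 h4 h5 h6 hi hb hs
    refine ⟨⟨fun u v hx hy => h1 (by simp [natDrawing, hx, hy]), h2, h3, h4, ?_, ?_⟩, hW, hH,
      fun v => (hi v).1, fun v => (hi v).2, hb, fun v => by simpa [or_assoc] using hs v⟩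
    · intro u v t h e ht ht'
      simpa using h5 u v t h e (by exact_mod_cast ht) (by exact_mod_cast ht')
    · intro u v t h e ht ht'
      simpa using h6 u v t h e (by exact_mod_cast ht) (by exact_mod_cast ht')
  · rintro ⟨⟨h1, h2, h3, h4, h5, h6⟩, hW, hH, hx, hy, hb, hs⟩
    refine ⟨⟨?_, ?_, ?_, ?_, ?_, ?_⟩, hW, hH, ?_, ?_, ?_⟩
    · intro u v h
      simp only [natDrawing, Prod.mk.injEq, Nat.cast_inj] at h
      exact h1 u v h.1 h.2
    · simpa [natDrawing] using h2
    · simpa only [natDrawing, Nat.cast_inj, Nat.cast_lt] using h3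
    · simpa only [natDrawing, Nat.cast_inj, Nat.cast_lt] using h4
    · simp only [natDrawing, Nat.cast_inj, Nat.cast_lt]
      intro u v t h e ht ht'
      lift t to ℕ using by omega
      simpa using h5 u v t h e (by exact_mod_cast ht) (by exact_mod_cast ht')
    · simp only [natDrawing, Nat.cast_inj, Nat.cast_lt]
      intro u v t h e ht ht'
      lift t to ℕ using by omega
      simpa using h6 u v t h e (by exact_mod_cast ht) (by exact_mod_cast ht')
    · simp only [natDrawing, Nat.cast_nonneg, true_and, Nat.cast_le]
      exact fun v => ⟨hx v, hy v⟩
    · intro i hi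
      simp [natDrawing, hb i hi]
    · simpa [natDrawing, or_assoc] using hs

theorem boundary_mem_boundary {W H i : ℕ} :
    (boundaryX W H i = 0 ∨ boundaryX W H i = W) ∨ boundaryY W H i = 0 ∨ boundaryY W H i = H := by
  unfold boundaryX boundaryY
  split_ifs <;> omega

/-- Start and orientation of the cycle are forgotten; what remains is symmetric in the two
coordinates. -/
theorem IsGridDrawing.isGrid {G : SimpleGraph V} {β : ℕ → V} {W H : ℕ} {x y : V → ℕ} {S : Set V}
    (h : IsGridDrawing G β W H (natDrawing x y))
    (hS : ∀ v, v ∈ S ↔ ∃ i < 2 * (W + H), v = β i) : IsGrid G S W H x y := by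
  have hS' : ∀ v, v ∈ S ↔ (x v = 0 ∨ x v = W) ∨ y v = 0 ∨ y v = H := by
    intro v
    rw [hS]
    constructor
    · rintro ⟨i, hi, rfl⟩
      obtain ⟨-, -, -, -, -, hb, -⟩ := isGridDrawing_natDrawing.1 h
      rw [(hb i hi).1, (hb i hi).2]
      exact boundary_mem_boundary
    · intro hv
      exact h.exists_eq_boundary (by simpa [natDrawing, or_assoc] using hv)
  obtain ⟨⟨h1, h2, h3, h4, h5, h6⟩, hW, hH, hx, hy, hb, hs⟩ := isGridDrawing_natDrawing.1 h
  exact ⟨h1, h2, h3, h4, h5, h6, hx, hy, hS',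
    fun v hv => (hs v).resolve_left fun h' => hv ((hS' v).2 h')⟩

/-! ### Chains -/

/-- What is needed of a grid drawing to walk in direction of growing `f`, where `g` is constant. -/
structure IsAxis (G : SimpleGraph V) (S : Set V) (N : ℕ) (f g : V → ℤ) : Prop where
  clear : ∀ u v w, G.Adj u v → g u = g v → g w = g u → ¬ (f u < f w ∧ f w < f v)
  straight : ∀ v, v ∉ S → (∃ p q, G.Adj v p ∧ G.Adj v q ∧ g p = g v ∧ g q = g v ∧
    f p < f v ∧ f v < f q) ∨
    ∃ p q, G.Adj v p ∧ G.Adj v q ∧ f p = f v ∧ f q = f v ∧ g p ≠ g q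
  bounded : ∀ u v, f u - f v ≤ N

theorem IsGrid.axis {G : SimpleGraph V} {S : Set V} {W H N : ℕ} {x y : V → ℕ}
    (h : IsGrid G S W H x y) (hN : W ≤ N) :
    IsAxis G S N (fun v => x v) (fun v => y v) where
  clear u v w a e e' := by
    have := h.clear_h u v w a (by omega) (by omega)
    omega
  straight v hv := by
    rcases h.straight v hv with ⟨p, q, a, b, h⟩ | ⟨p, q, a, b, h⟩
    · exact .inl ⟨p, q, a, b, by omega⟩
    · exact .inr ⟨p, q, a, b, by omega⟩
  bounded u v := by have := h.le_W u; omega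

/-- Changing the sign turns walks to the left into walks to the right. Together with `IsGrid.swap`,
one argument about an axis covers all four directions. -/
theorem IsGrid.axis_neg {G : SimpleGraph V} {S : Set V} {W H N : ℕ} {x y : V → ℕ}
    (h : IsGrid G S W H x y) (hN : W ≤ N) :
    IsAxis G S N (fun v => -x v) (fun v => y v) where
  clear u v w a e e' := by
    have := h.clear_h v u w a.symm (by omega) (by omega)
    omega
  straight v hv := by
    rcases h.straight v hv with ⟨p, q, a, b, h⟩ | ⟨p, q, a, b, h⟩
    · exact .inl ⟨q, p, b, a, by omega⟩
    · exact .inr ⟨p, q, a, b, by omega⟩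
  bounded u v := by have := h.le_W v; omega

/-- For every dart there is an axis along which it runs. -/
theorem IsGrid.exists_axis {G : SimpleGraph V} {S : Set V} {W H N : ℕ} {x y : V → ℕ}
    (h : IsGrid G S W H x y) (hW : W ≤ N) (hH : H ≤ N) {u v : V} (huv : G.Adj u v) :
    ∃ f g : V → ℤ, IsAxis G S N f g ∧ g u = g v ∧ f u < f v ∧
      ∀ w, g w = g u → f u < f w →
        (x v = x u ∧ x w = x u ∧ y w ≠ y u) ∨ (x v ≠ x u ∧ y w = y u ∧ x w ≠ x u) := by
  have hne : ¬ (x u = x v ∧ y u = y v) := fun e => huv.ne (h.injective _ _ e.1 e.2)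
  rcases h.aligned u v huv with e | e
  · rcases lt_or_gt_of_ne (fun e' => hne ⟨e, e'⟩) with hl | hl
    · exact ⟨_, _, h.swap.axis hH, by omega, by omega, fun w => by
        omega⟩
    · exact ⟨_, _, h.swap.axis_neg hH, by omega, by omega, fun w => by
        omega⟩
  · rcases lt_or_gt_of_ne (fun e' => hne ⟨e', e⟩) with hl | hl
    · exact ⟨_, _, h.axis hW, by omega, by omega, fun w => by
        omega⟩
    · exact ⟨_, _, h.axis_neg hW, by omega, by omega, fun w => by
        omega⟩

/-- At a vertex of degree two inside the rectangle, a chain continues straight on. -/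
theorem IsAxis.step [DecidableEq V] {G : SimpleGraph V} {S : Set V} {N : ℕ} {f g : V → ℤ} (h : IsAxis G S N f g)
    (A : AdjLists G) {p v : V} (hv : v ∉ S) (hpv : G.Adj v p) (hg : g p = g v) (hf : f p < f v)
    {a b : V} (hab : A.nbrs v = [a, b]) :
    ∃ q, q = (if a = p then b else a) ∧ G.Adj v q ∧ g q = g v ∧ f v < f q := by
  have mem : ∀ w, G.Adj v w ↔ w = a ∨ w = b := fun w => by
    rw [← A.mem_nbrs, hab]; simp
  have hp := (mem p).1 hpv
  rcases h.straight v hv with ⟨p', q, h1, h2, h3, h4, h5, h6⟩ | ⟨p', q, h1, h2, h3, h4, h5⟩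
  · refine ⟨q, ?_, h2, h4, h6⟩
    have hqp : q ≠ p := by rintro rfl; omega
    have hqp' : q ≠ p' := by rintro rfl; omega
    have e1 := (mem p').1 h1
    have e2 := (mem q).1 h2
    split_ifs with hap
    · subst hap
      exact e2.resolve_left hqp
    · have hpb : p = b := hp.resolve_left (Ne.symm hap)
      subst hpb
      exact e2.resolve_right hqp
  -- A straight pair perpendicular to the edge from `p` would, together with `p`, give three
  -- different neighbours.
  · exfalso
    have e1 := (mem p').1 h1
    have e2 := (mem q).1 h2
    have n1 : p' ≠ p := by rintro rfl; omega
    have n2 : q ≠ p := by rintro rfl; omega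
    have n3 : p' ≠ q := by rintro rfl; omega
    rcases hp with rfl | rfl
    · exact n3 ((e1.resolve_left n1).trans (e2.resolve_left n2).symm)
    · exact n3 ((e1.resolve_right n1).trans (e2.resolve_right n2).symm)

theorem IsGrid.two_le_degree {G : SimpleGraph V} {S : Set V} {W H : ℕ} {x y : V → ℕ}
    (h : IsGrid G S W H x y) (A : AdjLists G) {v : V} (hv : v ∉ S) : 2 ≤ (A.nbrs v).length := by
  classical
  have key : ∀ p q : V, p ≠ q → G.Adj v p → G.Adj v q → 2 ≤ (A.nbrs v).length := by
    intro p q hpq hp hq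
    rw [← List.toFinset_card_of_nodup (A.nodup v), ← Finset.card_pair hpq]
    refine Finset.card_le_card fun w hw => ?_
    simp only [Finset.mem_insert, Finset.mem_singleton] at hw
    rw [List.mem_toFinset, A.mem_nbrs]
    rcases hw with rfl | rfl <;> assumption
  rcases h.straight v hv with ⟨p, q, hp, hq, h1⟩ | ⟨p, q, hp, hq, h1⟩
  · exact key p q (by rintro rfl; omega) hp hq
  · exact key p q (by rintro rfl; omega) hp hq

/-- A vertex inside the rectangle at which a chain ends has a neighbour on the boundary. -/
theorem IsGrid.exists_boundary_nbr {G : SimpleGraph V} {S : Set V} {W H : ℕ} {x y : V → ℕ}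
    (h : IsGrid G S W H x y) (A : AdjLists G)
    (hS : ∀ v : (Sᶜ : Set V), ((G.induce Sᶜ).neighborSet v).ncard ≤ 2) {v : V} (hv : v ∉ S)
    (hd : (A.nbrs v).length ≠ 2) : ∃ c ∈ A.nbrs v, c ∈ S := by
  classical
  by_contra! hc
  have h2 := h.two_le_degree A hv
  have h3 := hS ⟨v, hv⟩
  -- Without a neighbour on the boundary, all neighbours count in the induced graph. There are at
  -- least three of them, since straightness gives two and the degree is not two.
  have : (Subtype.val '' ((G.induce Sᶜ).neighborSet ⟨v, hv⟩)) = ((A.nbrs v).toFinset : Set V) := by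
    ext w
    simp only [mem_image, SimpleGraph.mem_neighborSet, SimpleGraph.comap_adj, Subtype.exists,
      List.coe_toFinset, mem_ofPred_eq, A.mem_nbrs]
    constructor
    · rintro ⟨a, ha, hadj, rfl⟩
      exact hadj
    · intro hw
      exact ⟨w, hc w ((A.mem_nbrs _ _).2 hw), hw, rfl⟩
  rw [← Set.ncard_image_of_injective _ Subtype.val_injective, this, Set.ncard_coe_finset,
    List.toFinset_card_of_nodup (A.nodup v)] at h3
  omega

/-- How the direction of a dart at `(i, j)` is read off the end `w` of its chain. -/
def LooksVertical {G : SimpleGraph V} (A : AdjLists G) (S : Set V) (H : ℕ) (x y : V → ℕ)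
    (w : V) (i j : ℕ) : Prop :=
  (w ∈ S ∧ x w = i) ∨ (w ∉ S ∧ ∃ c ∈ A.nbrs w, c ∈ S ∧
    (((y c = 0 ∨ y c = H) ∧ x c = i) ∨ (¬ (y c = 0 ∨ y c = H) ∧ y c ≠ j)))

/-- The vertex `w` is the end of a chain that starts with the dart from `v` to `u`. -/
structure IsChainEnd {G : SimpleGraph V} (A : AdjLists G) (S : Set V) (x y : V → ℕ)
    (v u w : V) : Prop where
  stops : w ∈ S ∨ (A.nbrs w).length ≠ 2
  line : (x u = x v ∧ x w = x v ∧ y w ≠ y v) ∨ (x u ≠ x v ∧ y w = y v ∧ x w ≠ x v)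

/-- A chain is straight, so `w` shares exactly one coordinate with `v`, and knowing either
coordinate of `w` tells which. On the boundary `w` has a known position. Otherwise `w` has a
neighbour `c` there. If `c` is on the bottom or top side, the edge between them is vertical, since
`w` is inside, and `c` has the abscissa of `w`; if not, `c` is on the left or right side and has the
ordinate of `w`. -/
theorem IsGrid.looksVertical_iff {G : SimpleGraph V} {S : Set V} {W H : ℕ} {x y : V → ℕ}
    (h : IsGrid G S W H x y) (A : AdjLists G)
    (hS : ∀ v : (Sᶜ : Set V), ((G.induce Sᶜ).neighborSet v).ncard ≤ 2) {v u w : V}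
    (hw : IsChainEnd A S x y v u w) : LooksVertical A S H x y w (x v) (y v) ↔ x u = x v := by
  have hb := h.mem_iff w
  have nb : w ∉ S → ∀ c ∈ A.nbrs w, c ∈ S → ((y c = 0 ∨ y c = H) ∧ x c = x w) ∨
      (¬ (y c = 0 ∨ y c = H) ∧ y c = y w) := by
    intro hwS c hc hcS
    have := h.mem_iff c
    have := h.aligned w c ((A.mem_nbrs _ _).1 hc)
    have hw' := hb.not.1 hwS
    rw [h.mem_iff] at hcS
    by_cases hy : y c = 0 ∨ y c = H
    · exact .inl ⟨hy, by omega⟩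
    · exact .inr ⟨hy, by omega⟩
  rcases hw.line with ⟨h1, h2, h3⟩ | ⟨h1, h2, h3⟩
  · refine iff_of_true ?_ h1
    by_cases hwS : w ∈ S
    · exact .inl ⟨hwS, h2⟩
    · obtain ⟨c, hc, hcS⟩ := h.exists_boundary_nbr A hS hwS (hw.stops.resolve_left hwS)
      refine .inr ⟨hwS, c, hc, hcS, ?_⟩
      rcases nb hwS c hc hcS with ⟨a, b⟩ | ⟨a, b⟩
      · exact .inl ⟨a, b.trans h2⟩
      · exact .inr ⟨a, fun e => h3 (b.symm.trans e)⟩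
  · refine iff_of_false ?_ h1
    rintro (⟨_, e⟩ | ⟨hwS, c, hc, hcS, e⟩)
    · exact h3 e
    · rcases nb hwS c hc hcS with ⟨a, b⟩ | ⟨a, b⟩
      · rcases e with ⟨_, e⟩ | ⟨e, _⟩
        · exact h3 (b.symm.trans e)
        · exact e a
      · rcases e with ⟨e, _⟩ | ⟨_, e⟩
        · exact a e
        · exact e (b.trans h2)

/-! ### Labels -/

/-- The number `l` describes the edge that covers the unit segment to the right of `(i, j)`:
it is `0` if there is no such edge, and otherwise the right end of the edge, increased by one. -/
def IsLabel {n : ℕ} (G : SimpleGraph (Fin n)) (x y : Fin n → ℕ) (i j l : ℕ) : Prop :=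
  (l = 0 ∧ ∀ u v, G.Adj u v → y u = j → y v = j → x u ≤ i → i < x v → False) ∨
  ∃ u v, G.Adj u v ∧ y u = j ∧ y v = j ∧ x u ≤ i ∧ i < x v ∧ l = (v : ℕ) + 1

variable {n : ℕ} {G : SimpleGraph (Fin n)} {S : Set (Fin n)} {W H : ℕ} {x y : Fin n → ℕ}

/-- An edge that covers the segment to the right of `v` cannot run over `v`, so it starts there. -/
theorem IsGrid.isLabel_of_vertex (h : IsGrid G S W H x y) {v : Fin n} {l : ℕ}
    (hl : (l = 0 ∧ ∀ u, G.Adj v u → y u = y v → ¬ x v < x u) ∨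
      ∃ u, G.Adj v u ∧ y u = y v ∧ x v < x u ∧ l = (u : ℕ) + 1) :
    IsLabel G x y (x v) (y v) l := by
  rcases hl with ⟨rfl, hl⟩ | ⟨u, hu, hy, hx, rfl⟩
  · refine .inl ⟨rfl, fun a b hab ha hb hxa hxb => ?_⟩
    have := h.clear_h a b v hab (by omega) (by omega)
    have e : a = v := h.injective _ _ (by omega) ha
    subst e
    exact hl b hab hb hxb
  · exact .inr ⟨v, u, hu, rfl, hy, le_rfl, hx, rfl⟩

/-- An edge that covers the segment just before `v` cannot run over `v`, so it ends there. -/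
theorem IsGrid.isLabel_at_vertex (h : IsGrid G S W H x y) {i : ℕ} {v : Fin n} {l : ℕ}
    (hl : IsLabel G x y i (y v) l) (hv : x v = i + 1) : l = 0 ∨ l = (v : ℕ) + 1 := by
  rcases hl with ⟨rfl, -⟩ | ⟨a, b, hab, ha, hb, hxa, hxb, rfl⟩
  · exact .inl rfl
  · have := h.clear_h a b v hab (by omega) (by omega)
    have e : b = v := h.injective _ _ (by omega) hb
    exact .inr (by rw [e])

theorem IsGrid.isLabel_ne_zero {i j l : ℕ} (hl : IsLabel G x y i j l) {a b : Fin n}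
    (hab : G.Adj a b) (ha : y a = j) (hb : y b = j) (hxa : x a ≤ i) (hxb : i < x b) : l ≠ 0 := by
  rcases hl with ⟨-, hl⟩ | ⟨_, _, _, _, _, _, _, rfl⟩
  · exact (hl a b hab ha hb hxa hxb).elim
  · omega

theorem IsLabel.next {i j l : ℕ} (hl : IsLabel G x y i j l)
    (hno : ∀ v, ¬ (x v = i + 1 ∧ y v = j)) : IsLabel G x y (i + 1) j l := by
  rcases hl with ⟨rfl, hl⟩ | ⟨a, b, hab, ha, hb, hxa, hxb, rfl⟩
  · refine .inl ⟨rfl, fun a b hab ha hb hxa hxb => ?_⟩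
    have := hno a
    exact hl a b hab ha hb (by omega) (by omega)
  · have := hno b
    exact .inr ⟨a, b, hab, ha, hb, by omega, by omega, rfl⟩

/-- Which vertex is at a grid point inside the rectangle, given the labels of the segments to its
left and below it. -/
theorem IsGrid.which (h : IsGrid G S W H x y) {i j l u : ℕ} (hi : i + 1 < W) (hj : j + 1 < H)
    (hl : IsLabel G x y i (j + 1) l) (hu : IsLabel G y x j (i + 1) u) :
    (∃ v : Fin n, x v = i + 1 ∧ y v = j + 1 ∧
      (if l = 0 then u else if u = 0 ∨ u = l then l else 0) = (v : ℕ) + 1) ∨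
    (∀ v : Fin n, ¬ (x v = i + 1 ∧ y v = j + 1)) ∧
      (if l = 0 then u else if u = 0 ∨ u = l then l else 0) = 0 := by
  by_cases hv : ∃ v, x v = i + 1 ∧ y v = j + 1
  · obtain ⟨v, hx, hy⟩ := hv
    refine .inl ⟨v, hx, hy, ?_⟩
    rw [← hy] at hl
    rw [← hx] at hu
    have e1 := h.isLabel_at_vertex hl hx
    have e2 := h.swap.isLabel_at_vertex hu hy
    have hS : v ∉ S := by rw [h.mem_iff]; omega
    -- One member of the straight pair at `v` comes from the left or from below.
    have e3 : l ≠ 0 ∨ u ≠ 0 := by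
      rcases h.straight v hS with ⟨p, q, hp, _, h1, h2, h3, _⟩ | ⟨p, q, hp, _, h1, h2, h3, _⟩
      · exact .inl (IsGrid.isLabel_ne_zero hl hp.symm h1 rfl (by omega) (by omega))
      · exact .inr (IsGrid.isLabel_ne_zero hu hp.symm h1 rfl (by omega) (by omega))
    split_ifs <;> omega
  · have hv : ∀ v : Fin n, ¬ (x v = i + 1 ∧ y v = j + 1) := fun v a => hv ⟨v, a⟩
    refine .inr ⟨hv, ?_⟩
    rcases hl with ⟨rfl, hl⟩ | ⟨a, b, hab, ha, hb, hxa, hxb, rfl⟩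
    · rcases hu with ⟨rfl, hu⟩ | ⟨a, b, hab, ha, hb, hxa, hxb, rfl⟩
      · rfl
      -- The edge from below does not end at the point, so it continues and must be crossed there by
      -- a horizontal edge, which contradicts the label zero on the left.
      · exfalso
        have := hv b
        obtain ⟨p, q, hpq, h1, h2, h3, h4⟩ := h.cross_v a b (j + 1) hab (by omega) (by omega)
          (by omega)
        exact hl p q hpq h1 h2 (by omega) (by omega)
    · have hb' := hv b
      obtain ⟨p, q, hpq, h1, h2, h3, h4⟩ := h.cross_h a b (i + 1) hab (by omega) (by omega)
        (by omega)
      rcases hu with ⟨rfl, hu⟩ | ⟨c, d, hcd, hc, hd, hyc, hyd, rfl⟩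
      · exact (hu p q hpq h1 h2 (by omega) (by omega)).elim
      -- Both edges run through the point; one ends to the right of it and the other above it, so
      -- the two labels are different.
      · have : b ≠ d := by
          rintro rfl
          omega
        rw [if_neg (by omega), if_neg]
        rintro (e | e)
        · omega
        · exact this (Fin.ext (by omega))

end UERRF

/-! ### The layout of the input in memory and the evaluation of the basic expressions. -/

namespace UERRF

open Set WordRAM

/-- Sums of the first degrees are the offsets of the individual lists in the concatenated adjacency
array. -/
theorem getElem?_flatMap_sum {α β : Type*} (f : α → List β) (l : List α) {i k : ℕ}
    (hi : i < l.length) (hk : k < (f l[i]).length) :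
    (l.flatMap f)[((l.take i).map fun a => (f a).length).sum + k]? = some (f l[i])[k] := by
  induction l generalizing i with
  | nil => simp at hi
  | cons a l ih =>
    cases i with
    | zero =>
      simp only [List.getElem_cons_zero] at hk
      simp [List.flatMap_cons, List.getElem?_append_left hk]
    | succ i =>
      simp only [List.getElem_cons_succ] at hk
      have := ih (by simpa using hi) hk
      simp only [List.take_succ_cons, List.map_cons, List.sum_cons, List.flatMap_cons, add_assoc]
      rw [List.getElem?_append_right (by omega), Nat.add_sub_cancel_left, this]
      rfl

variable {n : ℕ} {G : SimpleGraph (Fin n)}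

/-- The memory contains the input. -/
structure HasInput (A : AdjLists G) {r : Fin n} (C : G.Walk r r) (s : State) : Prop where
  size : s.reg 0 = n
  length : s.reg 1 = C.length
  deg : ∀ v : Fin n, s.arr 0 v = (A.nbrs v).length
  nbr : ∀ (v : Fin n) (k : ℕ) (hk : k < (A.nbrs v).length),
    s.arr 2 (s.arr 1 v + k) = ((A.nbrs v)[k] : Fin n)
  cycle : ∀ i < C.length, s.arr 3 i = C.getVert i

/-- The values of an array as a function on vertices. -/
def coord (s : State) (a : ℕ) (v : Fin n) : ℕ := s.arr a v

theorem length_nbrs_le (A : AdjLists G) (v : Fin n) : (A.nbrs v).length ≤ n := by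
  simpa using (A.nodup v).length_le_card

theorem length_le_of_isCycle {r : Fin n} {C : G.Walk r r} (hC : C.IsCycle) : C.length ≤ n := by
  have := hC.support_nodup.length_le_card
  simpa using this

theorem cell_eq {l : List (Fin n)} {i : ℕ} {v : Fin n} (h : l[i]? = some v) : cell l i = v := by
  simp [cell, List.getD_eq_getElem?_getD, h]

section Input

variable (A : AdjLists G) {r : Fin n} (C : G.Walk r r)

theorem hasInput_input (l : List (Fin n)) : HasInput A C (input A C l) where
  size := rfl
  length := rfl
  deg v := by simp [input]
  nbr v k hk := by
    have h := getElem?_flatMap_sum A.nbrs (List.finRange n) (i := v) (k := k) (by simp)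
      (by simpa using hk)
    simp only [List.getElem_finRange, Fin.cast_mk, Fin.eta] at h
    rw [← cell_eq h]
    simp [input, List.map_take]
  cycle i hi := by
    have h : i < C.support.dropLast.length := by simpa using hi
    have : C.support.dropLast[i] = C.getVert i := by
      rw [List.getElem_dropLast, SimpleGraph.Walk.support_getElem_eq_getVert]
    exact cell_eq (by rw [List.getElem?_eq_getElem h, this])

theorem cell_le (l : List (Fin n)) (i : ℕ) : cell l i ≤ n := by
  unfold cell
  rw [List.getD_eq_getElem?_getD]
  by_cases h : i < (l.map Fin.val).length
  · rw [List.getElem?_eq_getElem h]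
    simp only [List.getElem_map, Option.getD_some]
    exact (Fin.is_lt _).le
  · rw [List.getElem?_eq_none (by omega)]
    simp

/-- The largest entries are the offsets, sums of at most `n` degrees of at most `n` each; this is
where the square comes from. -/
theorem input_boundedBy (hC : C.IsCycle) (l : List (Fin n)) :
    (input A C l).BoundedBy (n ^ 2) := by
  have hn : n ≤ n ^ 2 := Nat.le_self_pow (by norm_num) n
  constructor
  · intro x
    have := length_le_of_isCycle hC
    simp only [input]
    split_ifs <;> omega
  · intro a i
    have hcell : ∀ (l : List (Fin n)) i, cell l i ≤ n ^ 2 := fun l i => (cell_le l i).trans hn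
    simp only [input]
    split_ifs
    · rw [List.getD_eq_getElem?_getD]
      by_cases h : i < n
      · rw [List.getElem?_eq_getElem (by simpa using h)]
        simp only [List.getElem_map, Option.getD_some]
        exact (length_nbrs_le A _).trans hn
      · rw [List.getElem?_eq_none (by simpa using h)]
        simp
    · have h1 : ∀ x ∈ ((List.finRange n).take i).map (fun v => (A.nbrs v).length), x ≤ n := by
        intro x hx
        obtain ⟨v, -, rfl⟩ := List.mem_map.1 hx
        exact length_nbrs_le A v
      have h2 := List.sum_le_card_nsmul _ _ h1
      simp only [List.length_map, List.length_take, List.length_finRange, smul_eq_mul] at h2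
      calc _ ≤ _ := h2
        _ ≤ n * n := Nat.mul_le_mul_right _ (min_le_right _ _)
        _ = n ^ 2 := (sq n).symm
    · omega
    · exact hcell _ _
    · exact hcell _ _
    · exact hcell _ _
    · omega

end Input

namespace HasInput

variable {A : AdjLists G} {r : Fin n} {C : G.Walk r r} {s : State}

theorem congr (h : HasInput A C s) {s' : State} (h0 : s'.reg 0 = s.reg 0)
    (h1 : s'.reg 1 = s.reg 1) (ha : ∀ a < 4, s'.arr a = s.arr a) : HasInput A C s' where
  size := h0.trans h.size
  length := h1.trans h.length
  deg v := by rw [ha 0 (by norm_num), h.deg]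
  nbr v k hk := by rw [ha 2 (by norm_num), ha 1 (by norm_num), h.nbr v k hk]
  cycle i hi := by rw [ha 3 (by norm_num), h.cycle i hi]

theorem setReg (h : HasInput A C s) {x k : ℕ} (hx : 2 ≤ x) : HasInput A C (s.setReg x k) :=
  h.congr (by simp; omega) (by simp; omega) fun _ _ => rfl

theorem eval_degE (h : HasInput A C s) {e : Expr} {v : Fin n} (he : e.eval s = v) :
    (degE e).eval s = (A.nbrs v).length := by
  simp [degE, Expr.eval, he, h.deg]

theorem eval_nbE (h : HasInput A C s) {e f : Expr} {v : Fin n} {k : ℕ} (he : e.eval s = v)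
    (hf : f.eval s = k) (hk : k < (A.nbrs v).length) :
    (nbE e f).eval s = ((A.nbrs v)[k] : Fin n) := by
  simp [nbE, Expr.eval, he, hf, h.nbr v k hk]

/-- Four tests reach the whole adjacency list because of the bound on the degree. -/
theorem eval_anyNbE (h : HasInput A C s) {e : Expr} {v : Fin n} (he : e.eval s = v)
    (hd : (A.nbrs v).length ≤ 4) {f : Expr → Expr} {P : Fin n → Prop}
    (hf : ∀ (g : Expr) (u : Fin n), g.eval s = u → ((f g).eval s ≠ 0 ↔ P u)) :
    (anyNbE e f).eval s ≠ 0 ↔ ∃ u ∈ A.nbrs v, P u := by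
  simp only [anyNbE, Expr.any4_ne, Expr.mul_ne, Expr.lt_ne, h.eval_degE he]
  constructor
  · rintro ⟨k, -, hk, hP⟩
    refine ⟨(A.nbrs v)[k], List.getElem_mem hk, (hf _ _ (h.eval_nbE (k := k) he rfl hk)).1 hP⟩
  · rintro ⟨u, hu, hP⟩
    obtain ⟨k, hk, rfl⟩ := List.getElem_of_mem hu
    exact ⟨k, by omega, hk, (hf _ _ (h.eval_nbE (k := k) he rfl hk)).2 hP⟩

/-- The unreduced index is less than twice the length of the cycle, so subtracting the length at
most once, by means of the truth value of a comparison, reduces it. -/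
theorem eval_cycE (h : HasInput A C s) (hs : s.reg 2 < C.length) {e : Expr}
    (he : e.eval s ≤ C.length) :
    (cycE e).eval s = (cyc C (s.reg 2) (s.reg 4) (e.eval s) : Fin n) := by
  have h1 : (rawIdxE e).eval s =
      if s.reg 4 = 0 then s.reg 2 + e.eval s else s.reg 2 + C.length - e.eval s := by
    simp only [rawIdxE, Expr.eval, Expr.not, h.length]
    split_ifs <;> simp_all
  have h2 : (Expr.sub (rawIdxE e) (.mul (.var 1) (Expr.le (.var 1) (rawIdxE e)))).eval s =
      cycIdx C.length (s.reg 2) (s.reg 4) (e.eval s) := by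
    simp only [Expr.eval, Expr.le, h1, h.length, cycIdx]
    split_ifs <;> simp_all
  have h3 : cycIdx C.length (s.reg 2) (s.reg 4) (e.eval s) < C.length := by
    unfold cycIdx
    split_ifs <;> omega
  rw [cycE, Expr.eval, h2, h.cycle _ h3, cyc]

end HasInput

/-- With truncated subtraction `i - (i - W)` is the minimum of `i` and `W`. It rises to `W`, stays
there, and is then diminished by the excess of `i` over `W + H`, never below zero. The other
coordinate works in the same way. -/
theorem eval_boundaryXE {s : State} (e : Expr) : (boundaryXE e).eval s =
    boundaryX (s.reg 3) (s.reg 5) (e.eval s) := by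
  simp only [boundaryXE, Expr.eval, boundaryX]
  split_ifs <;> omega

theorem eval_boundaryYE {s : State} {e : Expr}
    (he : e.eval s ≤ 2 * (s.reg 3 + s.reg 5)) : (boundaryYE e).eval s =
    boundaryY (s.reg 3) (s.reg 5) (e.eval s) := by
  simp only [boundaryYE, Expr.eval, boundaryY]
  split_ifs <;> omega

end UERRF

/-! ### The meaning of the individual checks. -/

namespace UERRF

open Set WordRAM

theorem forall_lt_iff {n : ℕ} {p : ℕ → Prop} : (∀ k < n, p k) ↔ ∀ v : Fin n, p v :=
  ⟨fun h v => h v v.2, fun h k hk => h ⟨k, hk⟩⟩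

variable {n : ℕ} {G : SimpleGraph (Fin n)} {A : AdjLists G} {r : Fin n} {C : G.Walk r r}
  {s : State}

theorem AdjLists.exists_adj_iff {V : Type*} {G : SimpleGraph V} (A : AdjLists G) {v : V}
    {P : V → Prop} : (∃ u ∈ A.nbrs v, P u) ↔ ∃ u, G.Adj v u ∧ P u := by
  simp only [A.mem_nbrs]

theorem quiet_paramS : Scan.Quiet s paramS ↔ s.reg 2 < s.reg 1 ∧ 0 < s.reg 3 ∧ 0 < s.reg 5 ∧
    2 * (s.reg 3 + s.reg 5) = s.reg 1 := by
  simp only [paramS, Scan.quiet_both, Scan.quiet_check, Expr.lt_ne, Expr.eq_ne]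
  simp only [Expr.eval]

namespace HasInput

theorem quiet_vertexS (h : HasInput A C s) : Scan.Quiet s vertexS ↔
    ∀ v : Fin n, (A.nbrs v).length ≤ 4 ∧ coord s 5 v ≤ s.reg 3 ∧ coord s 6 v ≤ s.reg 5 ∧
      (((coord s 5 v = 0 ∨ coord s 5 v = s.reg 3) ∨ coord s 6 v = 0 ∨ coord s 6 v = s.reg 5) ∨
        (∃ p q, G.Adj v p ∧ G.Adj v q ∧ coord s 6 p = coord s 6 v ∧ coord s 6 q = coord s 6 v ∧
          coord s 5 p < coord s 5 v ∧ coord s 5 v < coord s 5 q) ∨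
        ∃ p q, G.Adj v p ∧ G.Adj v q ∧ coord s 5 p = coord s 5 v ∧ coord s 5 q = coord s 5 v ∧
          coord s 6 p < coord s 6 v ∧ coord s 6 v < coord s 6 q) := by
  simp only [vertexS, Scan.quiet_all, limVal, Scan.quiet_both, Scan.quiet_check, h.size,
    forall_lt_iff]
  refine forall_congr' fun v => ?_
  have h' : HasInput A C (s.setReg 20 v) := h.setReg (by norm_num)
  have he : (Expr.var 20).eval (s.setReg 20 v) = v := by simp [Expr.eval]
  rw [Expr.le_ne, h'.eval_degE he]
  refine and_congr_right fun hd => ?_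
  simp only [Expr.add_ne, Expr.mul_ne]
  rw [
    h'.eval_anyNbE he hd (P := fun u => coord s 6 u = coord s 6 v ∧ coord s 5 u < coord s 5 v),
    h'.eval_anyNbE he hd (P := fun u => coord s 6 u = coord s 6 v ∧ coord s 5 v < coord s 5 u),
    h'.eval_anyNbE he hd (P := fun u => coord s 5 u = coord s 5 v ∧ coord s 6 u < coord s 6 v),
    h'.eval_anyNbE he hd (P := fun u => coord s 5 u = coord s 5 v ∧ coord s 6 v < coord s 6 u)]
  · simp only [A.exists_adj_iff, Expr.le_ne, Expr.eq_ne]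
    simp only [xE, yE, Expr.eval,
      State.setReg_reg, State.setReg_arr, if_pos, coord]
    refine and_congr (by simp) (and_congr (by simp) (or_congr (by simp) (or_congr ?_ ?_)))
    · constructor
      · rintro ⟨⟨p, a, b, c⟩, q, d, e, f⟩
        exact ⟨p, q, a, d, b, e, c, f⟩
      · rintro ⟨p, q, a, d, b, e, c, f⟩
        exact ⟨⟨p, a, b, c⟩, q, d, e, f⟩
    · constructor
      · rintro ⟨⟨p, a, b, c⟩, q, d, e, f⟩
        exact ⟨p, q, a, d, b, e, c, f⟩
      · rintro ⟨p, q, a, d, b, e, c, f⟩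
        exact ⟨⟨p, a, b, c⟩, q, d, e, f⟩
  all_goals
    intro g u hg
    simp only [Expr.mul_ne, Expr.lt_ne, Expr.eq_ne]
    simp only [xE, yE, Expr.eval, hg, coord, State.setReg_arr, State.setReg_reg, if_pos]

theorem quiet_injS (h : HasInput A C s) : Scan.Quiet s injS ↔
    ∀ u v : Fin n, coord s 5 u = coord s 5 v → coord s 6 u = coord s 6 v → u = v := by
  simp only [injS, Scan.quiet_all, limVal, Scan.quiet_check, Expr.add_ne, Expr.eq_ne, Expr.not_ne]
  simp only [xE, yE, Expr.eval, coord, State.setReg_arr, State.setReg_reg, h.size]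
  norm_num
  rw [forall_lt_iff]
  refine forall_congr' fun u => ?_
  rw [forall_lt_iff]
  refine forall_congr' fun v => ?_
  rw [Fin.ext_iff]
  tauto

theorem quiet_nbrs (h : HasInput A C s) {φ : Scan} {v : Fin n} (hv : s.reg 20 = v)
    (hd : (A.nbrs v).length ≤ 4) {P : Fin n → Prop}
    (hφ : ∀ k (u : Fin n), Scan.Quiet ((s.setReg 22 k).setReg 23 u) φ ↔ P u) :
    Scan.Quiet s (.all 22 (some 4) (.guard (.lt (.var 22) (degE (.var 20)))
      (.bind 23 (nbE (.var 20) (.var 22)) φ))) ↔ ∀ u, G.Adj v u → P u := by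
  have he : ∀ k, (Expr.var 20).eval (s.setReg 22 k) = v := by simp [Expr.eval, hv]
  have he' : ∀ k, (Expr.var 22).eval (s.setReg 22 k) = k := by simp [Expr.eval]
  have h' : ∀ k, HasInput A C (s.setReg 22 k) := fun k => h.setReg (by norm_num)
  simp only [Scan.quiet_all, limVal, Scan.quiet_guard, Scan.quiet_bind, Expr.lt_ne,
    (h' _).eval_degE (he _), he']
  constructor
  · intro H u hu
    obtain ⟨k, hk, rfl⟩ := List.getElem_of_mem ((A.mem_nbrs _ _).2 hu)
    have := H k (by omega) hk
    rw [(h' k).eval_nbE (he k) (he' k) hk] at this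
    exact (hφ _ _).1 this
  · intro H k _ hk
    rw [(h' k).eval_nbE (he k) (he' k) hk]
    exact (hφ _ _).2 (H _ ((A.mem_nbrs _ _).1 (List.getElem_mem hk)))

theorem quiet_edgeS (h : HasInput A C s) (hd : ∀ v, (A.nbrs v).length ≤ 4) :
    Scan.Quiet s edgeS ↔ ∀ v u : Fin n, G.Adj v u →
      ((coord s 5 v = coord s 5 u ∨ coord s 6 v = coord s 6 u) ∧ ∀ w : Fin n,
        (¬ (coord s 6 v = coord s 6 u ∧ coord s 6 w = coord s 6 v ∧ coord s 5 v < coord s 5 w ∧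
            coord s 5 w < coord s 5 u) ∧
          ¬ (coord s 5 v = coord s 5 u ∧ coord s 5 w = coord s 5 v ∧ coord s 6 v < coord s 6 w ∧
            coord s 6 w < coord s 6 u)) ∧
        (coord s 6 v = coord s 6 u ∧ coord s 5 v < w ∧ w < coord s 5 u →
          s.arr 10 (w * n + coord s 6 v) ≠ 0) ∧
        (coord s 5 v = coord s 5 u ∧ coord s 6 v < w ∧ w < coord s 6 u →
          s.arr 11 (w * n + coord s 5 v) ≠ 0)) := by
  simp only [edgeS]
  rw [Scan.quiet_all]
  simp only [limVal, h.size, forall_lt_iff]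
  refine forall_congr' fun v => ?_
  have h' : HasInput A C (s.setReg 20 v) := h.setReg (by norm_num)
  refine h'.quiet_nbrs (by simp) (hd v) fun k u => ?_
  simp only [Scan.quiet_both, Scan.quiet_check, Scan.quiet_all, limVal, Expr.add_ne, Expr.mul_ne,
    Expr.eq_ne, Expr.lt_ne, Expr.not_ne]
  simp only [State.setReg_reg, State.setReg_arr, xE, yE, Expr.eval, coord]
  norm_num [h.size]
  refine fun _ => ?_
  rw [forall_lt_iff]
  refine forall_congr' fun w => and_congr Iff.rfl (and_congr ?_ ?_)
  · by_cases hz : s.arr 10 (w * n + s.arr 6 v) = 0 <;> simp [hz]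
  · by_cases hz : s.arr 11 (w * n + s.arr 5 v) = 0 <;> simp [hz]

theorem quiet_cycleS (h : HasInput A C s) (hC : C.length ≤ n) (hs : s.reg 2 < C.length)
    (hm : 2 * (s.reg 3 + s.reg 5) = C.length) :
    Scan.Quiet s cycleS ↔ ∀ i < 2 * (s.reg 3 + s.reg 5),
      coord s 5 (cyc C (s.reg 2) (s.reg 4) i) = boundaryX (s.reg 3) (s.reg 5) i ∧
      coord s 6 (cyc C (s.reg 2) (s.reg 4) i) = boundaryY (s.reg 3) (s.reg 5) i := by
  have key : ∀ i < C.length, Scan.Quiet (s.setReg 20 i)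
      (.both (.check (.eq (xE (cycE (.var 20))) (boundaryXE (.var 20))))
        (.check (.eq (yE (cycE (.var 20))) (boundaryYE (.var 20))))) ↔
      coord s 5 (cyc C (s.reg 2) (s.reg 4) i) = boundaryX (s.reg 3) (s.reg 5) i ∧
      coord s 6 (cyc C (s.reg 2) (s.reg 4) i) = boundaryY (s.reg 3) (s.reg 5) i := by
    intro i hi
    have h' : HasInput A C (s.setReg 20 i) := h.setReg (by norm_num)
    have he : (Expr.var 20).eval (s.setReg 20 i) = i := by simp [Expr.eval]
    have hc := h'.eval_cycE (by simpa using hs) (he.trans_le hi.le)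
    rw [he] at hc
    simp only [Scan.quiet_both, Scan.quiet_check, Expr.eq_ne, xE, yE]
    rw [eval_boundaryXE, eval_boundaryYE (by rw [he]; simp; omega), he]
    simp only [Expr.eval, hc]
    simp [coord]
  simp only [cycleS, Scan.quiet_all, limVal, Scan.quiet_guard, Expr.eval,
    State.setReg_reg, h.size, h.length, hm, if_pos]
  constructor
  · intro H i hi
    exact (key i hi).1 (H i (by omega) (by simpa using hi))
  · intro H i _ hi
    have hi : i < C.length := by simpa using hi
    exact (key i hi).2 (H i hi)

end HasInput

theorem quiet_cornerS {k : Fin 4 → Fin n} (hk : ∀ i : Fin 4, s.arr 4 i = k i) :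
    Scan.Quiet s cornerS ↔ ∀ i,
      (coord s 5 (k i) = 0 ∨ coord s 5 (k i) = s.reg 3) ∧
      (coord s 6 (k i) = 0 ∨ coord s 6 (k i) = s.reg 5) := by
  simp only [cornerS, Scan.quiet_all, limVal, Scan.quiet_check, forall_lt_iff, Expr.mul_ne,
    Expr.add_ne, Expr.eq_ne]
  simp only [xE, yE, Expr.eval, State.setReg_reg, State.setReg_arr]
  simp [hk, coord]

namespace HasInput

theorem hit_nbrs (h : HasInput A C s) {φ : Scan} {v : Fin n} (hv : s.reg 20 = v)
    (hd : (A.nbrs v).length ≤ 4) {j w : ℕ} {P : Fin n → Prop}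
    (hφ : ∀ k (u : Fin n), Scan.Hit ((s.setReg 22 k).setReg 23 u) φ j w ↔ P u) :
    Scan.Hit s (.all 22 (some 4) (.guard (.lt (.var 22) (degE (.var 20)))
      (.bind 23 (nbE (.var 20) (.var 22)) φ))) j w ↔ ∃ u, G.Adj v u ∧ P u := by
  have he : ∀ k, (Expr.var 20).eval (s.setReg 22 k) = v := by simp [Expr.eval, hv]
  have he' : ∀ k, (Expr.var 22).eval (s.setReg 22 k) = k := by simp [Expr.eval]
  have h' : ∀ k, HasInput A C (s.setReg 22 k) := fun k => h.setReg (by norm_num)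
  simp only [Scan.Hit, limVal, Expr.lt_ne, (h' _).eval_degE (he _), he']
  constructor
  · rintro ⟨k, -, hk, H⟩
    rw [(h' k).eval_nbE (he k) (he' k) hk] at H
    exact ⟨_, (A.mem_nbrs _ _).1 (List.getElem_mem hk), (hφ _ _).1 H⟩
  · rintro ⟨u, hu, H⟩
    obtain ⟨k, hk, rfl⟩ := List.getElem_of_mem ((A.mem_nbrs _ _).2 hu)
    refine ⟨k, by omega, hk, ?_⟩
    rw [(h' k).eval_nbE (he k) (he' k) hk]
    exact (hφ _ _).2 H

theorem hit_paintS (h : HasInput A C s) (hd : ∀ v, (A.nbrs v).length ≤ 4) {a b x z w : ℕ}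
    (hz : z < n) : Scan.Hit s (paintS a b) (x * n + z) w ↔
      (∃ p q, G.Adj p q ∧ coord s a p = x ∧ coord s a q = x ∧ coord s b p < z ∧ z < coord s b q) ∧
        w = 1 := by
  have key : ∀ v : Fin n, Scan.Hit (s.setReg 20 v) (.all 22 (some 4)
      (.guard (.lt (.var 22) (degE (.var 20))) (.bind 23 (nbE (.var 20) (.var 22)) (.all 24 none
      (.put (.mul (.eq (.read a (.var 20)) (.read a (.var 23)))
          (.mul (.lt (.read b (.var 20)) (.var 24)) (.lt (.var 24) (.read b (.var 23)))))
        (.add (.mul (.read a (.var 20)) (.var 0)) (.var 24)) (.const 1)))))) (x * n + z) w ↔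
      ∃ u, G.Adj v u ∧ (coord s a v = x ∧ coord s a u = x ∧ coord s b v < z ∧ z < coord s b u ∧
        w = 1) := by
    intro v
    have h' : HasInput A C (s.setReg 20 v) := h.setReg (by norm_num)
    refine h'.hit_nbrs (by simp) (hd v) fun k u => ?_
    simp only [Scan.Hit, limVal, Expr.mul_ne, Expr.eq_ne, Expr.lt_ne]
    simp only [Expr.eval, State.setReg_reg, State.setReg_arr, coord]
    norm_num [h.size]
    constructor
    · rintro ⟨t, ht, ⟨e, h1, h2⟩, e', rfl⟩
      -- Row-major addresses: the second coordinates are below `n`, so division by `n` recovers the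
      -- first coordinate.
      have hx : s.arr a v = x := by
        have := congrArg (· / n) e'
        simpa [Nat.add_div_of_dvd_right, Nat.mul_add_div, mul_comm _ n, Nat.div_eq_of_lt ht,
          Nat.div_eq_of_lt hz, (show 0 < n by omega)] using this
      subst hx
      have : t = z := by omega
      subst this
      exact ⟨rfl, e.symm, h1, h2, rfl⟩
    · rintro ⟨rfl, e, h1, h2, rfl⟩
      exact ⟨z, hz, ⟨e.symm, h1, h2⟩, rfl, rfl⟩
  unfold paintS
  rw [Scan.Hit]
  simp only [limVal, h.size]
  constructor
  · rintro ⟨k, hk, H⟩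
    obtain ⟨u, hu, h1, h2, h3, h4, rfl⟩ := (key ⟨k, hk⟩).1 H
    exact ⟨⟨_, _, hu, h1, h2, h3, h4⟩, rfl⟩
  · rintro ⟨⟨p, q, hpq, h1, h2, h3, h4⟩, rfl⟩
    exact ⟨p, p.2, (key p).2 ⟨q, hpq, h1, h2, h3, h4, rfl⟩⟩

/-- The effect of clearing and painting a table. -/
theorem paint (h : HasInput A C s) {a b c : ℕ} (hc : 4 ≤ c)
    (hw : clearS.within c [0, 1] = true) (hw' : (paintS a b).within c [0, 1] = true)
    (hab : a ≠ c ∧ b ≠ c) :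
    let s' := ((paintS a b).comp c).den ((clearS.comp c).den s)
    (∀ d ≠ c, s'.arr d = s.arr d) ∧ ((∀ v, (A.nbrs v).length ≤ 4) → ∀ x < n, ∀ z < n,
      (s'.arr c (x * n + z) ≠ 0 ↔ ∃ p q, G.Adj p q ∧ coord s a p = x ∧ coord s a q = x ∧
        coord s b p < z ∧ z < coord s b q)) := by
  intro s'
  obtain ⟨r1, b1, h1⟩ := Scan.comp_spec clearS hw s
  set t := (clearS.comp c).den s
  obtain ⟨r2, b2, h2⟩ := Scan.comp_spec _ hw' t
  have ht : HasInput A C t := h.congr (r1 0 (by simp)) (r1 1 (by simp)) fun d hd => b1 d (by omega)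
  refine ⟨fun d hd => (b2 d hd).trans (b1 d hd), fun hd x hx z hz => ?_⟩
  have hta : ∀ v : Fin n, coord t a v = coord s a v := fun v => by rw [coord, b1 a hab.1, coord]
  have htb : ∀ v : Fin n, coord t b v = coord s b v := fun v => by rw [coord, b1 b hab.2, coord]
  have h0 : t.arr c (x * n + z) = 0 := by
    have hit : ∀ w, Scan.Hit s clearS (x * n + z) w ↔
        ∃ k < n, ∃ l < n, k * n + l = x * n + z ∧ 0 = w := by
      intro w
      simp [clearS, Scan.Hit, limVal, h.size, Expr.eval]
    rcases h1 (x * n + z) with ⟨w, hw, e⟩ | ⟨hw, -⟩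
    · obtain ⟨_, _, _, _, _, rfl⟩ := (hit w).1 hw
      exact e
    · exact (hw 0 ((hit 0).2 ⟨x, hx, z, hz, rfl, rfl⟩)).elim
  simp only [← hta, ← htb]
  rcases h2 (x * n + z) with ⟨w, hw, e⟩ | ⟨hw, e⟩
  · obtain ⟨H, rfl⟩ := (ht.hit_paintS hd hz).1 hw
    exact iff_of_true (by rw [e]; exact one_ne_zero) H
  · refine iff_of_false (by rw [e]; exact not_not_intro h0) fun H => ?_
    exact hw 1 ((ht.hit_paintS hd hz).2 ⟨H, rfl⟩)

end HasInput

end UERRF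

/-! ### The rotation check and the whole verification. -/

namespace UERRF

open Set WordRAM

theorem eval_dirE {n : ℕ} {s : State} {e f : Expr} {v u : Fin n} (he : e.eval s = v)
    (hf : f.eval s = u) : (dirE e f).eval s =
      direction (natDrawing (coord s 5) (coord s 6) v) (natDrawing (coord s 5) (coord s 6) u) := by
  simp only [dirE, Expr.not, Expr.eval, xE, yE, he, hf, direction, natDrawing, coord, Nat.cast_lt]
  split_ifs <;> simp_all

/-- The order is transitive, so it suffices to compare consecutive entries, and rotating a list
shifts indices modulo its length. -/
theorem exists_isRotated_iff {α : Type*} (l : List α) (hl : 0 < l.length) (f : α → ℕ) :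
    (∃ l' : List α, l' ~r l ∧ (l'.map f).Pairwise (· < ·)) ↔ ∃ a < l.length,
      ∀ k, k + 1 < l.length → f (l[(a + k) % l.length]'(Nat.mod_lt _ hl)) <
        f (l[(a + (k + 1)) % l.length]'(Nat.mod_lt _ hl)) := by
  have key : ∀ a, ((l.rotate a).map f).Pairwise (· < ·) ↔
      ∀ k, k + 1 < l.length → f (l[(a + k) % l.length]'(Nat.mod_lt _ hl)) <
        f (l[(a + (k + 1)) % l.length]'(Nat.mod_lt _ hl)) := by
    intro a
    rw [← List.isChain_iff_pairwise, List.isChain_iff_getElem]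
    simp only [List.length_map, List.length_rotate, List.getElem_map, List.getElem_rotate,
      Nat.add_comm a]
  constructor
  · rintro ⟨l', hr, hp⟩
    obtain ⟨a, -, rfl⟩ := List.isRotated_iff_mod.1 hr.symm
    refine ⟨a % l.length, Nat.mod_lt _ hl, ?_⟩
    rw [← List.rotate_mod] at hp
    exact (key _).1 hp
  · rintro ⟨a, -, h⟩
    exact ⟨l.rotate a, (List.IsRotated.forall l a), (key a).2 h⟩

variable {n : ℕ} {G : SimpleGraph (Fin n)} {A : AdjLists G} {r : Fin n} {C : G.Walk r r}
  {s : State}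

namespace HasInput

theorem eval_rotNbE (h : HasInput A C s) {e f : Expr} {v : Fin n} {a k : ℕ} (he : e.eval s = v)
    (hf : f.eval s = a) (ha : a < (A.nbrs v).length) (hk : k < (A.nbrs v).length) :
    (rotNbE e f k).eval s =
      ((A.nbrs v)[(a + k) % (A.nbrs v).length]'(Nat.mod_lt _ (by omega)) : Fin n) := by
  refine h.eval_nbE he ?_ _
  simp only [Expr.eval, Expr.le, h.eval_degE he, hf]
  split_ifs with h1
  · rw [Nat.mod_eq_sub_mod (by omega), Nat.mod_eq_of_lt (by omega)]
    omega
  · rw [Nat.mod_eq_of_lt (by omega)]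
    omega

/-- A list of at most four neighbours has at most four rotations, each with at most three
consecutive comparisons. -/
theorem eval_rotE (h : HasInput A C s) {e : Expr} {v : Fin n} (he : e.eval s = v)
    (h0 : 0 < (A.nbrs v).length) (hd : (A.nbrs v).length ≤ 4) :
    (rotE e).eval s ≠ 0 ↔ ∃ l : List (Fin n), l ~r A.nbrs v ∧
      (l.map fun u => direction (natDrawing (coord s 5) (coord s 6) v)
        (natDrawing (coord s 5) (coord s 6) u)).Pairwise (· < ·) := by
  rw [exists_isRotated_iff _ h0]
  have step : ∀ a < (A.nbrs v).length, ∀ k, (stepE e (.const a) k).eval s ≠ 0 ↔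
      (k + 1 < (A.nbrs v).length → direction (natDrawing (coord s 5) (coord s 6) v)
          (natDrawing (coord s 5) (coord s 6)
            ((A.nbrs v)[(a + k) % (A.nbrs v).length]'(Nat.mod_lt _ h0))) <
        direction (natDrawing (coord s 5) (coord s 6) v) (natDrawing (coord s 5) (coord s 6)
            ((A.nbrs v)[(a + (k + 1)) % (A.nbrs v).length]'(Nat.mod_lt _ h0)))) := by
    intro a ha k
    simp only [stepE, Expr.add_ne, Expr.le_ne, Expr.lt_ne, h.eval_degE he]
    by_cases hk : k + 1 < (A.nbrs v).length
    · rw [eval_dirE he (h.eval_rotNbE (a := a) (k := k) he rfl ha (by omega)),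
        eval_dirE he (h.eval_rotNbE (a := a) (k := k + 1) he rfl ha hk)]
      simp only [hk, true_imp_iff]
      simp only [Expr.eval]
      exact or_iff_right (by omega)
    · simp only [hk, false_imp_iff, iff_true]
      left
      simp only [Expr.eval]
      omega
  simp only [rotE, Expr.any4_ne, Expr.mul_ne, Expr.lt_ne, h.eval_degE he]
  constructor
  · rintro ⟨a, -, ha, h1, h2, h3⟩
    refine ⟨a, ha, fun k hk => ?_⟩
    have : k = 0 ∨ k = 1 ∨ k = 2 := by omega
    rcases this with rfl | rfl | rfl
    · exact (step a ha _).1 h1 hk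
    · exact (step a ha _).1 h2 hk
    · exact (step a ha _).1 h3 hk
  · rintro ⟨a, ha, H⟩
    exact ⟨a, by omega, ha, (step a ha _).2 (H 0), (step a ha _).2 (H 1), (step a ha _).2 (H 2)⟩

theorem quiet_rotationS (h : HasInput A C s) (h0 : ∀ v, 0 < (A.nbrs v).length)
    (hd : ∀ v, (A.nbrs v).length ≤ 4) : Scan.Quiet s rotationS ↔
      PreservesRotation (natDrawing (coord s 5) (coord s 6)) A := by
  simp only [rotationS, Scan.quiet_all, limVal, Scan.quiet_check, h.size, forall_lt_iff,
    PreservesRotation]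
  refine forall_congr' fun v => ?_
  have h' : HasInput A C (s.setReg 20 v) := h.setReg (by norm_num)
  exact h'.eval_rotE (by simp [Expr.eval]) (h0 v) (hd v)

/-- The verification succeeds if and only if a drawing with the required properties has been
found. -/
theorem quiet_checkS (h : HasInput A C s) (hC : C.length ≤ n) {rot corners : Bool}
    (hV : (∀ v, (A.nbrs v).length ≤ 4) → ∀ x < n, ∀ z < n, (s.arr 10 (x * n + z) ≠ 0 ↔
      ∃ p q, G.Adj p q ∧ coord s 5 p = x ∧ coord s 5 q = x ∧ coord s 6 p < z ∧ z < coord s 6 q))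
    (hH : (∀ v, (A.nbrs v).length ≤ 4) → ∀ x < n, ∀ z < n, (s.arr 11 (x * n + z) ≠ 0 ↔
      ∃ p q, G.Adj p q ∧ coord s 6 p = x ∧ coord s 6 q = x ∧ coord s 5 p < z ∧ z < coord s 5 q))
    {k : Fin 4 → Fin n} (hk : corners = true → ∀ i : Fin 4, s.arr 4 i = k i) :
    Scan.Quiet s (checkS rot corners) ↔ s.reg 2 < C.length ∧
      2 * (s.reg 3 + s.reg 5) = C.length ∧
      IsGridDrawing G (cyc C (s.reg 2) (s.reg 4)) (s.reg 3) (s.reg 5)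
        (natDrawing (coord s 5) (coord s 6)) ∧ (∀ v, (A.nbrs v).length ≤ 4) ∧
      (corners = true → ∀ i, (coord s 5 (k i) = 0 ∨ coord s 5 (k i) = s.reg 3) ∧
        (coord s 6 (k i) = 0 ∨ coord s 6 (k i) = s.reg 5)) ∧
      (rot = true → PreservesRotation (natDrawing (coord s 5) (coord s 6)) A) := by
  have corner : Scan.Quiet s (if corners then cornerS else .check (.const 1)) ↔
      (corners = true → ∀ i, (coord s 5 (k i) = 0 ∨ coord s 5 (k i) = s.reg 3) ∧
        (coord s 6 (k i) = 0 ∨ coord s 6 (k i) = s.reg 5)) := by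
    cases corners
    · simp [Scan.quiet_check, Expr.eval]
    · simp only [if_true, true_imp_iff]
      exact quiet_cornerS (hk rfl)
  have rotation : (∀ v, 0 < (A.nbrs v).length) → (∀ v, (A.nbrs v).length ≤ 4) →
      (Scan.Quiet s (if rot then rotationS else .check (.const 1)) ↔
      (rot = true → PreservesRotation (natDrawing (coord s 5) (coord s 6)) A)) := by
    intro h0 hd
    cases rot
    · simp [Scan.quiet_check, Expr.eval]
    · simp only [if_true, true_imp_iff]
      exact h.quiet_rotationS h0 hd
  -- The rotation check needs nonempty lists, as it fails when there is no rotation to try; in a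
  -- grid drawing no vertex is isolated.
  have pos : s.reg 2 < C.length → 2 * (s.reg 3 + s.reg 5) = C.length →
      IsGridDrawing G (cyc C (s.reg 2) (s.reg 4)) (s.reg 3) (s.reg 5)
        (natDrawing (coord s 5) (coord s 6)) → ∀ v, 0 < (A.nbrs v).length := by
    intro h2 hm hD v
    obtain ⟨w, hw⟩ := hD.exists_adj (hm ▸ cyc_isClosedSeq h2) v
    exact List.length_pos_of_mem ((A.mem_nbrs _ _).2 hw)
  simp only [checkS, Scan.quiet_both, quiet_paramS, h.length]
  constructor
  · rintro ⟨⟨h2, h3, h5, hm⟩, hv, hi, he, hc, hco, hr⟩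
    rw [h.quiet_vertexS] at hv
    have hd := fun v => (hv v).1
    rw [h.quiet_edgeS hd] at he
    have hD : IsGridDrawing G (cyc C (s.reg 2) (s.reg 4)) (s.reg 3) (s.reg 5)
        (natDrawing (coord s 5) (coord s 6)) := by
      refine isGridDrawing_natDrawing.2 ⟨⟨h.quiet_injS.1 hi, fun u v huv => (he u v huv).1,
        fun u v w huv e e' hh => ((he u v huv).2 w).1.1 ⟨e, e', hh⟩,
        fun u v w huv e e' hh => ((he u v huv).2 w).1.2 ⟨e, e', hh⟩, ?_, ?_⟩, h3, h5,
        fun v => (hv v).2.1, fun v => (hv v).2.2.1, (h.quiet_cycleS hC h2 hm).1 hc,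
        fun v => (hv v).2.2.2⟩
      · intro u v t huv e e1 e2
        have ht := (hv v).2.1
        have hy := (hv u).2.2.1
        exact (hV hd t (by omega) _ (by omega)).1
          (((he u v huv).2 ⟨t, by omega⟩).2.1 ⟨e, e1, e2⟩)
      · intro u v t huv e e1 e2
        have ht := (hv v).2.2.1
        have hy := (hv u).2.1
        exact (hH hd t (by omega) _ (by omega)).1
          (((he u v huv).2 ⟨t, by omega⟩).2.2 ⟨e, e1, e2⟩)
    exact ⟨h2, hm, hD, hd, corner.1 hco, (rotation (pos h2 hm hD) hd).1 hr⟩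
  · rintro ⟨h2, hm, hD, hd, hco, hr⟩
    obtain ⟨⟨g1, g2, g3, g4, g5, g6⟩, hW, hH', gx, gy, gb, gs⟩ := isGridDrawing_natDrawing.1 hD
    refine ⟨⟨h2, hW, hH', hm⟩, h.quiet_vertexS.2 fun v => ⟨hd v, gx v, gy v, gs v⟩,
      h.quiet_injS.2 g1, (h.quiet_edgeS hd).2 fun u v huv => ⟨g2 u v huv, fun w =>
        ⟨⟨fun e => g3 u v w huv e.1 e.2.1 e.2.2, fun e => g4 u v w huv e.1 e.2.1 e.2.2⟩, ?_, ?_⟩⟩,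
      (h.quiet_cycleS hC h2 hm).2 gb, corner.2 hco, (rotation (pos h2 hm hD) hd).2 hr⟩
    · rintro ⟨e, e1, e2⟩
      have := gy u
      exact (hV hd w w.2 _ (by omega)).2 (g5 u v w huv e e1 e2)
    · rintro ⟨e, e1, e2⟩
      have := gx u
      exact (hH hd w w.2 _ (by omega)).2 (g6 u v w huv e e1 e2)

end HasInput

end UERRF

namespace WordRAM

namespace Scan

/-- All instructions write the value one into cell `0`. -/
def isCheck : Scan → Bool
  | put _ (.const 0) (.const 1) => true
  | put _ _ _ => false
  | all _ _ φ => φ.isCheck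
  | bind _ _ φ => φ.isCheck
  | guard _ φ => φ.isCheck
  | both φ ψ => φ.isCheck && ψ.isCheck

/-- Consequently a flag that is cleared beforehand stays zero exactly if the scan writes nothing. -/
theorem hit_of_isCheck {φ : Scan} (hφ : φ.isCheck = true) {s : State} {j w : ℕ}
    (h : Hit s φ j w) : j = 0 ∧ w = 1 := by
  induction φ generalizing s with
  | put c i v =>
    unfold isCheck at hφ
    split at hφ
    · rename_i h1
      cases h1
      exact ⟨h.2.1.symm, h.2.2.symm⟩
    · cases hφ
    · simp_all
    · simp_all
    · simp_all
    · simp_all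
  | all x lim φ ih =>
    obtain ⟨k, -, h⟩ := h
    exact ih hφ h
  | bind x e φ ih => exact ih hφ h
  | guard e φ ih => exact ih hφ h.2
  | both φ ψ h1 h2 =>
    simp only [isCheck, Bool.and_eq_true] at hφ
    exact h.elim (h1 hφ.1) (h2 hφ.2)

end Scan
end WordRAM

/-! ### Setting up a trial: degrees, height and the position of the cycle. -/

namespace UERRF

open Set WordRAM

theorem checkS_isCheck (rot corners : Bool) : (checkS rot corners).isCheck = true := by
  cases rot <;> cases corners <;> decide

theorem mem_support_iff_cyc {V : Type*} {G : SimpleGraph V} {r : V} {C : G.Walk r r} {s o : ℕ}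
    (hs : s < C.length) {v : V} : v ∈ C.support ↔ ∃ i < C.length, v = cyc C s o i := by
  constructor
  · intro h
    obtain ⟨k, rfl, hk⟩ := SimpleGraph.Walk.mem_support_iff_exists_getVert.1 h
    wlog hk' : k < C.length generalizing k
    · have e : C.getVert k = C.getVert 0 := by
        rw [show k = C.length by omega]; simp
      rw [e] at h ⊢
      exact this 0 (by omega) h (by omega)
    unfold cyc cycIdx
    by_cases ho : o = 0
    · by_cases h' : s ≤ k
      · exact ⟨k - s, by omega, congrArg _ (by split_ifs <;> omega)⟩
      · exact ⟨k + C.length - s, by omega, congrArg _ (by split_ifs <;> omega)⟩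
    · by_cases h' : k ≤ s
      · exact ⟨s - k, by omega, congrArg _ (by split_ifs <;> omega)⟩
      · exact ⟨s + C.length - k, by omega, congrArg _ (by split_ifs <;> omega)⟩
  · rintro ⟨i, -, rfl⟩
    exact cyc_mem_support i

/-- Of two neighbours in the same direction the nearer one would lie inside the edge to the other.
So the directions of the neighbours are different, and there are only four. -/
theorem IsLattice.length_nbrs_le {V : Type*} {G : SimpleGraph V} {D : Drawing V}
    (hD : IsLattice G D) (A : AdjLists G) (v : V) : (A.nbrs v).length ≤ 4 := by
  have h : ((A.nbrs v).map fun u => direction (D v) (D u)).Nodup := by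
    refine (A.nodup v).map_on fun u hu w hw e => ?_
    rw [A.mem_nbrs] at hu hw
    have key : ∀ u, G.Adj v u →
        (direction (D v) (D u) = 0 ∧ (D v).1 = (D u).1 ∧ (D v).2 < (D u).2) ∨
        (direction (D v) (D u) = 1 ∧ (D v).2 = (D u).2 ∧ (D v).1 < (D u).1) ∨
        (direction (D v) (D u) = 2 ∧ (D v).1 = (D u).1 ∧ (D u).2 < (D v).2) ∨
        (direction (D v) (D u) = 3 ∧ (D v).2 = (D u).2 ∧ (D u).1 < (D v).1) := by
      intro u hu
      have n1 : ¬ D v = D u := fun h => hu.ne (hD.injective h)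
      have a1 := hD.aligned v u hu
      rw [Prod.ext_iff] at n1
      unfold direction
      split_ifs <;> omega
    refine hD.injective (Prod.ext_iff.2 ?_)
    rcases key u hu with k1 | k1 | k1 | k1 <;> rcases key w hw with k2 | k2 | k2 | k2 <;>
      try omega
    · have c1 := hD.clear_v v u w hu
      have c2 := hD.clear_v v w u hw
      omega
    · have c1 := hD.clear_h v u w hu
      have c2 := hD.clear_h v w u hw
      omega
    · have c1 := hD.clear_v u v w hu.symm
      have c2 := hD.clear_v w v u hw.symm
      omega
    · have c1 := hD.clear_h u v w hu.symm
      have c2 := hD.clear_h w v u hw.symm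
      omega
  have := (List.subperm_of_subset (l₂ := List.range 4) h fun k hk => by
    obtain ⟨u, -, rfl⟩ := List.mem_map.1 hk
    simp only [List.mem_range, direction]
    split_ifs <;> omega).length_le
  simpa using this

variable {n : ℕ} {G : SimpleGraph (Fin n)} {A : AdjLists G} {r : Fin n} {C : G.Walk r r}
  {s : State}

theorem HasInput.den (h : HasInput A C s) (P : FProg) (h0 : 0 ∉ P.regs) (h1 : 1 ∉ P.regs)
    (ha : ∀ a < 4, a ∉ P.arrs) : HasInput A C (P.den s) :=
  h.congr (P.den_reg h0 s) (P.den_reg h1 s) fun a hlt => P.den_arr (ha a hlt) s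

theorem resetP_spec (hs : s.reg 0 = n) {a : ℕ} {e : Expr}
    (he : e.within a [20, 0, 1, 2, 3, 4, 5] = true) (v : Fin n) :
    ((resetP a e).den s).arr a v = e.eval (s.setReg 20 v) := by
  have hw : (Scan.all 20 none (.put (.const 1) (.var 20) e)).within a [0, 1, 2, 3, 4, 5] = true := by
    simp [Scan.within, Expr.within, he]
  obtain ⟨-, -, h⟩ := Scan.comp_spec _ hw s
  have hit : ∀ j w, Scan.Hit s (Scan.all 20 none (.put (.const 1) (.var 20) e)) j w ↔
      ∃ k < n, k = j ∧ e.eval (s.setReg 20 k) = w := by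
    intro j w
    simp [Scan.Hit, limVal, hs, Expr.eval]
  rcases h v with ⟨w, hw, e⟩ | ⟨hw, -⟩
  · obtain ⟨k, -, rfl, rfl⟩ := (hit _ _).1 hw
    exact e
  · exact (hw _ ((hit _ _).2 ⟨v, v.2, rfl, rfl⟩)).elim

/-- The value written is a function `f` of the vertex, so the order of the writes is irrelevant. -/
theorem HasInput.onCycleP_spec (h : HasInput A C s) (hC : C.length ≤ n) (hs : s.reg 2 < C.length)
    {a : ℕ} (ha : a ≠ 3) {e : Expr} (he : e.within a [20, 0, 1, 2, 3, 4, 5] = true)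
    {f : Fin n → ℕ} (hf : ∀ i < C.length, e.eval (s.setReg 20 i) = f (cyc C (s.reg 2) (s.reg 4) i))
    (v : Fin n) : (v ∈ C.support → ((onCycleP a e).den s).arr a v = f v) ∧
      (v ∉ C.support → ((onCycleP a e).den s).arr a v = s.arr a v) := by
  have hw : (Scan.all 20 none (.put (.lt (.var 20) (.var 1)) (cycE (.var 20)) e)).within a
      [0, 1, 2, 3, 4, 5] = true := by
    simp [Scan.within, Expr.within, he, cycE, rawIdxE, Expr.le, Expr.not, ha.symm]
  obtain ⟨-, -, h'⟩ := Scan.comp_spec _ hw s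
  have hit : ∀ j w, Scan.Hit s (Scan.all 20 none
      (.put (.lt (.var 20) (.var 1)) (cycE (.var 20)) e)) j w ↔
      ∃ k < C.length, ((cyc C (s.reg 2) (s.reg 4) k : Fin n) : ℕ) = j ∧
        f (cyc C (s.reg 2) (s.reg 4) k) = w := by
    intro j w
    simp only [Scan.Hit, limVal, h.size, Expr.lt_ne]
    constructor
    · rintro ⟨k, hk, hlt, h1, h2⟩
      simp only [Expr.eval, State.setReg_reg, h.length] at hlt
      norm_num at hlt
      have hc := (h.setReg (x := 20) (k := k) (by norm_num)).eval_cycE (e := .var 20) (by simpa)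
        (by simpa [Expr.eval] using hlt.le)
      simp only [Expr.eval, State.setReg_reg] at hc
      norm_num at hc
      exact ⟨k, hlt, by rw [← h1, hc], by rw [← h2, hf k hlt]⟩
    · rintro ⟨k, hlt, h1, h2⟩
      have hc := (h.setReg (x := 20) (k := k) (by norm_num)).eval_cycE (e := .var 20) (by simpa)
        (by simpa [Expr.eval] using hlt.le)
      simp only [Expr.eval, State.setReg_reg] at hc
      norm_num at hc
      exact ⟨k, by omega, by simpa [Expr.eval, h.length] using hlt, by rw [hc, h1],
        by rw [hf k hlt, h2]⟩
  constructor
  · intro hv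
    rcases h' v with ⟨w, hw, e⟩ | ⟨hw, -⟩
    · obtain ⟨k, -, h1, rfl⟩ := (hit _ _).1 hw
      rw [Fin.ext h1] at e
      exact e
    · obtain ⟨i, hi, rfl⟩ := (mem_support_iff_cyc (o := s.reg 4) hs).1 hv
      exact (hw _ ((hit _ _).2 ⟨i, hi, rfl, rfl⟩)).elim
  · intro hv
    rcases h' v with ⟨w, hw, -⟩ | ⟨-, e⟩
    · obtain ⟨k, hk, h1, -⟩ := (hit _ _).1 hw
      exact (hv ((mem_support_iff_cyc (o := s.reg 4) hs).2 ⟨k, hk, Fin.ext h1.symm⟩)).elim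
    · exact e

/-- Expressions have no division, so the height is found by running through all candidates; the
equation has only one solution. -/
theorem HasInput.heightP_spec (h : HasInput A C s) {H : ℕ} (hH : H < n)
    (hm : 2 * (s.reg 3 + H) = C.length) : (heightP.den s).reg 5 = H := by
  have hw : (Scan.all 20 none (.put (.eq (.mul (.const 2) (.add (.var 3) (.var 20))) (.var 1))
      (.const 0) (.var 20))).within 12 [0, 1, 2, 3, 4, 5] = true := by decide
  set t := s.setArr 12 0 0 with ht
  obtain ⟨-, -, h'⟩ := Scan.comp_spec _ hw t
  have hit : ∀ w, Scan.Hit t (Scan.all 20 none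
      (.put (.eq (.mul (.const 2) (.add (.var 3) (.var 20))) (.var 1)) (.const 0) (.var 20))) 0 w ↔
      ∃ k < n, 2 * (s.reg 3 + k) = C.length ∧ k = w := by
    intro w
    simp [Scan.Hit, limVal, h.size, h.length, Expr.eval, ht]
  simp only [heightP, FProg.den, Expr.eval, State.setReg_reg, if_pos, ← ht]
  rcases h' 0 with ⟨w, hw, e⟩ | ⟨hw, -⟩
  · obtain ⟨k, -, h1, rfl⟩ := (hit _).1 hw
    rw [e]
    omega
  · exact (hw _ ((hit _).2 ⟨H, hH, hm, rfl⟩)).elim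

/-- The memory contains the values of `x` and `y` for the vertices of the cycle, and default values
for the others. -/
structure IsPlaced (C : G.Walk r r) (W H : ℕ) (x y : Fin n → ℕ) (s : State) : Prop where
  width : s.reg 3 = W
  height : s.reg 5 = H
  flag : ∀ v : Fin n, s.arr 7 v ≠ 0 ↔ v ∈ C.support
  x_mem : ∀ v ∈ C.support, coord s 5 v = x v
  y_mem : ∀ v ∈ C.support, coord s 6 v = y v

theorem HasInput.placeP_spec (h : HasInput A C s) (hC : C.length ≤ n) (hs : s.reg 2 < C.length)
    {W H : ℕ} (hW : s.reg 3 = W) (hH : s.reg 5 = H) (hm : 2 * (W + H) = C.length)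
    {x y : Fin n → ℕ}
    (hD : IsGridDrawing G (cyc C (s.reg 2) (s.reg 4)) W H (natDrawing x y)) :
    IsPlaced C W H x y (placeP.den s) ∧
      (∀ v ∉ C.support, coord (placeP.den s) 5 v = W) ∧
      ∀ v ∉ C.support, coord (placeP.den s) 6 v = H := by
  subst hW hH
  obtain ⟨-, -, -, -, -, hb, -⟩ := isGridDrawing_natDrawing.1 hD
  simp only [placeP, FProg.den]
  set s1 := (resetP 5 (.var 3)).den s with e1
  set s2 := (resetP 6 (.var 5)).den s1 with e2
  set s3 := (resetP 7 (.const 0)).den s2 with e3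
  set s4 := (onCycleP 5 (boundaryXE (.var 20))).den s3 with e4
  set s5 := (onCycleP 6 (boundaryYE (.var 20))).den s4 with e5
  set s6 := (onCycleP 7 (.const 1)).den s5 with e6
  have r1 : ∀ x < 6, s1.reg x = s.reg x := fun x hx => FProg.den_reg _ (by
    simp [resetP, Scan.comp, FProg.regs]; omega) _
  have r2 : ∀ x < 6, s2.reg x = s.reg x := fun x hx => (FProg.den_reg _ (by
    simp [resetP, Scan.comp, FProg.regs]; omega) _).trans (r1 x hx)
  have r3 : ∀ x < 6, s3.reg x = s.reg x := fun x hx => (FProg.den_reg _ (by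
    simp [resetP, Scan.comp, FProg.regs]; omega) _).trans (r2 x hx)
  have r4 : ∀ x < 6, s4.reg x = s.reg x := fun x hx => (FProg.den_reg _ (by
    simp [onCycleP, Scan.comp, FProg.regs]; omega) _).trans (r3 x hx)
  have r5 : ∀ x < 6, s5.reg x = s.reg x := fun x hx => (FProg.den_reg _ (by
    simp [onCycleP, Scan.comp, FProg.regs]; omega) _).trans (r4 x hx)
  have r6 : ∀ x < 6, s6.reg x = s.reg x := fun x hx => (FProg.den_reg _ (by
    simp [onCycleP, Scan.comp, FProg.regs]; omega) _).trans (r5 x hx)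
  have b1 : ∀ a, a ≠ 5 → s1.arr a = s.arr a := fun a hx => FProg.den_arr _ (by
    simpa [resetP, Scan.comp, FProg.arrs] using hx) _
  have b2 : ∀ a, a ≠ 6 → s2.arr a = s1.arr a := fun a hx => FProg.den_arr _ (by
    simpa [resetP, Scan.comp, FProg.arrs] using hx) _
  have b3 : ∀ a, a ≠ 7 → s3.arr a = s2.arr a := fun a hx => FProg.den_arr _ (by
    simpa [resetP, Scan.comp, FProg.arrs] using hx) _
  have b4 : ∀ a, a ≠ 5 → s4.arr a = s3.arr a := fun a hx => FProg.den_arr _ (by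
    simpa [onCycleP, Scan.comp, FProg.arrs] using hx) _
  have b5 : ∀ a, a ≠ 6 → s5.arr a = s4.arr a := fun a hx => FProg.den_arr _ (by
    simpa [onCycleP, Scan.comp, FProg.arrs] using hx) _
  have b6 : ∀ a, a ≠ 7 → s6.arr a = s5.arr a := fun a hx => FProg.den_arr _ (by
    simpa [onCycleP, Scan.comp, FProg.arrs] using hx) _
  have h3 : HasInput A C s3 := h.congr (r3 0 (by omega)) (r3 1 (by omega)) fun a ha => by
    rw [b3 a (by omega), b2 a (by omega), b1 a (by omega)]
  have h4 : HasInput A C s4 := h3.congr ((r4 0 (by omega)).trans (r3 0 (by omega)).symm)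
    ((r4 1 (by omega)).trans (r3 1 (by omega)).symm) fun a ha => b4 a (by omega)
  have h5 : HasInput A C s5 := h4.congr ((r5 0 (by omega)).trans (r4 0 (by omega)).symm)
    ((r5 1 (by omega)).trans (r4 1 (by omega)).symm) fun a ha => b5 a (by omega)
  have c5 := h3.onCycleP_spec hC (by rw [r3 2 (by omega)]; exact hs) (a := 5) (by omega)
    (e := boundaryXE (.var 20)) (by decide) (f := x) (fun i hi => by
      rw [eval_boundaryXE, r3 2 (by omega), r3 4 (by omega), (hb i (by omega)).1]
      simp [Expr.eval, r3 3 (by omega), r3 5 (by omega)])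
  have c6 := h4.onCycleP_spec hC (by rw [r4 2 (by omega)]; exact hs) (a := 6) (by omega)
    (e := boundaryYE (.var 20)) (by decide) (f := y) (fun i hi => by
      rw [eval_boundaryYE (by simp [Expr.eval, r4 3 (by omega), r4 5 (by omega)]; omega),
        r4 2 (by omega), r4 4 (by omega), (hb i (by omega)).2]
      simp [Expr.eval, r4 3 (by omega), r4 5 (by omega)])
  have c7 := h5.onCycleP_spec hC (by rw [r5 2 (by omega)]; exact hs) (a := 7) (by omega)
    (e := .const 1) (by decide) (f := fun _ => 1) (fun i hi => rfl)
  have d5 := resetP_spec h.size (a := 5) (e := .var 3) (by decide)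
  have d6 := resetP_spec ((r1 0 (by omega)).trans h.size) (a := 6) (e := .var 5) (by decide)
  have d7 := resetP_spec ((r2 0 (by omega)).trans h.size) (a := 7) (e := .const 0) (by decide)
  have g5 : ∀ v : Fin n, s6.arr 5 v = s4.arr 5 v := fun v => by
    rw [b6 5 (by omega), b5 5 (by omega)]
  have g6 : ∀ v : Fin n, s6.arr 6 v = s5.arr 6 v := fun v => by rw [b6 6 (by omega)]
  refine ⟨⟨r6 3 (by omega), r6 5 (by omega), fun v => ?_, fun v hv => ?_, fun v hv => ?_⟩,
    fun v hv => ?_, fun v hv => ?_⟩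
  · by_cases hv : v ∈ C.support
    · rw [(c7 v).1 hv]; simpa using hv
    · rw [(c7 v).2 hv, b5 7 (by omega), b4 7 (by omega), d7 v]
      simpa [Expr.eval] using hv
  · rw [coord, g5, (c5 v).1 hv]
  · rw [coord, g6, (c6 v).1 hv]
  · rw [coord, g5, (c5 v).2 hv, b3 5 (by omega), b2 5 (by omega), d5 v]
    simp [Expr.eval]
  · rw [coord, g6, (c6 v).2 hv, b4 6 (by omega), b3 6 (by omega), d6 v]
    simp [Expr.eval, r1 5 (by omega)]

end UERRF

namespace WordRAM.FProg

theorem den_seq (P Q : FProg) (s : State) : (seq P Q).den s = Q.den (P.den s) := rfl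

theorem den_assign (x : ℕ) (e : Expr) (s : State) :
    (assign x e).den s = s.setReg x (e.eval s) := rfl

theorem den_write (a : ℕ) (i e : Expr) (s : State) :
    (write a i e).den s = s.setArr a (i.eval s) (e.eval s) := rfl

end WordRAM.FProg

/-! ### Computing the ends of chains. -/

namespace UERRF

open Set WordRAM

variable {n : ℕ} {G : SimpleGraph (Fin n)} {A : AdjLists G} {r : Fin n} {C : G.Walk r r}
  {s : State} {W H : ℕ} {x y : Fin n → ℕ}

namespace HasInput

/-- An end is a fixed point of the step, so always taking `n` steps does no harm. -/
theorem chainStepP_at_end (h : HasInput A C s) (hf : ∀ v : Fin n, s.arr 7 v ≠ 0 ↔ v ∈ C.support)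
    {c : Fin n} (hc : s.reg 16 = c) (hs : c ∈ C.support ∨ (A.nbrs c).length ≠ 2) :
    chainStepP.den s = s := by
  rw [chainStepP, FProg.den, if_neg]
  · rfl
  · rw [Expr.mul_ne, Expr.not_ne, Expr.eq_ne, h.eval_degE (e := .var 16) (v := c) hc]
    simp only [Expr.eval, hc, hf]
    tauto

theorem chainStepP_go (h : HasInput A C s) (hf : ∀ v : Fin n, s.arr 7 v ≠ 0 ↔ v ∈ C.support)
    {p c a b : Fin n} (hp : s.reg 15 = p) (hc : s.reg 16 = c) (hs : c ∉ C.support)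
    (hab : A.nbrs c = [a, b]) : (chainStepP.den s).reg 15 = c ∧
      (chainStepP.den s).reg 16 = (if a = p then b else a : Fin n) := by
  have h2 : (A.nbrs c).length = 2 := by rw [hab]; rfl
  have e0 : (nbE (.var 16) (.const 0)).eval s = a := by
    rw [h.eval_nbE (e := .var 16) (v := c) (k := 0) hc rfl (by omega)]
    simp [hab]
  set t := s.setReg 17 a with ht
  have h' : HasInput A C t := h.setReg (by norm_num)
  have e1 : (nbE (.var 16) (.const 1)).eval t = b := by
    rw [h'.eval_nbE (v := c) (k := 1) (by simpa [Expr.eval, ht] using hc) rfl (by omega)]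
    simp [hab]
  rw [chainStepP, FProg.den, if_pos]
  · simp only [FProg.den, e0, ← ht, e1]
    have hcond : (Expr.eq (.var 17) (.var 15)).eval t ≠ 0 ↔ a = p := by
      rw [Expr.eq_ne]
      simp [Expr.eval, ht, hp, Fin.ext_iff]
    simp only [hcond]
    split_ifs <;> simp [Expr.eval, ht, hc]
  · rw [Expr.mul_ne, Expr.not_ne, Expr.eq_ne, h.eval_degE (e := .var 16) (v := c) hc]
    simp only [Expr.eval, hc, hf]
    exact ⟨hs, h2⟩

/-- Along the axis of the dart every step increases `f` by at least one, while `f` varies by at most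
`n`; hence the walk has stopped after `n` steps. -/
theorem chainP_spec (h : HasInput A C s) (hf : ∀ v : Fin n, s.arr 7 v ≠ 0 ↔ v ∈ C.support)
    (hD : IsGrid G {v | v ∈ C.support} W H x y) (hW : W ≤ n) (hH : H ≤ n) {v : Fin n} {k : ℕ}
    (hv : s.reg 8 = v) (hk : s.reg 9 = k) :
    (∀ hlt : k < (A.nbrs v).length, ∃ w : Fin n, (chainP.den s).arr 8 (4 * v + k) = w ∧
      IsChainEnd A {v | v ∈ C.support} x y v (A.nbrs v)[k] w) ∧
    (∀ i ≠ 4 * (v : ℕ) + k, (chainP.den s).arr 8 i = s.arr 8 i) := by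
  have hcond : (Expr.lt (.var 9) (degE (.var 8))).eval s ≠ 0 ↔ k < (A.nbrs v).length := by
    rw [Expr.lt_ne, h.eval_degE (e := .var 8) (v := v) hv]
    simp [Expr.eval, hk]
  rw [chainP, FProg.den]
  by_cases hlt : k < (A.nbrs v).length
  swap
  · rw [if_neg (hcond.not.2 hlt)]
    exact ⟨fun h => (hlt h).elim, fun _ _ => rfl⟩
  rw [if_pos (hcond.2 hlt)]
  have huv : G.Adj v (A.nbrs v)[k] := (A.mem_nbrs _ _).1 (List.getElem_mem hlt)
  obtain ⟨f, g, hax, hg, hlt', line⟩ := hD.exists_axis hW hH huv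
  simp only [FProg.den_seq, FProg.den_assign, FProg.den_write, Expr.eval, hv]
  set t0 := s.setReg 15 v with ht0
  have ht0' : HasInput A C t0 := h.setReg (by norm_num)
  have e0 : (nbE (.var 8) (.var 9)).eval t0 = (A.nbrs v)[k] :=
    ht0'.eval_nbE (by simpa [Expr.eval, ht0] using hv) (by simpa [Expr.eval, ht0] using hk) hlt
  rw [e0]
  set t1 := t0.setReg 16 ((A.nbrs v)[k] : Fin n) with ht1
  -- After `m` rounds the walk has stopped or has advanced by at least `m + 1`; the extra one is the
  -- dart itself, traversed before the loop. The previous vertex `p` is kept behind `c` on the same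
  -- line, so that the next step goes straight on.
  have key := FProg.den_loop (x := 14) (lim := none) (P := chainStepP) (n := n)
    (Inv := fun m t => HasInput A C t ∧ ∃ p c : Fin n, t.reg 15 = p ∧ t.reg 16 = c ∧ G.Adj c p ∧
      g p = g c ∧ f p < f c ∧ g c = g v ∧ f v < f c ∧
      ((c ∈ C.support ∨ (A.nbrs c).length ≠ 2) ∨ (m : ℤ) + 1 ≤ f c - f v))
    (s := t1) (by simpa [ht1, ht0] using h.size)
    ⟨(ht0'.setReg (by norm_num)).setReg (by norm_num), v, (A.nbrs v)[k], by simp [ht1, ht0],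
      by simp [ht1], huv.symm, hg, hlt', hg.symm, hlt', .inr (by push_cast; omega)⟩
    (by
      rintro m - t - hreg harr ⟨hin, p, c, hp, hc, hcp, hg1, hf1, hg2, hf2, hst⟩
      have hin' : HasInput A C ((chainStepP.den t).setReg 14 (m + 1)) :=
        (hin.den chainStepP (by decide) (by decide) (by decide)).setReg (by norm_num)
      have hft : ∀ v : Fin n, t.arr 7 v ≠ 0 ↔ v ∈ C.support := by
        rw [harr 7 (by decide)]
        exact hf
      refine ⟨hin', ?_⟩
      by_cases hend : c ∈ C.support ∨ (A.nbrs c).length ≠ 2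
      · refine ⟨p, c, ?_, ?_, hcp, hg1, hf1, hg2, hf2, .inl hend⟩
        · rw [hin.chainStepP_at_end hft hc hend]; simpa using hp
        · rw [hin.chainStepP_at_end hft hc hend]; simpa using hc
      · push Not at hend
        obtain ⟨a, b, hab⟩ := List.length_eq_two.1 hend.2
        obtain ⟨q, hq, h1, h2, h3⟩ := hax.step A (v := c) (p := p) hend.1 hcp hg1 hf1 hab
        obtain ⟨r1, r2⟩ := hin.chainStepP_go hft hp hc hend.1 hab
        rw [← hq] at r2
        have := hst.resolve_left (by tauto)
        exact ⟨c, q, by simpa using r1, by simpa using r2, h1.symm, h2.symm, h3,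
          h2.trans hg2, by omega, .inr (by push_cast; omega)⟩)
  obtain ⟨-, p, c, -, hc, -, -, -, hgc, hfc, hst⟩ := key
  set t2 := (FProg.loop 14 none chainStepP).den t1 with ht2
  have r8 : t2.reg 8 = v := by
    rw [ht2, FProg.den_reg _ (by decide)]
    simpa [ht1, ht0] using hv
  have r9 : t2.reg 9 = k := by
    rw [ht2, FProg.den_reg _ (by decide)]
    simpa [ht1, ht0] using hk
  have b8 : t2.arr 8 = s.arr 8 := by
    rw [ht2, FProg.den_arr _ (by decide)]
    rfl
  simp only [State.setArr_arr, r8, r9, b8, hc]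
  refine ⟨fun _ => ⟨c, by simp, ?_, line c hgc hfc⟩, fun i hi => by simp [hi]⟩
  refine hst.resolve_right fun h' => ?_
  have := hax.bounded c v
  simp only [limVal] at h'
  omega

/-- The vertex `T (4 * v + k)` is the end of the chain that starts with dart `k` of `v`. -/
def _root_.UERRF.HasChainEnds (A : AdjLists G) (S : Set (Fin n)) (x y : Fin n → ℕ) (T : ℕ → ℕ)
    (v : Fin n) (l : ℕ) : Prop :=
  ∀ k < l, ∀ hk : k < (A.nbrs v).length, ∃ w : Fin n, T (4 * v + k) = w ∧
    IsChainEnd A S x y v (A.nbrs v)[k] w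

theorem _root_.UERRF.HasChainEnds.congr {S : Set (Fin n)} {T T' : ℕ → ℕ} {v : Fin n} {l : ℕ}
    (h : HasChainEnds A S x y T v l) (hT : ∀ k < l, T' (4 * v + k) = T (4 * v + k)) :
    HasChainEnds A S x y T' v l := by
  intro k hk hk'
  rw [hT k hk]
  exact h k hk hk'

theorem chainP_loop_spec (h : HasInput A C s) (hf : ∀ v : Fin n, s.arr 7 v ≠ 0 ↔ v ∈ C.support)
    (hD : IsGrid G {v | v ∈ C.support} W H x y) (hW : W ≤ n) (hH : H ≤ n) {v : Fin n}
    (hv : s.reg 8 = v) :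
    HasChainEnds A {v | v ∈ C.support} x y (((FProg.loop 9 (some 4) chainP).den s).arr 8) v 4 ∧
      ∀ i < 4 * (v : ℕ), ((FProg.loop 9 (some 4) chainP).den s).arr 8 i = s.arr 8 i := by
  refine FProg.den_loop (x := 9) (lim := some 4) (P := chainP) (n := n)
    (Inv := fun l t => HasChainEnds A {v | v ∈ C.support} x y (t.arr 8) v l ∧
      ∀ i < 4 * (v : ℕ), t.arr 8 i = s.arr 8 i) (s := s) h.size
    ⟨fun k hk => (Nat.not_lt_zero _ hk).elim, fun _ _ => rfl⟩ ?_
  rintro l - t htl hreg harr ⟨h1, h2⟩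
  have ht : HasInput A C t := h.congr (hreg 0 (by decide) (by decide))
    (hreg 1 (by decide) (by decide)) fun a hlt => harr a (by revert a; decide)
  have hft : ∀ v : Fin n, t.arr 7 v ≠ 0 ↔ v ∈ C.support := by
    rw [harr 7 (by decide)]
    exact hf
  obtain ⟨p1, p2⟩ := ht.chainP_spec hft hD hW hH ((hreg 8 (by decide) (by decide)).trans hv) htl
  rw [State.setReg_arr]
  refine ⟨fun k hk hk' => ?_, fun i hi => ?_⟩
  · rcases Nat.lt_succ_iff_lt_or_eq.1 hk with hlt | rfl
    · rw [p2 _ (by omega)]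
      exact h1 k hlt hk'
    · exact p1 hk'
  · rw [p2 _ (by omega)]
    exact h2 i hi

/-- For every dart, array `8` contains the end of its chain. -/
theorem chainsP_spec (h : HasInput A C s) (hf : ∀ v : Fin n, s.arr 7 v ≠ 0 ↔ v ∈ C.support)
    (hD : IsGrid G {v | v ∈ C.support} W H x y) (hW : W ≤ n) (hH : H ≤ n) (v : Fin n) :
    HasChainEnds A {v | v ∈ C.support} x y ((chainsP.den s).arr 8) v 4 := by
  refine FProg.den_loop (x := 8) (lim := none) (P := .loop 9 (some 4) chainP) (n := n)
    (Inv := fun m t => ∀ v : Fin n, v < m →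
      HasChainEnds A {v | v ∈ C.support} x y (t.arr 8) v 4) (s := s) h.size
    (fun v hv => (Nat.not_lt_zero _ hv).elim) ?_ v v.2
  intro m hm t htm hreg harr hinv v hv
  have ht : HasInput A C t := h.congr (hreg 0 (by decide) (by decide))
    (hreg 1 (by decide) (by decide)) fun a hlt => harr a (by revert a; decide)
  have hft : ∀ v : Fin n, t.arr 7 v ≠ 0 ↔ v ∈ C.support := by
    rw [harr 7 (by decide)]
    exact hf
  obtain ⟨p1, p2⟩ := ht.chainP_loop_spec hft hD hW hH (v := ⟨m, hm⟩) htm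
  rw [State.setReg_arr]
  rcases Nat.lt_succ_iff_lt_or_eq.1 hv with hlt | hEq
  · exact (hinv v hlt).congr fun k hk => p2 _ (by simp only; omega)
  · rwa [show v = ⟨m, hm⟩ from Fin.ext hEq]

end HasInput

end UERRF

/-! ### The sweep that places the inner vertices. -/

namespace UERRF

open Set WordRAM

variable {n : ℕ} {G : SimpleGraph (Fin n)} {A : AdjLists G} {r : Fin n} {C : G.Walk r r}
  {s : State} {W H : ℕ} {x y : Fin n → ℕ}

/-- The memory at any moment during the sweep: the cycle is placed, and the ends of all chains are
known. -/
structure IsReady (A : AdjLists G) (C : G.Walk r r) (W H : ℕ) (x y : Fin n → ℕ) (s : State) :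
    Prop where
  input : HasInput A C s
  placed : IsPlaced C W H x y s
  chains : ∀ v, HasChainEnds A {v | v ∈ C.support} x y (s.arr 8) v 4
  start : s.reg 2 < C.length
  perimeter : 2 * (W + H) = C.length
  boundary : ∀ i < 2 * (W + H), x (cyc C (s.reg 2) (s.reg 4) i) = boundaryX W H i ∧
    y (cyc C (s.reg 2) (s.reg 4) i) = boundaryY W H i

namespace IsReady

theorem congr (h : IsReady A C W H x y s) {s' : State} (hr : ∀ x < 6, s'.reg x = s.reg x)
    (ha : ∀ a < 9, a ≠ 5 → a ≠ 6 → s'.arr a = s.arr a)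
    (h5 : ∀ v ∈ C.support, coord s' 5 v = coord s 5 v)
    (h6 : ∀ v ∈ C.support, coord s' 6 v = coord s 6 v) : IsReady A C W H x y s' where
  input := h.input.congr (hr 0 (by omega)) (hr 1 (by omega))
    fun a _ => ha a (by omega) (by omega) (by omega)
  placed := {
    width := (hr 3 (by omega)).trans h.placed.width
    height := (hr 5 (by omega)).trans h.placed.height
    flag := by rw [ha 7 (by omega) (by omega) (by omega)]; exact h.placed.flag
    x_mem := fun v hv => (h5 v hv).trans (h.placed.x_mem v hv)
    y_mem := fun v hv => (h6 v hv).trans (h.placed.y_mem v hv) }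
  chains := by rw [ha 8 (by omega) (by omega) (by omega)]; exact h.chains
  start := by rw [hr 2 (by omega)]; exact h.start
  perimeter := h.perimeter
  boundary := by rw [hr 2 (by omega), hr 4 (by omega)]; exact h.boundary

theorem setReg (h : IsReady A C W H x y s) {z k : ℕ} (hz : 6 ≤ z) :
    IsReady A C W H x y (s.setReg z k) :=
  h.congr (fun x hx => by simp; omega) (fun _ _ _ _ => rfl) (fun _ _ => rfl) fun _ _ => rfl

theorem eval_vertE (h : IsReady A C W H x y s) (hd : ∀ v, (A.nbrs v).length ≤ 4) {e f g : Expr}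
    {w : Fin n} {i j : ℕ} (he : e.eval s = w) (hf : f.eval s = i) (hg : g.eval s = j) :
    (vertE e f g).eval s ≠ 0 ↔ LooksVertical A {v | v ∈ C.support} H x y w i j := by
  simp only [vertE, Expr.add_ne, Expr.mul_ne, Expr.not_ne]
  rw [h.input.eval_anyNbE he (hd w) (P := fun c => c ∈ C.support ∧
    (((y c = 0 ∨ y c = H) ∧ x c = i) ∨ (¬ (y c = 0 ∨ y c = H) ∧ y c ≠ j)))]
  · simp only [Expr.eq_ne]
    simp only [Expr.eval, xE, he, hf, h.placed.flag, LooksVertical]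
    refine or_congr (and_congr_right fun hw => ?_) Iff.rfl
    rw [← h.placed.x_mem w hw, coord]
  · intro e' u hu
    simp only [Expr.add_ne, Expr.mul_ne, Expr.not_ne, Expr.eq_ne]
    simp only [Expr.eval, xE, yE, hu, hf, hg, h.placed.flag, h.placed.height]
    refine and_congr_right fun hw => ?_
    rw [← h.placed.x_mem u hw, ← h.placed.y_mem u hw, coord, coord]

end IsReady

/-- The labels that have been computed after looking at the first `l` darts of a vertex. -/
def IsPartialLabel (A : AdjLists G) (x y : Fin n → ℕ) (v : Fin n) (l m : ℕ) : Prop :=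
  (m = 0 ∧ ∀ k < l, ∀ hk : k < (A.nbrs v).length, y (A.nbrs v)[k] = y v →
    ¬ x v < x (A.nbrs v)[k]) ∨
  ∃ u, G.Adj v u ∧ y u = y v ∧ x v < x u ∧ m = (u : ℕ) + 1

theorem IsPartialLabel.succ {v : Fin n} {l m m' : ℕ} (h : IsPartialLabel A x y v l m)
    (h0 : ¬ l < (A.nbrs v).length → m' = m)
    (h1 : ∀ hl : l < (A.nbrs v).length,
      (y (A.nbrs v)[l] = y v ∧ x v < x (A.nbrs v)[l] → m' = ((A.nbrs v)[l] : Fin n) + 1) ∧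
      (¬ (y (A.nbrs v)[l] = y v ∧ x v < x (A.nbrs v)[l]) → m' = m)) :
    IsPartialLabel A x y v (l + 1) m' := by
  by_cases hl : l < (A.nbrs v).length
  · by_cases hc : y (A.nbrs v)[l] = y v ∧ x v < x (A.nbrs v)[l]
    · exact .inr ⟨_, (A.mem_nbrs _ _).1 (List.getElem_mem hl), hc.1, hc.2, (h1 hl).1 hc⟩
    · rw [(h1 hl).2 hc]
      rcases h with ⟨rfl, h⟩ | h
      · refine .inl ⟨rfl, fun k hk hk' => ?_⟩
        rcases Nat.lt_succ_iff_lt_or_eq.1 hk with hlt | rfl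
        · exact h k hlt hk'
        · exact fun e e' => hc ⟨e, e'⟩
      · exact .inr h
  · rw [h0 hl]
    rcases h with ⟨rfl, h⟩ | h
    · refine .inl ⟨rfl, fun k hk hk' => h k (by omega) hk'⟩
    · exact .inr h

theorem IsPartialLabel.isLabel {v : Fin n} {m : ℕ} {S : Set (Fin n)} (h : IsPartialLabel A x y v 4 m)
    (hd : (A.nbrs v).length ≤ 4) (hD : IsGrid G S W H x y) : IsLabel G x y (x v) (y v) m := by
  refine hD.isLabel_of_vertex ?_
  rcases h with ⟨rfl, h⟩ | h
  · refine .inl ⟨rfl, fun u hu => ?_⟩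
    obtain ⟨k, hk, rfl⟩ := List.getElem_of_mem ((A.mem_nbrs _ _).2 hu)
    exact h k (by omega) hk
  · exact .inr h

/-- Hypotheses about the graph and the drawing that is looked for. -/
structure IsTarget (A : AdjLists G) (C : G.Walk r r) (W H : ℕ) (x y : Fin n → ℕ) : Prop where
  grid : IsGrid G {v | v ∈ C.support} W H x y
  deg : ∀ v, (A.nbrs v).length ≤ 4
  inner : ∀ v : ({v | v ∈ C.support}ᶜ : Set (Fin n)),
    ((G.induce {v | v ∈ C.support}ᶜ).neighborSet v).ncard ≤ 2

/-- The chain end decides between horizontal and vertical. The sign comes from comparing stored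
coordinates; `hx` and `hy` say that this comparison is correct even if the neighbour holds only
default values. -/
theorem IsReady.dartP_spec (h : IsReady A C W H x y s) (hD : IsTarget A C W H x y) {v : Fin n}
    {k : ℕ} (h6 : s.reg 6 = x v) (h7 : s.reg 7 = y v) (h8 : s.reg 8 = v) (h9 : s.reg 9 = k)
    (hk4 : k < 4)
    (hx : ∀ u, G.Adj v u → y u = y v → (x v < coord s 5 u ↔ x v < x u))
    (hy : ∀ u, G.Adj v u → x u = x v → (y v < coord s 6 u ↔ y v < y u))
    (h12 : IsPartialLabel A x y v k (s.reg 12)) (h13 : IsPartialLabel A y x v k (s.reg 13)) :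
    IsPartialLabel A x y v (k + 1) ((dartP.den s).reg 12) ∧
      IsPartialLabel A y x v (k + 1) ((dartP.den s).reg 13) := by
  have hcond : (Expr.lt (.var 9) (degE (.var 8))).eval s ≠ 0 ↔ k < (A.nbrs v).length := by
    rw [Expr.lt_ne, h.input.eval_degE (e := .var 8) (v := v) h8]
    simp [Expr.eval, h9]
  rw [dartP, FProg.den]
  by_cases hk : k < (A.nbrs v).length
  swap
  · rw [if_neg (hcond.not.2 hk)]
    exact ⟨h12.succ (fun _ => rfl) fun h => (hk h).elim, h13.succ (fun _ => rfl) fun h => (hk h).elim⟩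
  rw [if_pos (hcond.2 hk)]
  have huv : G.Adj v (A.nbrs v)[k] := (A.mem_nbrs _ _).1 (List.getElem_mem hk)
  rw [FProg.den_seq, FProg.den_assign,
    h.input.eval_nbE (e := .var 8) (f := .var 9) (v := v) (k := k) h8 h9 hk]
  obtain ⟨w, hw, hend⟩ := h.chains v k hk4 hk
  set u := (A.nbrs v)[k] with hu
  set t := s.setReg 18 u with ht
  have htr : IsReady A C W H x y t := h.setReg (by norm_num)
  have hv : (vertE (.read 8 (.add (.mul (.const 4) (.var 8)) (.var 9))) (.var 6) (.var 7)).eval t ≠ 0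
      ↔ x u = x v := by
    rw [htr.eval_vertE hD.deg (w := w) (i := x v) (j := y v), hD.grid.looksVertical_iff A hD.inner hend]
    · simpa [Expr.eval, ht, h8, h9] using hw
    · simpa [Expr.eval, ht] using h6
    · simpa [Expr.eval, ht] using h7
  have hne : ¬ (x v = x u ∧ y v = y u) := fun e => huv.ne (hD.grid.injective _ _ e.1 e.2)
  rw [FProg.den]
  by_cases hxu : x u = x v
  · rw [if_pos (hv.2 hxu)]
    have hyc : (Expr.lt (.var 7) (yE (.var 18))).eval t ≠ 0 ↔ y v < y u := by
      rw [Expr.lt_ne, ← hy u huv hxu]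
      simp [Expr.eval, yE, ht, h7, coord]
    rw [FProg.den]
    by_cases hyu : y v < y u
    · rw [if_pos (hyc.2 hyu)]
      refine ⟨h12.succ (fun h => (h hk).elim) fun _ => ⟨fun e => by rw [← hu] at e; omega, fun _ => ?_⟩,
        h13.succ (fun h => (h hk).elim) fun _ => ⟨fun e => ?_, fun e => (e ⟨hxu, hyu⟩).elim⟩⟩
      · simp [FProg.den, ht]
      · simp [FProg.den, ht, Expr.eval, hu]
    · rw [if_neg (hyc.not.2 hyu)]
      refine ⟨h12.succ (fun h => (h hk).elim) fun _ => ⟨fun e => by rw [← hu] at e; omega, fun _ => ?_⟩,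
        h13.succ (fun h => (h hk).elim) fun _ => ⟨fun e => (hyu e.2).elim, fun e => ?_⟩⟩
      · simp [FProg.den, ht]
      · simp [FProg.den, ht]
  · rw [if_neg (hv.not.2 hxu)]
    have hyu : y u = y v := ((hD.grid.aligned v u huv).resolve_left fun e => hxu e.symm).symm
    have hxc : (Expr.lt (.var 6) (xE (.var 18))).eval t ≠ 0 ↔ x v < x u := by
      rw [Expr.lt_ne, ← hx u huv hyu]
      simp [Expr.eval, xE, ht, h6, coord]
    rw [FProg.den]
    by_cases hlt : x v < x u
    · rw [if_pos (hxc.2 hlt)]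
      refine ⟨h12.succ (fun h => (h hk).elim) fun _ => ⟨fun e => ?_, fun e => (e ⟨hyu, hlt⟩).elim⟩,
        h13.succ (fun h => (h hk).elim) fun _ => ⟨fun e => (hxu e.1).elim, fun _ => ?_⟩⟩
      · simp [FProg.den, ht, Expr.eval, hu]
      · simp [FProg.den, ht]
    · rw [if_neg (hxc.not.2 hlt)]
      refine ⟨h12.succ (fun h => (h hk).elim) fun _ => ⟨fun e => (hlt e.2).elim, fun e => ?_⟩,
        h13.succ (fun h => (h hk).elim) fun _ => ⟨fun e => (hxu e.1).elim, fun _ => ?_⟩⟩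
      · simp [FProg.den, ht]
      · simp [FProg.den, ht]

/-- The sweep has reached the point `(i, j)`. -/
structure IsSwept (C : G.Walk r r) (W H : ℕ) (x y : Fin n → ℕ) (i j : ℕ) (s : State) : Prop where
  x_eq : ∀ v ∉ C.support,
    coord s 5 v = if y v < j ∨ (y v = j ∧ x v < i) then x v else W
  y_eq : ∀ v ∉ C.support,
    coord s 6 v = if y v < j ∨ (y v = j ∧ x v < i) then y v else H
  left : 0 < i → IsLabel G x y (i - 1) j (s.reg 10)
  below : ∀ k < W, (k < i → IsLabel G y x j k (s.arr 9 k)) ∧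
    (i ≤ k → 0 < j → IsLabel G y x (j - 1) k (s.arr 9 k))

/-- Vertices in the bottom row and the left column are read off the cycle. Every other point swept
has both a left and a lower label, and `IsGrid.which` applies. -/
theorem IsReady.whichP_spec (h : IsReady A C W H x y s) (hD : IsTarget A C W H x y) {i j : ℕ}
    (h6 : s.reg 6 = i) (h7 : s.reg 7 = j) (hi : i < W) (hj : j < H)
    (hs : IsSwept C W H x y i j s) : ∃ z, whichP.den s = s.setReg 11 z ∧
      ((∃ v : Fin n, x v = i ∧ y v = j ∧ z = (v : ℕ) + 1) ∨
        (∀ v, ¬ (x v = i ∧ y v = j)) ∧ z = 0 ∧ 0 < i ∧ 0 < j) := by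
  have hm := h.perimeter
  have c7 : (Expr.eq (.var 7) (.const 0)).eval s ≠ 0 ↔ j = 0 := by
    rw [Expr.eq_ne]; simp [Expr.eval, h7]
  have c6 : (Expr.eq (.var 6) (.const 0)).eval s ≠ 0 ↔ i = 0 := by
    rw [Expr.eq_ne]; simp [Expr.eval, h6]
  have c10 : (Expr.eq (.var 10) (.const 0)).eval s ≠ 0 ↔ s.reg 10 = 0 := by
    rw [Expr.eq_ne]; simp [Expr.eval]
  have c9 : (Expr.add (.eq (.read 9 (.var 6)) (.const 0))
      (.eq (.read 9 (.var 6)) (.var 10))).eval s ≠ 0 ↔ s.arr 9 i = 0 ∨ s.arr 9 i = s.reg 10 := by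
    rw [Expr.add_ne, Expr.eq_ne, Expr.eq_ne]; simp [Expr.eval, h6]
  rw [whichP]
  simp only [FProg.den, c7, c6, c10, c9]
  by_cases hj0 : j = 0
  · subst hj0
    rw [if_pos rfl]
    refine ⟨_, rfl, .inl ⟨cyc C (s.reg 2) (s.reg 4) i, ?_, ?_, ?_⟩⟩
    · rw [(h.boundary i (by omega)).1, boundaryX, if_pos hi.le]
    · rw [(h.boundary i (by omega)).2, boundaryY, if_pos hi.le]
    · have := h.input.eval_cycE h.start (e := .var 6) (by simp only [Expr.eval]; omega)
      rw [Expr.eval, this]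
      simp [Expr.eval, h6]
  rw [if_neg hj0]
  by_cases hi0 : i = 0
  · subst hi0
    rw [if_pos rfl]
    refine ⟨_, rfl, .inl ⟨cyc C (s.reg 2) (s.reg 4) (C.length - j), ?_, ?_, ?_⟩⟩
    · rw [(h.boundary _ (by omega)).1, boundaryX]
      split_ifs <;> omega
    · rw [(h.boundary _ (by omega)).2, boundaryY]
      split_ifs <;> omega
    · have := h.input.eval_cycE h.start (e := .sub (.var 1) (.var 7))
        (by simp only [Expr.eval, h.input.length]; omega)
      rw [Expr.eval, this]
      simp [Expr.eval, h7, h.input.length]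
  rw [if_neg hi0]
  obtain ⟨i, rfl⟩ := Nat.exists_eq_succ_of_ne_zero hi0
  obtain ⟨j, rfl⟩ := Nat.exists_eq_succ_of_ne_zero hj0
  refine ⟨if s.reg 10 = 0 then s.arr 9 (i + 1) else
    if s.arr 9 (i + 1) = 0 ∨ s.arr 9 (i + 1) = s.reg 10 then s.reg 10 else 0, ?_, ?_⟩
  · simp only [Nat.succ_eq_add_one]
    split_ifs <;> simp [Expr.eval, h6]
  · rcases hD.grid.which hi hj (hs.left (by omega))
      ((hs.below (i + 1) hi).2 le_rfl (by omega)) with H | H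
    · exact .inl H
    · exact .inr ⟨H.1, H.2, by omega, by omega⟩

theorem IsReady.dartP_loop_spec (h : IsReady A C W H x y s) (hD : IsTarget A C W H x y) {v : Fin n}
    (h6 : s.reg 6 = x v) (h7 : s.reg 7 = y v) (h8 : s.reg 8 = v)
    (hx : ∀ u, G.Adj v u → y u = y v → (x v < coord s 5 u ↔ x v < x u))
    (hy : ∀ u, G.Adj v u → x u = x v → (y v < coord s 6 u ↔ y v < y u))
    (h12 : s.reg 12 = 0) (h13 : s.reg 13 = 0) :
    IsLabel G x y (x v) (y v) (((FProg.loop 9 (some 4) dartP).den s).reg 12) ∧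
      IsLabel G y x (y v) (x v) (((FProg.loop 9 (some 4) dartP).den s).reg 13) := by
  have key := FProg.den_loop (x := 9) (lim := some 4) (P := dartP) (n := n)
    (Inv := fun l t => IsPartialLabel A x y v l (t.reg 12) ∧ IsPartialLabel A y x v l (t.reg 13))
    (s := s) h.input.size
    ⟨.inl ⟨by simpa using h12, fun k hk => (Nat.not_lt_zero _ hk).elim⟩,
      .inl ⟨by simpa using h13, fun k hk => (Nat.not_lt_zero _ hk).elim⟩⟩
    (by
      rintro l hl t htl hreg harr ⟨i1, i2⟩
      have harr' : ∀ a, t.arr a = s.arr a := fun a => harr a (by simp [dartP, FProg.arrs])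
      have ht : IsReady A C W H x y t := h.congr
        (fun z hz => hreg z (by omega) (by simp [dartP, FProg.regs]; omega))
        (fun a _ _ _ => harr' a) (fun v _ => by rw [coord, harr', coord])
        fun v _ => by rw [coord, harr', coord]
      have := ht.dartP_spec hD ((hreg 6 (by decide) (by decide)).trans h6)
        ((hreg 7 (by decide) (by decide)).trans h7) ((hreg 8 (by decide) (by decide)).trans h8) htl hl
        (fun u => by rw [coord, harr']; exact hx u) (fun u => by rw [coord, harr']; exact hy u) i1 i2
      simpa using this)
  exact ⟨key.1.isLabel (hD.deg v) hD.grid, key.2.isLabel (hD.deg v) hD.grid.swap⟩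

theorem IsReady.pointP_spec (h : IsReady A C W H x y s) (hD : IsTarget A C W H x y) {i j : ℕ}
    (h6 : s.reg 6 = i) (h7 : s.reg 7 = j) (hi : i < W) (hj : j < H)
    (hs : IsSwept C W H x y i j s) :
    IsReady A C W H x y (pointP.den s) ∧ IsSwept C W H x y (i + 1) j (pointP.den s) := by
  obtain ⟨z, hz, hzv⟩ := h.whichP_spec hD h6 h7 hi hj hs
  rw [pointP, FProg.den_seq, hz, FProg.den]
  have e11 : (Expr.var 11).eval (s.setReg 11 z) = z := by simp [Expr.eval]
  rw [e11]
  rcases hzv with ⟨v, hxv, hyv, rfl⟩ | ⟨hno, rfl, hi0, hj0⟩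
  swap
  · rw [if_neg (not_not_intro rfl)]
    have hcond : ∀ v, (y v < j ∨ (y v = j ∧ x v < i + 1)) ↔ (y v < j ∨ (y v = j ∧ x v < i)) := by
      intro v
      have := hno v
      omega
    refine ⟨h.setReg (by norm_num), ⟨fun v hv => ?_, fun v hv => ?_, fun _ => ?_, fun k hk => ?_⟩⟩
    · simp only [hcond]
      exact hs.x_eq v hv
    · simp only [hcond]
      exact hs.y_eq v hv
    · have := (hs.left hi0).next (fun v => by
        rw [Nat.sub_add_cancel hi0]
        exact hno v)
      rw [Nat.sub_add_cancel hi0] at this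
      simpa [FProg.den] using this
    · refine ⟨fun hlt => ?_, fun hle => (hs.below k hk).2 (by omega)⟩
      rcases Nat.lt_succ_iff_lt_or_eq.1 hlt with hlt | rfl
      · exact (hs.below k hk).1 hlt
      · have := ((hs.below k hk).2 le_rfl hj0).next (fun v => by
          rw [Nat.sub_add_cancel hj0]
          exact fun e => hno v e.symm)
        rw [Nat.sub_add_cancel hj0] at this
        exact this
  rw [if_pos (Nat.succ_ne_zero _)]
  subst hxv hyv
  have e8 : (Expr.sub (.var 11) (.const 1)).eval (s.setReg 11 ((v : ℕ) + 1)) = v := by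
    simp [Expr.eval]
  rw [FProg.den_seq, FProg.den_assign, e8]
  set t1 := (s.setReg 11 ((v : ℕ) + 1)).setReg 8 v with ht1
  have f6 : (Expr.var 6).eval t1 = x v := by simp [Expr.eval, ht1, h6]
  have f8 : (Expr.var 8).eval t1 = v := by simp [Expr.eval, ht1]
  rw [FProg.den_seq, FProg.den_write, f6, f8]
  set t2 := t1.setArr 5 v (x v) with ht2
  have g7 : (Expr.var 7).eval t2 = y v := by simp [Expr.eval, ht2, ht1, h7]
  have g8 : (Expr.var 8).eval t2 = v := by simp [Expr.eval, ht2, ht1]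
  rw [FProg.den_seq, FProg.den_write, g7, g8, FProg.den_seq, FProg.den_assign, FProg.den_seq,
    FProg.den_assign, FProg.den_seq]
  simp only [Expr.eval]
  set t3 := ((t2.setArr 6 v (y v)).setReg 12 0).setReg 13 0 with ht3
  have a5 : ∀ u : Fin n, coord t3 5 u = if u = v then x v else coord s 5 u := by
    intro u
    simp [coord, ht3, ht2, ht1, Fin.ext_iff]
  have a6 : ∀ u : Fin n, coord t3 6 u = if u = v then y v else coord s 6 u := by
    intro u
    simp [coord, ht3, ht2, ht1, Fin.ext_iff]
  have a9 : ∀ k, t3.arr 9 k = s.arr 9 k := by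
    intro k
    simp [ht3, ht2, ht1]
  have r3 : ∀ z < 8, t3.reg z = s.reg z := by
    intro z hz
    simp only [ht3, ht2, ht1, State.setReg_reg, State.setArr_reg]
    rw [if_neg (by omega), if_neg (by omega), if_neg (by omega), if_neg (by omega)]
  have ready3 : IsReady A C W H x y t3 := by
    refine h.congr (fun z hz => r3 z (by omega)) (fun a ha h5 h6 => ?_) (fun u hu => ?_)
      fun u hu => ?_
    · rw [ht3, ht2, ht1, State.setReg_arr, State.setReg_arr, State.setArr_arr_of_ne _ _ _ h6,
        State.setArr_arr_of_ne _ _ _ h5]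
      rfl
    · rw [a5]
      split_ifs with huv
      · rw [huv, h.placed.x_mem v (huv ▸ hu)]
      · rfl
    · rw [a6]
      split_ifs with huv
      · rw [huv, h.placed.y_mem v (huv ▸ hu)]
      · rfl
  obtain ⟨l1, l2⟩ := ready3.dartP_loop_spec hD (v := v) ((r3 6 (by omega)).trans h6)
    ((r3 7 (by omega)).trans h7) (by simp [ht3, ht2, ht1])
    -- A neighbour in the row of `v` is already placed if it is to the left. An inner neighbour to
    -- the right still has the default abscissa `W`, which exceeds that of `v`, and the comparison
    -- gives the same answer as the true position. The argument for columns is analogous.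
    (fun u hu hyu => by
      rw [a5, if_neg hu.ne']
      have : ¬ x v = x u := fun e => hu.ne (hD.grid.injective v u e hyu.symm)
      by_cases hus : u ∈ C.support
      · rw [h.placed.x_mem u hus]
      · rw [hs.x_eq u hus]
        split_ifs <;> omega)
    (fun u hu hxu => by
      rw [a6, if_neg hu.ne']
      have : ¬ y v = y u := fun e => hu.ne (hD.grid.injective v u hxu.symm e)
      by_cases hus : u ∈ C.support
      · rw [h.placed.y_mem u hus]
      · rw [hs.y_eq u hus]
        split_ifs <;> omega) (by simp [ht3]) (by simp [ht3])
  set t4 := (FProg.loop 9 (some 4) dartP).den t3 with ht4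
  have b4 : t4.arr = t3.arr := funext fun a =>
    FProg.den_arr _ (by simp [dartP, FProg.arrs]) _
  have r4 : ∀ z < 8, t4.reg z = s.reg z := fun z hz =>
    (FProg.den_reg _ (by simp [dartP, FProg.regs]; omega) _).trans (r3 z hz)
  have ready4 : IsReady A C W H x y t4 := ready3.congr
    (fun z hz => (r4 z (by omega)).trans (r3 z (by omega)).symm) (fun a _ _ _ => by rw [b4])
    (fun u _ => by rw [coord, b4, coord]) fun u _ => by rw [coord, b4, coord]
  have hcond : ∀ u, u ≠ v →
      ((y u < y v ∨ (y u = y v ∧ x u < x v + 1)) ↔ (y u < y v ∨ (y u = y v ∧ x u < x v))) := by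
    intro u hu
    have : ¬ (x u = x v ∧ y u = y v) := fun e => hu (hD.grid.injective u v e.1 e.2)
    omega
  simp only [FProg.den_seq, FProg.den_assign, FProg.den_write, Expr.eval, State.setReg_reg]
  norm_num [r4 6, h6]
  refine ⟨ready4.congr (fun z hz => by simp; omega) (fun a ha _ _ => by
      rw [State.setArr_arr_of_ne _ _ _ (by omega)]; rfl) (fun u _ => by simp [coord])
      (fun u _ => by simp [coord]), ⟨fun u hu => ?_, fun u hu => ?_, fun _ => ?_, fun k hk => ?_⟩⟩
  · have : coord ((t4.setReg 10 (t4.reg 12)).setArr 9 (x v) (t4.reg 13)) 5 u = coord t3 5 u := by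
      simp [coord, b4]
    rw [this, a5]
    by_cases huv : u = v
    · subst huv; simp
    · simp only [if_neg huv, hcond u huv]
      exact hs.x_eq u hu
  · have : coord ((t4.setReg 10 (t4.reg 12)).setArr 9 (x v) (t4.reg 13)) 6 u = coord t3 6 u := by
      simp [coord, b4]
    rw [this, a6]
    by_cases huv : u = v
    · subst huv; simp
    · simp only [if_neg huv, hcond u huv]
      exact hs.y_eq u hu
  · simpa using l1
  · simp only [State.setArr_arr, true_and, State.setReg_arr, b4, a9]
    by_cases hkx : k = x v
    · subst hkx
      simpa using l2
    · rw [if_neg hkx]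
      exact ⟨fun hlt => (hs.below k hk).1 (by omega), fun hle => (hs.below k hk).2 (by omega)⟩

/-- The sweep finds the positions of all vertices. -/
theorem IsReady.sweepP_spec (h : IsReady A C W H x y s) (hD : IsTarget A C W H x y)
    (hW : W ≤ n) (hH : H ≤ n) (hx : ∀ v ∉ C.support, coord s 5 v = W)
    (hy : ∀ v ∉ C.support, coord s 6 v = H) :
    IsReady A C W H x y (sweepP.den s) ∧
      ∀ v, coord (sweepP.den s) 5 v = x v ∧ coord (sweepP.den s) 6 v = y v := by
  have key := FProg.den_loop (x := 7) (lim := none) (P := .ite (.lt (.var 7) (.var 5))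
    (.loop 6 none (.ite (.lt (.var 6) (.var 3)) pointP .skip)) .skip) (n := n)
    -- The loops always run `n` rounds, but rows from `H` on and columns from `W` on are skipped;
    -- the minima express that nothing changes there.
    (Inv := fun j t => IsReady A C W H x y t ∧ IsSwept C W H x y 0 (min j H) t) (s := s)
    h.input.size ⟨h.setReg (by norm_num), by
      rw [Nat.zero_min]
      exact ⟨fun v hv => by simpa [coord] using hx v hv,
        fun v hv => by simpa [coord] using hy v hv,
        fun h => (Nat.lt_irrefl _ h).elim,
        fun k _ => ⟨fun h => (Nat.not_lt_zero _ h).elim, fun _ h => (Nat.lt_irrefl _ h).elim⟩⟩⟩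
    (by
      rintro j - t htj - - ⟨hr, hs⟩
      suffices hsuf : ∀ t' : State, t' = (FProg.ite (.lt (.var 7) (.var 5))
          (.loop 6 none (.ite (.lt (.var 6) (.var 3)) pointP .skip)) .skip).den t →
          IsReady A C W H x y t' ∧ IsSwept C W H x y 0 (min (j + 1) H) t' by
        obtain ⟨h1, h2⟩ := hsuf _ rfl
        exact ⟨h1.setReg (by norm_num), ⟨h2.x_eq, h2.y_eq, fun h => (Nat.lt_irrefl _ h).elim,
          h2.below⟩⟩
      rintro t' rfl
      have hcond : (Expr.lt (.var 7) (.var 5)).eval t ≠ 0 ↔ j < H := by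
        rw [Expr.lt_ne]; simp [Expr.eval, htj, hr.placed.height]
      rw [FProg.den]
      by_cases hj : j < H
      swap
      · rw [if_neg (hcond.not.2 hj)]
        rw [min_eq_right (by omega)] at hs ⊢
        exact ⟨hr, hs⟩
      rw [if_pos (hcond.2 hj), min_eq_left (by omega)]
      rw [min_eq_left (by omega)] at hs
      have inner := FProg.den_loop (x := 6) (lim := none)
        (P := .ite (.lt (.var 6) (.var 3)) pointP .skip) (n := n)
        (Inv := fun i t => IsReady A C W H x y t ∧ IsSwept C W H x y (min i W) j t) (s := t)
        hr.input.size ⟨hr.setReg (by norm_num), by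
          rw [Nat.zero_min]
          exact ⟨hs.x_eq, hs.y_eq, fun h => (Nat.lt_irrefl _ h).elim, hs.below⟩⟩
        (by
          rintro i - t' hti hreg - ⟨hr', hs'⟩
          have htj' : t'.reg 7 = j := (hreg 7 (by decide) (by decide)).trans htj
          suffices hsuf : ∀ t'' : State, t'' = (FProg.ite (.lt (.var 6) (.var 3)) pointP .skip).den t' →
              IsReady A C W H x y t'' ∧ IsSwept C W H x y (min (i + 1) W) j t'' by
            obtain ⟨h1, h2⟩ := hsuf _ rfl
            exact ⟨h1.setReg (by norm_num), ⟨h2.x_eq, h2.y_eq, fun h => by simpa using h2.left h,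
              h2.below⟩⟩
          rintro t'' rfl
          have hcond : (Expr.lt (.var 6) (.var 3)).eval t' ≠ 0 ↔ i < W := by
            rw [Expr.lt_ne]; simp [Expr.eval, hti, hr'.placed.width]
          rw [FProg.den]
          by_cases hi : i < W
          · rw [if_pos (hcond.2 hi), min_eq_left (by omega)]
            rw [min_eq_left (by omega)] at hs'
            exact hr'.pointP_spec hD hti htj' hi hj hs'
          · rw [if_neg (hcond.not.2 hi)]
            rw [min_eq_right (by omega)] at hs' ⊢
            exact ⟨hr', hs'⟩)
      obtain ⟨h1, h2⟩ := inner
      simp only [limVal, min_eq_right hW] at h2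
      -- Inner vertices have abscissae strictly between `0` and `W`, so the end of a row is the
      -- beginning of the next one. The labels of the segments above row `j` become the labels below
      -- row `j + 1`.
      have hcond : ∀ v ∉ C.support, (y v < j + 1 ∨ (y v = j + 1 ∧ x v < 0)) ↔
          (y v < j ∨ (y v = j ∧ x v < W)) := by
        intro v hv
        have h1 := hD.grid.mem_iff v
        have h2 := hD.grid.le_W v
        have h3 : ¬ ((x v = 0 ∨ x v = W) ∨ y v = 0 ∨ y v = H) := h1.not.1 hv
        omega
      exact ⟨h1, ⟨fun v hv => by simpa only [hcond v hv] using h2.x_eq v hv,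
        fun v hv => by simpa only [hcond v hv] using h2.y_eq v hv,
        fun h => (Nat.lt_irrefl _ h).elim,
        fun k hk => ⟨fun h => (Nat.not_lt_zero _ h).elim, fun _ _ => (h2.below k hk).1 hk⟩⟩⟩)
  obtain ⟨h1, h2⟩ := key
  simp only [limVal, min_eq_right hH] at h2
  refine ⟨h1, fun v => ?_⟩
  by_cases hv : v ∈ C.support
  · exact ⟨h1.placed.x_mem v hv, h1.placed.y_mem v hv⟩
  · have hlt : y v < H := by
      have h1 := hD.grid.mem_iff v
      have h2 := hD.grid.le_H v
      have h3 : ¬ ((x v = 0 ∨ x v = W) ∨ y v = 0 ∨ y v = H) := h1.not.1 hv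
      omega
    constructor
    · have := h2.x_eq v hv
      rwa [if_pos (.inl hlt)] at this
    · have := h2.y_eq v hv
      rwa [if_pos (.inl hlt)] at this

end UERRF

/-! ### A single trial: soundness and completeness. -/

namespace UERRF

open Set WordRAM

variable {n : ℕ} {G : SimpleGraph (Fin n)} {A : AdjLists G} {r : Fin n} {C : G.Walk r r}
  {k : Fin 4 → Fin n} {rot corners : Bool} {s : State} {W H : ℕ} {x y : Fin n → ℕ}

/-- A drawing with all required properties in the rectangle `[0, W] × [0, H]`, in which the cycle
begins at position `s` in the lower left corner and has orientation `o`. -/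
structure IsSolution (A : AdjLists G) (C : G.Walk r r) (k : Fin 4 → Fin n) (rot corners : Bool)
    (s o W H : ℕ) (x y : Fin n → ℕ) : Prop where
  start : s < C.length
  perimeter : 2 * (W + H) = C.length
  grid : IsGridDrawing G (cyc C s o) W H (natDrawing x y)
  deg : ∀ v, (A.nbrs v).length ≤ 4
  corner : corners = true → ∀ i, (x (k i) = 0 ∨ x (k i) = W) ∧ (y (k i) = 0 ∨ y (k i) = H)
  rotation : rot = true → PreservesRotation (natDrawing x y) A

/-- The hypotheses on the input. -/
structure IsInstance (C : G.Walk r r) (k : Fin 4 → Fin n) (corners : Bool) : Prop where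
  cycle : C.IsCycle
  inner : IsInnerTwoGraph G C
  injective : corners = true → Function.Injective k

theorem IsInstance.length_le (hC : IsInstance C k corners) : C.length ≤ n := length_le_of_isCycle hC.cycle

/-- The memory contains the input, including the prescribed corners. -/
structure HasFullInput (A : AdjLists G) (C : G.Walk r r) (k : Fin 4 → Fin n) (corners : Bool)
    (s : State) : Prop extends HasInput A C s where
  corner : corners = true → ∀ i : Fin 4, s.arr 4 i = k i

theorem HasFullInput.den (h : HasFullInput A C k corners s) (P : FProg) (h0 : 0 ∉ P.regs)
    (h1 : 1 ∉ P.regs) (ha : ∀ a < 5, a ∉ P.arrs) : HasFullInput A C k corners (P.den s) where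
  toHasInput := h.toHasInput.den P h0 h1 fun a hlt => ha a (by omega)
  corner := by rw [P.den_arr (ha 4 (by norm_num))]; exact h.corner

theorem HasFullInput.setReg (h : HasFullInput A C k corners s) {z l : ℕ} (hz : 2 ≤ z) :
    HasFullInput A C k corners (s.setReg z l) :=
  ⟨h.toHasInput.setReg hz, h.corner⟩

/-- Verification of the drawing that has been found. -/
def verifyP (rot corners : Bool) : FProg :=
  .seq paintP (.seq (.write 13 (.const 0) (.const 0)) ((checkS rot corners).comp 13))

theorem HasFullInput.paintP_spec (h : HasFullInput A C k corners s) :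
    (∀ a, a ≠ 10 → a ≠ 11 → (paintP.den s).arr a = s.arr a) ∧
    ((∀ v, (A.nbrs v).length ≤ 4) → ∀ x < n, ∀ z < n, ((paintP.den s).arr 10 (x * n + z) ≠ 0 ↔
      ∃ p q, G.Adj p q ∧ coord s 5 p = x ∧ coord s 5 q = x ∧ coord s 6 p < z ∧ z < coord s 6 q)) ∧
    ((∀ v, (A.nbrs v).length ≤ 4) → ∀ x < n, ∀ z < n, ((paintP.den s).arr 11 (x * n + z) ≠ 0 ↔
      ∃ p q, G.Adj p q ∧ coord s 6 p = x ∧ coord s 6 q = x ∧ coord s 5 p < z ∧ z < coord s 5 q)) := by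
  rw [paintP, FProg.den_seq, FProg.den_seq, FProg.den_seq]
  obtain ⟨b1, p1⟩ := h.paint (a := 5) (b := 6) (c := 10) (by omega) (by decide) (by decide)
    (by omega)
  have h1 : HasInput A C (((paintS 5 6).comp 10).den ((clearS.comp 10).den s)) :=
    (h.toHasInput.den (clearS.comp 10) (by decide) (by decide)
    (by decide)).den ((paintS 5 6).comp 10) (by decide) (by decide) (by decide)
  generalize ((paintS 5 6).comp 10).den ((clearS.comp 10).den s) = t at *
  obtain ⟨b2, p2⟩ := h1.paint (a := 6) (b := 5) (c := 11) (by omega) (by decide) (by decide)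
    (by omega)
  generalize ((paintS 6 5).comp 11).den ((clearS.comp 11).den t) = t' at *
  have e5 : (coord t 5 : Fin n → ℕ) = coord s 5 := funext fun v => by
    rw [coord, b1 5 (by norm_num), coord]
  have e6 : (coord t 6 : Fin n → ℕ) = coord s 6 := funext fun v => by
    rw [coord, b1 6 (by norm_num), coord]
  refine ⟨fun a h10 h11 => (b2 a h11).trans (b1 a h10), ?_, ?_⟩
  · rw [b2 10 (by norm_num)]
    exact p1
  · rw [e5, e6] at p2
    exact p2

theorem verifyP_regs (rot corners : Bool) : ∀ z < 6, z ∉ (verifyP rot corners).regs := by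
  cases rot <;> cases corners <;> decide

theorem verifyP_arrs (rot corners : Bool) : ∀ a < 10, a ∉ (verifyP rot corners).arrs := by
  cases rot <;> cases corners <;> decide

/-- The flag is cleared before the checks, and they can only set it to one; so it stays zero exactly
if all of them succeed, whatever was stored as coordinates. -/
theorem HasFullInput.verifyP_iff (h : HasFullInput A C k corners s) (hC : IsInstance C k corners) :
    ((verifyP rot corners).den s).arr 13 0 = 0 ↔
      IsSolution A C k rot corners (s.reg 2) (s.reg 4) (s.reg 3) (s.reg 5) (coord s 5)
        (coord s 6) := by
  rw [verifyP, FProg.den_seq, FProg.den_seq, FProg.den_write]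
  have r1 : ∀ z < 6, (paintP.den s).reg z = s.reg z := fun z hz => FProg.den_reg _ (by
    simp [paintP, clearS, paintS, Scan.comp, FProg.regs]; omega) _
  obtain ⟨b1, hV, hH⟩ := h.paintP_spec
  have h1 : HasFullInput A C k corners (paintP.den s) :=
    h.den paintP (by decide) (by decide) (by decide)
  generalize paintP.den s = t at *
  simp only [Expr.eval]
  have b2 : ∀ a ≠ 13, (t.setArr 13 0 0).arr a = t.arr a :=
    fun a ha => State.setArr_arr_of_ne _ _ _ ha
  have r2 : ∀ z < 6, (t.setArr 13 0 0).reg z = s.reg z := r1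
  have z2 : (t.setArr 13 0 0).arr 13 0 = 0 := by simp
  have h2 : HasFullInput A C k corners (t.setArr 13 0 0) :=
    ⟨h1.toHasInput.congr rfl rfl fun a ha => b2 a (by omega), h1.corner⟩
  generalize t.setArr 13 0 0 = t' at *
  have c5 : (coord t' 5 : Fin n → ℕ) = coord s 5 := funext fun v => by
    rw [coord, b2 5 (by norm_num), b1 5 (by norm_num) (by norm_num), coord]
  have c6 : (coord t' 6 : Fin n → ℕ) = coord s 6 := funext fun v => by
    rw [coord, b2 6 (by norm_num), b1 6 (by norm_num) (by norm_num), coord]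
  obtain ⟨-, -, c4⟩ := Scan.comp_spec _ (checkS_within rot corners) t'
  have quiet : (((checkS rot corners).comp 13).den t').arr 13 0 = 0 ↔
      Scan.Quiet t' (checkS rot corners) := by
    rcases c4 0 with ⟨w, hw, e⟩ | ⟨hw, e⟩
    · have := (Scan.hit_of_isCheck (checkS_isCheck rot corners) hw).2
      exact iff_of_false (by omega) fun hq => hq _ _ hw
    · refine iff_of_true (by rw [e, z2]) fun j w hj => ?_
      obtain ⟨rfl, -⟩ := Scan.hit_of_isCheck (checkS_isCheck rot corners) hj
      exact hw _ hj
  rw [quiet, h2.toHasInput.quiet_checkS hC.length_le (k := k) _ _ h2.corner]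
  · rw [r2 2 (by omega), r2 3 (by omega), r2 4 (by omega), r2 5 (by omega), c5, c6]
    exact ⟨fun ⟨a, b, c, d, e, f⟩ => ⟨a, b, c, d, e, f⟩, fun ⟨a, b, c, d, e, f⟩ => ⟨a, b, c, d, e, f⟩⟩
  · rw [b2 10 (by norm_num), c5, c6]
    exact hV
  · rw [b2 11 (by norm_num), c5, c6]
    exact hH

/-- The failure flag says whether a solution has been found. -/
theorem HasFullInput.coreP_iff (h : HasFullInput A C k corners s) (hC : IsInstance C k corners) :
    ((coreP rot corners).den s).arr 13 0 = 0 ↔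
      IsSolution A C k rot corners (((coreP rot corners).den s).reg 2)
        (((coreP rot corners).den s).reg 4) (((coreP rot corners).den s).reg 3)
        (((coreP rot corners).den s).reg 5) (coord ((coreP rot corners).den s) 5)
        (coord ((coreP rot corners).den s) 6) := by
  have e : (coreP rot corners).den s =
      (verifyP rot corners).den (sweepP.den (chainsP.den (placeP.den (heightP.den s)))) := rfl
  have h0 : HasFullInput A C k corners (sweepP.den (chainsP.den (placeP.den (heightP.den s)))) :=
    (((h.den heightP (by decide) (by decide) (by decide)).den placeP (by decide) (by decide)
      (by decide)).den chainsP (by decide) (by decide) (by decide)).den sweepP (by decide) (by decide)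
      (by decide)
  rw [e]
  -- Soundness holds for any state before the verification; nothing about the sweep is used beyond
  -- preservation of the input.
  generalize sweepP.den (chainsP.den (placeP.den (heightP.den s))) = t at *
  have c : ∀ a < 10, (coord ((verifyP rot corners).den t) a : Fin n → ℕ) = coord t a :=
    fun a ha => funext fun v => by rw [coord, FProg.den_arr _ (verifyP_arrs rot corners a ha), coord]
  have r := fun z hz => FProg.den_reg _ (verifyP_regs rot corners z hz) t
  rw [h0.verifyP_iff hC, r 2 (by omega), r 3 (by omega), r 4 (by omega), r 5 (by omega),
    c 5 (by omega), c 6 (by omega)]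

/-- If there is a solution with the current parameters then one is found. -/
theorem HasFullInput.coreP_complete (h : HasFullInput A C k corners s) (hC : IsInstance C k corners)
    (hs : IsSolution A C k rot corners (s.reg 2) (s.reg 4) (s.reg 3) H x y) :
    ((coreP rot corners).den s).arr 13 0 = 0 := by
  rw [h.coreP_iff hC]
  have hn := hC.length_le
  have hper := hs.perimeter
  have hwh := isGridDrawing_natDrawing.1 hs.grid
  have hgrid : IsGrid G {v | v ∈ C.support} (s.reg 3) H x y := hs.grid.isGrid fun v => by
    rw [hper]
    exact mem_support_iff_cyc hs.start
  have htarget : IsTarget A C (s.reg 3) H x y := ⟨hgrid, hs.deg, hC.inner⟩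
  set t1 := heightP.den s with ht1
  have h1 : HasFullInput A C k corners t1 := h.den heightP (by decide) (by decide) (by decide)
  have r1 : ∀ z < 5, t1.reg z = s.reg z := fun z hz =>
    FProg.den_reg _ (by simp [heightP, Scan.comp, FProg.regs]; omega) _
  have h5 : t1.reg 5 = H := h.heightP_spec (by have := hwh.2.1; omega) hper
  obtain ⟨p1, p2, p3⟩ := h1.placeP_spec hn (by rw [r1 2 (by omega)]; exact hs.start)
    (r1 3 (by omega)) h5 hper (x := x) (y := y)
    (by rw [r1 2 (by omega), r1 4 (by omega)]; exact hs.grid)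
  set t2 := placeP.den t1 with ht2
  have h2 : HasFullInput A C k corners t2 := h1.den placeP (by decide) (by decide) (by decide)
  have r2 : ∀ z < 5, t2.reg z = s.reg z := fun z hz => (FProg.den_reg _ (by
    simp [placeP, resetP, onCycleP, Scan.comp, FProg.regs]; omega) _).trans (r1 z hz)
  have c3 := h2.chainsP_spec p1.flag hgrid (by omega) (by omega)
  set t3 := chainsP.den t2 with ht3
  have h3 : HasFullInput A C k corners t3 := h2.den chainsP (by decide) (by decide) (by decide)
  have r3 : ∀ z < 6, t3.reg z = t2.reg z := fun z hz => FProg.den_reg _ (by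
    simp [chainsP, chainP, chainStepP, FProg.regs]; omega) _
  have b3 : ∀ a ≠ 8, t3.arr a = t2.arr a := fun a ha => FProg.den_arr _ (by
    simp [chainsP, chainP, chainStepP, FProg.arrs]; omega) _
  have ready : IsReady A C (s.reg 3) H x y t3 :=
    { input := h3.toHasInput
      placed := {
        width := (r3 3 (by omega)).trans p1.width
        height := (r3 5 (by omega)).trans p1.height
        flag := by rw [b3 7 (by omega)]; exact p1.flag
        x_mem := fun v hv => by rw [coord, b3 5 (by omega)]; exact p1.x_mem v hv
        y_mem := fun v hv => by rw [coord, b3 6 (by omega)]; exact p1.y_mem v hv }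
      chains := c3
      start := by rw [r3 2 (by omega), r2 2 (by omega)]; exact hs.start
      perimeter := hper
      boundary := by
        rw [r3 2 (by omega), r2 2 (by omega), r3 4 (by omega), r2 4 (by omega)]
        exact hwh.2.2.2.2.2.1 }
  -- The sweep reproduces the coordinates of the given solution, whatever they are; in particular
  -- the parameters determine the solution, and the verification accepts it.
  obtain ⟨-, hxy⟩ := ready.sweepP_spec htarget (by omega) (by omega)
    (fun v hv => by rw [coord, b3 5 (by omega)]; exact p2 v hv)
    (fun v hv => by rw [coord, b3 6 (by omega)]; exact p3 v hv)
  have hden : (coreP rot corners).den s = (verifyP rot corners).den (sweepP.den t3) := rfl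
  have r5 : ∀ z < 6, (sweepP.den t3).reg z = t3.reg z := fun z hz => FProg.den_reg _ (by
    simp [sweepP, pointP, whichP, dartP, FProg.regs]; omega) _
  have r6 : ∀ z < 6, ((coreP rot corners).den s).reg z = t2.reg z := fun z hz => by
    rw [hden, FProg.den_reg _ (verifyP_regs rot corners z hz), r5 z hz, r3 z hz]
  have ex : (coord ((coreP rot corners).den s) 5 : Fin n → ℕ) = x := funext fun v => by
    rw [hden, coord, FProg.den_arr _ (verifyP_arrs rot corners 5 (by omega))]
    exact (hxy v).1
  have ey : (coord ((coreP rot corners).den s) 6 : Fin n → ℕ) = y := funext fun v => by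
    rw [hden, coord, FProg.den_arr _ (verifyP_arrs rot corners 6 (by omega))]
    exact (hxy v).2
  rw [ex, ey, r6 2 (by omega), r6 3 (by omega), r6 4 (by omega), r6 5 (by omega), r2 2 (by omega),
    r2 3 (by omega), r2 4 (by omega), p1.height]
  exact hs

end UERRF

/-! ### The search over start, width and orientation, and the theorem. -/

namespace UERRF

open Set WordRAM

variable {n : ℕ} {G : SimpleGraph (Fin n)} {A : AdjLists G} {r : Fin n} {C : G.Walk r r}
  {k : Fin 4 → Fin n} {rot corners : Bool} {s : State}

/-- A drawing as required; prescribed corners and the rotation system are optional. -/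
def IsValid (A : AdjLists G) (C : G.Walk r r) (k : Fin 4 → Fin n) (rot corners : Bool)
    (D : Drawing (Fin n)) : Prop :=
  IsUERRF G D ∧ HasExternalCycle G D C ∧ (corners = true → HasCorners G D k) ∧
    (rot = true → PreservesRotation D A)

theorem PreservesRotation.shift {V : Type*} {G : SimpleGraph V} {A : AdjLists G} {D : Drawing V}
    (h : PreservesRotation D A) (a c : ℤ) : PreservesRotation (shift a c D) A := by
  simpa [PreservesRotation, UERRF.shift, direction] using h

theorem IsSolution.isValid {p o W H : ℕ} {x y : Fin n → ℕ}
    (h : IsSolution A C k rot corners p o W H x y) (hC : IsInstance C k corners) :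
    IsValid A C k rot corners (natDrawing x y) := by
  have hβ : IsClosedSeq G (cyc C p o) (2 * (W + H)) := h.perimeter ▸ cyc_isClosedSeq h.start
  refine ⟨h.grid.isUERRF hβ, h.grid.hasExternalCycle hβ fun e => ?_,
    fun hc => h.grid.hasCorners hβ (hC.injective hc) ?_, h.rotation⟩
  · rw [h.perimeter]
    exact cyc_edges h.start e
  · simpa [natDrawing] using h.corner hc

/-- The normalised drawing has nonnegative coordinates, and its degrees are bounded by the lattice
conditions. The lower corners are the boundary points with indices `0` and `W`, which is how
prescribed corners determine start and width. -/
theorem IsValid.exists_isSolution {D : Drawing (Fin n)} (h : IsValid A C k rot corners D)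
    (hC : IsInstance C k corners) : ∃ (p o W H : ℕ) (x y : Fin n → ℕ), o < 2 ∧
      IsSolution A C k rot corners p o W H x y ∧
      (corners = true → ∃ a b, cyc C p o 0 = k a ∧ cyc C p o W = k b) := by
  obtain ⟨h1, h2, h3, h4⟩ := h
  obtain ⟨a, c, W, H, p, o, hp, ho, hm, hgrid, hF⟩ := h1.exists_gridDrawing hC.cycle h2
  have hxy : natDrawing (fun v => ((shift a c D) v).1.toNat) (fun v => ((shift a c D) v).2.toNat) =
      shift a c D := by
    funext v
    obtain ⟨e1, -, e2, -⟩ := hgrid.inside v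
    exact Prod.ext (Int.toNat_of_nonneg e1) (Int.toNat_of_nonneg e2)
  refine ⟨p, o, W, H, _, _, ho, ⟨hp, hm, hxy ▸ hgrid, hgrid.length_nbrs_le A, fun hc i => ?_,
    fun hr => hxy ▸ (h4 hr).shift a c⟩, fun hc => ?_⟩
  · have := ((h3 hc).shift h1 hgrid.W_pos hgrid.H_pos hF).1 i
    omega
  · obtain ⟨-, ⟨i, hi⟩, j, hj⟩ := (h3 hc).shift h1 hgrid.W_pos hgrid.H_pos hF
    have hW := hgrid.W_pos
    refine ⟨i, j, hgrid.injective ?_, hgrid.injective ?_⟩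
    · rw [hi, hgrid.boundary 0 (by omega)]
      simp [boundaryX, boundaryY]
    · rw [hj, hgrid.boundary W (by omega)]
      simp [boundaryX, boundaryY]

/-- Register `30` says whether a valid drawing has been found; if not, then `N` holds. -/
structure IsSearched (A : AdjLists G) (C : G.Walk r r) (k : Fin 4 → Fin n) (rot corners : Bool)
    (N : Prop) (s : State) : Prop where
  input : HasFullInput A C k corners s
  result : (s.reg 30 = 1 ∧ IsValid A C k rot corners (natDrawing (coord s 5) (coord s 6))) ∨
    (s.reg 30 = 0 ∧ N)

theorem IsSearched.setReg {N : Prop} (h : IsSearched A C k rot corners N s) {z l : ℕ} (hz : 2 ≤ z)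
    (hz' : z ≠ 30) : IsSearched A C k rot corners N (s.setReg z l) :=
  ⟨h.input.setReg hz, by
    rw [State.setReg_reg, if_neg hz'.symm]
    exact h.result⟩

theorem IsSearched.mono {N N' : Prop} (h : IsSearched A C k rot corners N s) (hN : N → N') :
    IsSearched A C k rot corners N' s :=
  ⟨h.input, h.result.imp_right fun e => ⟨e.1, hN e.2⟩⟩

/-- Searching through the values of a loop counter. -/
theorem IsSearched.loop {z : ℕ} {lim : Option ℕ} {P : FProg} {Q : ℕ → Prop} {N : Prop}
    (hz : 2 ≤ z) (hz' : z ≠ 30) (h : IsSearched A C k rot corners N s)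
    (hstep : ∀ l < limVal n lim, ∀ t : State, t.reg z = l →
      (∀ y, y ≠ z → y ∉ P.regs → t.reg y = s.reg y) → ∀ N : Prop,
      IsSearched A C k rot corners N t → IsSearched A C k rot corners (N ∧ Q l) (P.den t)) :
    IsSearched A C k rot corners (N ∧ ∀ l < limVal n lim, Q l) ((FProg.loop z lim P).den s) :=
  FProg.den_loop (Inv := fun m t => IsSearched A C k rot corners (N ∧ ∀ l < m, Q l) t)
    h.input.size ((h.setReg hz hz').mono fun hN => ⟨hN, fun l hl => (Nat.not_lt_zero l hl).elim⟩)
    fun m hm t htm hreg _ hinv => ((hstep m hm t htm hreg _ hinv).setReg hz hz').mono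
      fun ⟨⟨hN, hQ⟩, hm⟩ => ⟨hN, fun l hl => (Nat.lt_succ_iff_lt_or_eq.1 hl).elim (hQ l)
        fun e => e ▸ hm⟩

theorem coreP_regs (rot corners : Bool) : ∀ z, z < 5 ∨ 30 ≤ z → z ∉ (coreP rot corners).regs := by
  have h : ∀ z ∈ (coreP rot corners).regs, 5 ≤ z ∧ z < 30 := by
    cases rot <;> cases corners <;> decide
  intro z hz hz'
  have := h z hz'
  omega

theorem coreP_arrs (rot corners : Bool) : ∀ a < 5, a ∉ (coreP rot corners).arrs := by
  cases rot <;> cases corners <;> decide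

/-- One step of the search. -/
theorem IsSearched.tryP {pre : FProg} {N Q : Prop} (hC : IsInstance C k corners)
    (h : IsSearched A C k rot corners N s) (hregs : ∀ z ∈ pre.regs, 2 ≤ z ∧ z ≠ 30)
    (harrs : ∀ a < 5, a ∉ pre.arrs)
    (hQ : (∀ H x y, ¬ IsSolution A C k rot corners ((pre.den s).reg 2) ((pre.den s).reg 4)
      ((pre.den s).reg 3) H x y) → Q) :
    IsSearched A C k rot corners (N ∧ Q) ((tryP pre rot corners).den s) := by
  have cond : (Expr.eq (.var 30) (.const 0)).eval s ≠ 0 ↔ s.reg 30 = 0 := by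
    rw [Expr.eq_ne]; simp [Expr.eval]
  rw [UERRF.tryP, FProg.den]
  rcases h.result with ⟨h30, hv⟩ | ⟨h30, hN⟩
  · rw [if_neg (cond.not.2 (by omega))]
    exact ⟨h.input, .inl ⟨h30, hv⟩⟩
  rw [if_pos (cond.2 h30), FProg.den_seq, FProg.den_seq]
  have h1 : HasFullInput A C k corners (pre.den s) := h.input.den pre
    (fun hz => by have := hregs 0 hz; omega) (fun hz => by have := hregs 1 hz; omega) harrs
  have r1 : (pre.den s).reg 30 = 0 := by
    rw [FProg.den_reg _ fun hz => (hregs 30 hz).2 rfl, h30]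
  generalize pre.den s = t at *
  have h2 : HasFullInput A C k corners ((coreP rot corners).den t) := h1.den (coreP rot corners)
    (coreP_regs rot corners 0 (by omega)) (coreP_regs rot corners 1 (by omega))
    (coreP_arrs rot corners)
  have r2 : ((coreP rot corners).den t).reg 30 = 0 :=
    (FProg.den_reg _ (coreP_regs rot corners 30 (by omega)) t).trans r1
  have hiff := h1.coreP_iff (rot := rot) hC
  have hcomp : ∀ H x y, IsSolution A C k rot corners (t.reg 2) (t.reg 4) (t.reg 3) H x y →
      ((coreP rot corners).den t).arr 13 0 = 0 := fun H x y => h1.coreP_complete hC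
  generalize (coreP rot corners).den t = t' at *
  have cond : (Expr.eq (.read 13 (.const 0)) (.const 0)).eval t' ≠ 0 ↔ t'.arr 13 0 = 0 := by
    rw [Expr.eq_ne]; simp [Expr.eval]
  rw [FProg.den]
  by_cases hf : t'.arr 13 0 = 0
  · rw [if_pos (cond.2 hf), FProg.den_assign]
    exact ⟨h2.setReg (by norm_num), .inl ⟨by simp [Expr.eval], (hiff.1 hf).isValid hC⟩⟩
  · rw [if_neg (cond.not.2 hf)]
    exact ⟨h2, .inr ⟨r2, hN, hQ fun H x y hs => hf (hcomp H x y hs)⟩⟩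

/-- In the end, the drawing that has been found is copied to the output. -/
theorem IsSearched.outputP (h : IsSearched A C k rot corners
    (¬ ∃ D, IsValid A C k rot corners D) s) :
    ((outputP.den s).reg 30 = 1 ∧ IsValid A C k rot corners (output n (outputP.den s))) ∨
      ((outputP.den s).reg 30 = 0 ∧ ¬ ∃ D, IsValid A C k rot corners D) := by
  have r : (UERRF.outputP.den s).reg 30 = s.reg 30 := FProg.den_reg _ (by decide) _
  rw [r]
  refine h.result.imp_left fun ⟨h30, hv⟩ => ⟨h30, ?_⟩
  have e : output n (UERRF.outputP.den s) = natDrawing (coord s 5) (coord s 6) := by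
    funext v
    rw [UERRF.outputP, FProg.den_seq]
    have b0 : ∀ a ≠ 0, ((resetP 0 (xE (.var 20))).den s).arr a = s.arr a := fun a ha =>
      FProg.den_arr _ (by simpa [resetP, Scan.comp, FProg.arrs] using ha) _
    have r0 : ((resetP 0 (xE (.var 20))).den s).reg 0 = n :=
      (FProg.den_reg _ (by decide) _).trans h.input.size
    have e0 := resetP_spec h.input.size (a := 0) (e := xE (.var 20)) (by decide) v
    generalize (resetP 0 (xE (.var 20))).den s = t at *
    have b1 : ((resetP 1 (yE (.var 20))).den t).arr 0 = t.arr 0 :=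
      FProg.den_arr _ (by decide) _
    have e1 := resetP_spec r0 (a := 1) (e := yE (.var 20)) (by decide) v
    simp only [output, b1, e0, e1]
    simp [xE, yE, Expr.eval, b0, natDrawing, coord]
  rw [e]
  exact hv

/-- Start and width of a solution are below `n`: the cycle has at most `n` vertices, and its length
is `2 * (W + H)` with positive `H`. So the loops meet every possible solution. -/
theorem IsSearched.freeP {N : Prop} (hC : IsInstance C k false)
    (h : IsSearched A C k rot false N s) :
    IsSearched A C k rot false (¬ ∃ D, IsValid A C k rot false D)
      ((FProg.loop 2 none (.loop 3 none (.loop 4 (some 2) (UERRF.tryP .skip rot false)))).den s) := by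
  have hr : ∀ z ∈ (UERRF.tryP .skip rot false).regs, 5 ≤ z := by cases rot <;> decide
  refine (h.loop (Q := fun p => ∀ W < n, ∀ o < 2, ∀ H x y,
    ¬ IsSolution A C k rot false p o W H x y) (by norm_num) (by norm_num) ?_).mono ?_
  · intro p _ t htp _ N hs
    refine hs.loop (z := 3) (lim := none) (Q := fun W => ∀ o < 2, ∀ H x y,
      ¬ IsSolution A C k rot false p o W H x y) (by norm_num) (by norm_num) ?_
    intro W _ t htW hreg N hs
    have htp := (hreg 2 (by norm_num) fun hz => by
      rcases List.mem_cons.1 hz with hz | hz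
      · omega
      · have := hr 2 hz; omega).trans htp
    refine hs.loop (z := 4) (lim := some 2) (Q := fun o => ∀ H x y,
      ¬ IsSolution A C k rot false p o W H x y) (by norm_num) (by norm_num) ?_
    intro o _ t hto hreg N hs
    have htp := (hreg 2 (by norm_num) fun hz => by have := hr 2 hz; omega).trans htp
    have htW := (hreg 3 (by norm_num) fun hz => by have := hr 3 hz; omega).trans htW
    refine hs.tryP hC (by simp [FProg.regs]) (by simp [FProg.arrs]) ?_
    rw [FProg.den, htp, htW, hto]
    exact id
  · rintro ⟨-, hno⟩ ⟨D, hD⟩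
    obtain ⟨p, o, W, H, x, y, ho, hsol, -⟩ := hD.exists_isSolution hC
    have := hC.length_le
    have := hsol.start
    have := hsol.perimeter
    have hH := hsol.grid.H_pos
    exact hno p (by simp only [limVal]; omega) W (by omega) o ho H x y hsol

/-- Start and width are determined by the two lower corners. -/
theorem HasFullInput.cornerP_spec (h : HasFullInput A C k true s) (hC : IsInstance C k true)
    {a b : Fin 4} (ha : s.reg 31 = a) (hb : s.reg 32 = b) {p W : ℕ} (hp : p < C.length)
    (hW : W < C.length) (hpa : cyc C p (s.reg 4) 0 = k a) (hWb : cyc C p (s.reg 4) W = k b) :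
    (cornerP.den s).reg 2 = p ∧ (cornerP.den s).reg 3 = W ∧
      (cornerP.den s).reg 4 = s.reg 4 := by
  have hn := hC.length_le
  have hw1 : (Scan.all 20 none (.put (.mul (.lt (.var 20) (.var 1))
      (.eq (.read 3 (.var 20)) (.read 4 (.var 31)))) (.const 0) (.var 20))).within 12
      [0, 1, 2, 3, 4, 5, 31, 32] = true := by decide
  have hw2 : (Scan.all 20 none (.put (.mul (.lt (.var 20) (.var 1))
        (.eq (cycE (.var 20)) (.read 4 (.var 32)))) (.const 0) (.var 20))).within 12
      [0, 1, 2, 3, 4, 5, 31, 32] = true := by decide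
  have r4 : (cornerP.den s).reg 4 = s.reg 4 := FProg.den_reg _ (by decide) _
  rw [r4]
  rw [cornerP, FProg.den_seq, FProg.den_seq, FProg.den_seq, FProg.den_assign, FProg.den_assign]
  -- In both orientations the walk begins at position `p`, so the first corner fixes `p`, as a cycle
  -- visits a vertex only once. The width is then the number of steps to the second corner in the
  -- given orientation.
  have hp0 : C.getVert p = k a := by
    rw [← hpa, cyc, cycIdx]
    congr 1
    split_ifs <;> omega
  obtain ⟨r1, b1, c1⟩ := Scan.comp_spec _ hw1 s
  have hit1 : ∀ w, Scan.Hit s (Scan.all 20 none (.put (.mul (.lt (.var 20) (.var 1))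
      (.eq (.read 3 (.var 20)) (.read 4 (.var 31)))) (.const 0) (.var 20))) 0 w ↔ w = p := by
    intro w
    simp only [Scan.Hit, limVal, h.size, Expr.mul_ne, Expr.lt_ne, Expr.eq_ne]
    simp only [Expr.eval, State.setReg_reg, State.setReg_arr, h.length]
    norm_num [ha, h.corner rfl]
    constructor
    · rintro ⟨-, hi, e⟩
      rw [h.cycle w hi] at e
      exact hC.cycle.getVert_injOn' (by simp only [mem_ofPred_eq]; omega)
        (by simp only [mem_ofPred_eq]; omega) ((Fin.ext e).trans hp0.symm)
    · rintro rfl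
      exact ⟨by omega, hp, by rw [h.cycle w hp, hp0]⟩
  have e1 : (((Scan.all 20 none (.put (.mul (.lt (.var 20) (.var 1))
      (.eq (.read 3 (.var 20)) (.read 4 (.var 31)))) (.const 0) (.var 20))).comp 12).den s).arr 12 0
      = p := by
    rcases c1 0 with ⟨w, hw, e⟩ | ⟨hw, -⟩
    · rw [e]; exact (hit1 w).1 hw
    · exact (hw p ((hit1 p).2 rfl)).elim
  have h1 : HasFullInput A C k true (((Scan.all 20 none (.put (.mul (.lt (.var 20) (.var 1))
      (.eq (.read 3 (.var 20)) (.read 4 (.var 31)))) (.const 0) (.var 20))).comp 12).den s) :=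
    h.den _ (by decide) (by decide) (by decide)
  generalize ((Scan.all 20 none (.put (.mul (.lt (.var 20) (.var 1))
      (.eq (.read 3 (.var 20)) (.read 4 (.var 31)))) (.const 0) (.var 20))).comp 12).den s = t at *
  have e1' : (Expr.read 12 (.const 0)).eval t = p := e1
  rw [e1']
  have h2 : HasFullInput A C k true (t.setReg 2 p) := h1.setReg (by norm_num)
  have g2 : (t.setReg 2 p).reg 2 = p := by simp
  have g4 : (t.setReg 2 p).reg 4 = s.reg 4 := by simpa using r1 4 (by simp)
  have g32 : (t.setReg 2 p).reg 32 = b := by simpa [hb] using r1 32 (by simp)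
  generalize t.setReg 2 p = t' at *
  obtain ⟨r2, b2, c2⟩ := Scan.comp_spec _ hw2 t'
  have hit2 : ∀ w, Scan.Hit t' (Scan.all 20 none (.put (.mul (.lt (.var 20) (.var 1))
        (.eq (cycE (.var 20)) (.read 4 (.var 32)))) (.const 0) (.var 20))) 0 w ↔ w = W := by
    intro w
    have hc : ∀ i < C.length, (cycE (.var 20)).eval (t'.setReg 20 i) =
        (cyc C p (s.reg 4) i : Fin n) := by
      intro i hi
      have := (h2.toHasInput.setReg (x := 20) (k := i) (by norm_num)).eval_cycE (e := .var 20)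
        (by simpa [g2] using hp) (by simpa [Expr.eval] using hi.le)
      rw [this]
      simp [Expr.eval, g2, g4]
    simp only [Scan.Hit, limVal, h2.size, Expr.mul_ne, Expr.lt_ne, Expr.eq_ne]
    constructor
    · rintro ⟨i, -, ⟨hi, e⟩, -, rfl⟩
      have hi : i < C.length := by simpa [Expr.eval, h2.length] using hi
      rw [hc i hi] at e
      have e : ((cyc C p (s.reg 4) i : Fin n) : ℕ) = k b := by
        simpa [Expr.eval, g32, h2.corner rfl] using e
      have := cyc_injOn hC.cycle hp hi hW ((Fin.ext e).trans hWb.symm)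
      simpa [Expr.eval] using this
    · rintro rfl
      refine ⟨w, by omega, ⟨by simpa [Expr.eval, h2.length] using hW, ?_⟩, rfl, by simp [Expr.eval]⟩
      rw [hc w hW, hWb]
      simp [Expr.eval, g32, h2.corner rfl]
  have e2 : (((Scan.all 20 none (.put (.mul (.lt (.var 20) (.var 1))
        (.eq (cycE (.var 20)) (.read 4 (.var 32)))) (.const 0) (.var 20))).comp 12).den t').arr 12 0
      = W := by
    rcases c2 0 with ⟨w, hw, e⟩ | ⟨hw, -⟩
    · rw [e]; exact (hit2 w).1 hw
    · exact (hw W ((hit2 W).2 rfl)).elim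
  refine ⟨?_, ?_, rfl⟩
  · simpa using (r2 2 (by simp)).trans g2
  · simpa [Expr.eval] using e2

/-- Every ordered pair of prescribed corners is tried as lower left and lower right corner, in both
orientations. The hypotheses under which a choice is refuted hold for the pair and orientation of an
actual drawing. -/
theorem IsSearched.cornersP {N : Prop} (hC : IsInstance C k true)
    (h : IsSearched A C k rot true N s) :
    IsSearched A C k rot true (¬ ∃ D, IsValid A C k rot true D)
      ((FProg.loop 31 (some 4) (.loop 32 (some 4) (.loop 4 (some 2)
        (UERRF.tryP cornerP rot true)))).den s) := by
  have hr : ∀ z ∈ (UERRF.tryP cornerP rot true).regs, z ≠ 4 ∧ z < 31 := by cases rot <;> decide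
  refine (h.loop (Q := fun a => ∀ b : ℕ, b < 4 → ∀ o < 2, ∀ p < C.length, ∀ W < C.length,
    ∀ a' b' : Fin 4, a = (a' : ℕ) → b = (b' : ℕ) → cyc C p o 0 = k a' → cyc C p o W = k b' → ∀ H x y,
    ¬ IsSolution A C k rot true p o W H x y) (by norm_num) (by norm_num) ?_).mono ?_
  · intro a _ t hta _ N hs
    refine hs.loop (z := 32) (lim := some 4) (Q := fun b => ∀ o < 2, ∀ p < C.length,
      ∀ W < C.length, ∀ a' b' : Fin 4, a = (a' : ℕ) → b = (b' : ℕ) → cyc C p o 0 = k a' →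
      cyc C p o W = k b' → ∀ H x y, ¬ IsSolution A C k rot true p o W H x y) (by norm_num) (by norm_num) ?_
    intro b _ t htb hreg N hs
    have hta := (hreg 31 (by norm_num) fun hz => by
      rcases List.mem_cons.1 hz with hz | hz
      · omega
      · have := hr 31 hz; omega).trans hta
    refine hs.loop (z := 4) (lim := some 2) (Q := fun o => ∀ p < C.length,
      ∀ W < C.length, ∀ a' b' : Fin 4, a = (a' : ℕ) → b = (b' : ℕ) → cyc C p o 0 = k a' →
      cyc C p o W = k b' → ∀ H x y, ¬ IsSolution A C k rot true p o W H x y) (by norm_num) (by norm_num) ?_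
    intro o _ t hto hreg N hs
    have hta := (hreg 31 (by norm_num) fun hz => by have := hr 31 hz; omega).trans hta
    have htb := (hreg 32 (by norm_num) fun hz => by have := hr 32 hz; omega).trans htb
    refine hs.tryP hC (by decide) (by decide) ?_
    intro hno p hp W hW a' b' haa hbb hpa hWb H x y hsol
    rw [haa] at hta
    rw [hbb] at htb
    obtain ⟨e1, e2, e3⟩ := hs.input.cornerP_spec hC hta htb hp hW (by rwa [hto]) (by rwa [hto])
    refine hno H x y ?_
    rwa [e1, e2, e3, hto]
  · rintro ⟨-, hno⟩ ⟨D, hD⟩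
    obtain ⟨p, o, W, H, x, y, ho, hsol, hab⟩ := hD.exists_isSolution hC
    obtain ⟨a, b, hpa, hWb⟩ := hab rfl
    have := hsol.perimeter
    have hH := hsol.grid.H_pos
    exact hno a a.2 b b.2 o ho p hsol.start W (by omega) a b rfl rfl hpa hWb H x y hsol

theorem hasFullInput_input (A : AdjLists G) (C : G.Walk r r) (k : Fin 4 → Fin n) :
    HasFullInput A C k true (input A C (List.ofFn k)) where
  toHasInput := hasInput_input A C _
  corner _ i := cell_eq (by rw [List.getElem?_eq_getElem (by simp), List.getElem_ofFn])

theorem solves_of_den {P : Prog} {B T : ℕ} {s' : State} {t : ℕ} {Valid : Drawing (Fin n) → Prop}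
    (hex : Exec B P s (s'.setReg 0 (s'.reg 30)) t) (ht : t ≤ T)
    (h : (s'.reg 30 = 1 ∧ Valid (output n s')) ∨ (s'.reg 30 = 0 ∧ ¬ ∃ D, Valid D)) :
    Solves P B T s Valid :=
  ⟨_, t, hex, ht, by rw [State.setReg_reg, if_pos rfl]; exact h⟩

theorem freeP_spec (hC : IsInstance C k false) (h : IsSearched A C k rot false True s) :
    (((freeP rot).den s).reg 30 = 1 ∧ IsValid A C k rot false (output n ((freeP rot).den s))) ∨
      (((freeP rot).den s).reg 30 = 0 ∧ ¬ ∃ D, IsValid A C k rot false D) := by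
  rw [freeP, FProg.den_seq]
  exact (h.freeP hC).outputP

theorem cornersP_spec (hC : IsInstance C k true) (h : IsSearched A C k rot true True s) :
    (((cornersP rot).den s).reg 30 = 1 ∧ IsValid A C k rot true (output n ((cornersP rot).den s))) ∨
      (((cornersP rot).den s).reg 30 = 0 ∧ ¬ ∃ D, IsValid A C k rot true D) := by
  rw [cornersP, FProg.den_seq]
  exact (h.cornersP hC).outputP

end UERRF

theorem theorem3 (rotationPrescribed : Bool) :
    (∃ (P : WordRAM.Prog) (K : ℕ),
      ∀ (n : ℕ) (G : SimpleGraph (Fin n)) (A : UERRF.AdjLists G) (r : Fin n) (C : G.Walk r r),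
        C.IsCycle → UERRF.IsInnerTwoGraph G C →
        ∀ k : Fin 4 → Fin n, Function.Injective k → (∀ i, k i ∈ C.support) →
          UERRF.Solves P (K * n ^ K) (K * n ^ 2) (UERRF.input A C (List.ofFn k))
            (fun D => UERRF.IsUERRF G D ∧ UERRF.HasExternalCycle G D C ∧ UERRF.HasCorners G D k ∧
              (rotationPrescribed = true → UERRF.PreservesRotation D A))) ∧
    (∃ (P : WordRAM.Prog) (K : ℕ),
      ∀ (n : ℕ) (G : SimpleGraph (Fin n)) (A : UERRF.AdjLists G) (r : Fin n) (C : G.Walk r r),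
        C.IsCycle → UERRF.IsInnerTwoGraph G C →
          UERRF.Solves P (K * n ^ K) (K * n ^ 4) (UERRF.input A C [])
            (fun D => UERRF.IsUERRF G D ∧ UERRF.HasExternalCycle G D C ∧
              (rotationPrescribed = true → UERRF.PreservesRotation D A))) := by
  constructor
  · obtain ⟨K, hK⟩ := WordRAM.FProg.exists_exec (UERRF.cornersP rotationPrescribed)
      (UERRF.cornersP_wf _) 30 (UERRF.cornersP_depth rotationPrescribed)
    -- During the run register `0` must hold `n`, so the answer is kept in register `30` and copied
    -- at the very end.
    refine ⟨.seq (UERRF.cornersP rotationPrescribed).toProg (.assign 0 (.var 30)), K,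
      fun n G A r C hC hin k hk _ => ?_⟩
    obtain ⟨t, ht, hex⟩ := hK n r.pos (UERRF.input A C (List.ofFn k)) rfl
      (UERRF.input_boundedBy A C hC _)
    have hs : UERRF.IsSearched A C k rotationPrescribed true True
        (UERRF.input A C (List.ofFn k)) :=
      ⟨UERRF.hasFullInput_input A C k, .inr ⟨rfl, trivial⟩⟩
    convert UERRF.solves_of_den hex ht (UERRF.cornersP_spec ⟨hC, hin, fun _ => hk⟩ hs) using 2
    simp [UERRF.IsValid]
  · obtain ⟨K, hK⟩ := WordRAM.FProg.exists_exec (UERRF.freeP rotationPrescribed)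
      (UERRF.freeP_wf _) 30 (UERRF.freeP_depth rotationPrescribed)
    refine ⟨.seq (UERRF.freeP rotationPrescribed).toProg (.assign 0 (.var 30)), K,
      fun n G A r C hC hin => ?_⟩
    obtain ⟨t, ht, hex⟩ := hK n r.pos (UERRF.input A C []) rfl
      (UERRF.input_boundedBy A C hC _)
    have hs : UERRF.IsSearched A C (fun _ => r) rotationPrescribed false True
        (UERRF.input A C []) :=
      ⟨⟨UERRF.hasInput_input A C _, fun h => by cases h⟩, .inr ⟨rfl, trivial⟩⟩
    convert UERRF.solves_of_den hex ht (UERRF.freeP_spec ⟨hC, hin, fun h => by cases h⟩ hs) using 2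
    simp [UERRF.IsValid]
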